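/- Let $n\ge 2$ and let $R_n$ be the rose with $n$ petals, i.e. the graph with one vertex and $n$ topological (unoriented) edges, all of them loops. Graphs are one-dimensional cell complexes; graph morphisms send vertices to vertices and edges homeomorphically to edges. Let $\Omega$ be the set of all reduced edge-paths in $R_n$ (those with no subpath $e\,e^{-1}$) and $\Omega_N$ the set of those of length $N$; a subset $S\subseteq\Omega$ is called generic if $\lim_{N\to\infty}|S\cap\Omega_N|/|\Omega_N|=1$. An edge-path $\gamma$ in a graph is called $\alpha$-injective if it crosses at least $\alpha\cdot|\gamma|$ distinct topological edges. **Theorem.** Let $\alpha\in[0,1)$. There is a generic subset $S\subseteq\Omega$, depending only on $n$ and $\alpha$, with the following property. Let $\Gamma$ be a connected graph with a vertex $v_0$ such that no proper subgraph of $\Gamma$ containing $v_0$ has the property that its inclusion into $\Gamma$ is a homotopy equivalence (that is, $(\Gamma,v_0)$ is a connected core graph). Suppose that the first Betti number of $\Gamma$ satisfies $b(\Gamma)\le 2n-1$. Let $f:\Gamma\to R_n$ be a morphism of graphs such that there is no subgraph $\Gamma'\subseteq\Gamma$ for which $f|_{\Gamma'}:\Gamma'\to R_n$ is a covering of degree $1$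 or $2$. Then for every $s\in S$, every edge-path $\tilde s$ in $\Gamma$ with $f(\tilde s)=s$ is $\alpha$-injective. -/

import Mathlib

open Filter Topology

universe u v u₁ v₁ u₂ v₂

/-- A graph (one-dimensional cell complex), in combinatorial form: vertices, oriented edges, the
fixed-point-free involution `e ↦ e⁻¹` on the oriented edges, and the initial vertex of an
oriented edge. Loops and multiple edges are allowed, and the graph may be infinite. -/
structure SGraph where
  V : Type u
  E : Type v
  inv : E → E
  inv_inv : ∀ e, inv (inv e) = e
  inv_ne : ∀ e, inv e ≠ e
  ini : E → V

namespace SGraph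

/-- The terminal vertex of an oriented edge. -/
def ter (Γ : SGraph.{u, v}) (e : Γ.E) : Γ.V := Γ.ini (Γ.inv e)

/-- The topological edge underlying an oriented edge `e`: the unordered pair `{e, e⁻¹}`. -/
def topEdge (Γ : SGraph.{u, v}) (e : Γ.E) : Sym2 Γ.E := s(e, Γ.inv e)

/-! ### Edge-paths -/

/-- `Γ.IsPathFrom x l`: the consecutive oriented edges in `l` form an edge-path starting at `x`. -/
def IsPathFrom (Γ : SGraph.{u, v}) : Γ.V → List Γ.E → Prop
  | _, [] => True
  | x, e :: l => Γ.ini e = x ∧ Γ.IsPathFrom (Γ.ter e) l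

/-- The vertex at which the sequence of edges `l`, started at `x`, ends. -/
def finishFrom (Γ : SGraph.{u, v}) : Γ.V → List Γ.E → Γ.V
  | x, [] => x
  | _, e :: l => Γ.finishFrom (Γ.ter e) l

/-- An edge-path. The starting vertex is recorded so that there is exactly one path of length `0`
at every vertex; for a path of positive length it is determined by the edges. -/
@[ext]
structure EdgePath (Γ : SGraph.{u, v}) where
  start : Γ.V
  edges : List Γ.E
  isPath : Γ.IsPathFrom start edges

namespace EdgePath

variable {Γ : SGraph.{u, v}}

/-- The length of an edge-path. -/
def length (p : Γ.EdgePath) : ℕ := p.edges.length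

/-- The terminal vertex of an edge-path. -/
def finish (p : Γ.EdgePath) : Γ.V := Γ.finishFrom p.start p.edges

/-- A path is reduced if it has no subpath `e, e⁻¹`. -/
def IsReduced (p : Γ.EdgePath) : Prop :=
  ∀ (l₁ l₂ : List Γ.E) (e : Γ.E), p.edges ≠ l₁ ++ e :: Γ.inv e :: l₂

/-- The set of topological edges crossed by a path. -/
def crossed (p : Γ.EdgePath) : Set (Sym2 Γ.E) := {x | ∃ e ∈ p.edges, Γ.topEdge e = x}

/-- A path `p` is `α`-injective if it crosses at least `α * |p|` distinct topological edges. -/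
def IsAlphaInjective (α : ℝ) (p : Γ.EdgePath) : Prop :=
  α * (p.length : ℝ) ≤ (p.crossed.ncard : ℝ)

/-- `q` arises from `p` by deleting one subpath `e, e⁻¹`. -/
def Step (p q : Γ.EdgePath) : Prop :=
  p.start = q.start ∧ ∃ (l₁ l₂ : List Γ.E) (e : Γ.E),
    p.edges = l₁ ++ e :: Γ.inv e :: l₂ ∧ q.edges = l₁ ++ l₂

/-- Homotopy of edge-paths relative to the endpoints: the equivalence relation generated by
deleting and inserting subpaths `e, e⁻¹`. -/
def Homotopic (p q : Γ.EdgePath) : Prop := Relation.EqvGen Step p q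

end EdgePath

/-- A graph is connected if it is nonempty and any two vertices are joined by an edge-path. -/
def Connected (Γ : SGraph.{u, v}) : Prop :=
  Nonempty Γ.V ∧ ∀ x y : Γ.V, ∃ p : Γ.EdgePath, p.start = x ∧ p.finish = y

/-! ### Morphisms -/

/-- A morphism of graphs: it sends vertices to vertices and oriented edges to oriented edges,
compatibly with edge inversion and initial (hence terminal) vertices. -/
structure Mor (Γ : SGraph.{u₁, v₁}) (Δ : SGraph.{u₂, v₂}) where
  onV : Γ.V → Δ.V
  onE : Γ.E → Δ.E
  map_inv : ∀ e, onE (Γ.inv e) = Δ.inv (onE e)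
  map_ini : ∀ e, onV (Γ.ini e) = Δ.ini (onE e)

namespace Mor

variable {Γ : SGraph.{u₁, v₁}} {Δ : SGraph.{u₂, v₂}}

theorem map_ter (f : Mor Γ Δ) (e : Γ.E) : f.onV (Γ.ter e) = Δ.ter (f.onE e) := by
  unfold ter
  rw [f.map_ini, f.map_inv]

theorem isPathFrom_map (f : Mor Γ Δ) (l : List Γ.E) :
    ∀ x : Γ.V, Γ.IsPathFrom x l → Δ.IsPathFrom (f.onV x) (l.map f.onE) := by
  induction l with
  | nil => intro x _; trivial
  | cons e l ih =>
    intro x h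
    refine ⟨?_, ?_⟩
    · rw [← f.map_ini, h.1]
    · rw [← f.map_ter]
      exact ih _ h.2

/-- The image of an edge-path. A path `p` is a lift of `q` if `f.mapPath p = q`. -/
def mapPath (f : Mor Γ Δ) (p : Γ.EdgePath) : Δ.EdgePath where
  start := f.onV p.start
  edges := p.edges.map f.onE
  isPath := f.isPathFrom_map p.edges p.start p.isPath

/-- A morphism is a covering if it is surjective and locally bijective: at every vertex `x` it
maps the edges starting at `x` bijectively onto the edges starting at the image of `x`. -/
def IsCovering (f : Mor Γ Δ) : Prop :=
  Function.Surjective f.onV ∧ Function.Surjective f.onE ∧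
    ∀ x : Γ.V, Set.BijOn f.onE {e | Γ.ini e = x} {e | Δ.ini e = f.onV x}

/-- A covering of degree `d`: every vertex has exactly `d` preimages. -/
def IsCoveringOfDegree (f : Mor Γ Δ) (d : ℕ) : Prop :=
  f.IsCovering ∧ ∀ y : Δ.V, (f.onV ⁻¹' {y}).encard = d

/-- A morphism of graphs is a homotopy equivalence. Since graphs are aspherical, this means that
it induces an equivalence of fundamental groupoids (homotopy classes of edge-paths): it is
essentially surjective, full and faithful. -/
def IsHomotopyEquiv (f : Mor Γ Δ) : Prop :=
  (∀ y : Δ.V, ∃ (x : Γ.V) (p : Δ.EdgePath), p.start = f.onV x ∧ p.finish = y) ∧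
  (∀ (x x' : Γ.V) (p : Δ.EdgePath), p.start = f.onV x → p.finish = f.onV x' →
    ∃ q : Γ.EdgePath, q.start = x ∧ q.finish = x' ∧ (f.mapPath q).Homotopic p) ∧
  (∀ q q' : Γ.EdgePath, q.start = q'.start → q.finish = q'.finish →
    (f.mapPath q).Homotopic (f.mapPath q') → q.Homotopic q')

end Mor

/-! ### Subgraphs -/

/-- A subgraph: a set of vertices and an inversion-invariant set of oriented edges, all of whose
endpoints belong to the set of vertices. -/
structure Sub (Γ : SGraph.{u, v}) where
  verts : Set Γ.V
  edges : Set Γ.E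
  inv_mem : ∀ e ∈ edges, Γ.inv e ∈ edges
  ini_mem : ∀ e ∈ edges, Γ.ini e ∈ verts

namespace Sub

variable {Γ : SGraph.{u₁, v₁}} {Δ : SGraph.{u₂, v₂}}

/-- A subgraph as a graph in its own right. -/
def toGraph (Γ' : Γ.Sub) : SGraph.{u₁, v₁} where
  V := Γ'.verts
  E := Γ'.edges
  inv e := ⟨Γ.inv e.1, Γ'.inv_mem e.1 e.2⟩
  inv_inv e := Subtype.ext (Γ.inv_inv e.1)
  inv_ne e h := Γ.inv_ne e.1 (congrArg Subtype.val h)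
  ini e := ⟨Γ.ini e.1, Γ'.ini_mem e.1 e.2⟩

/-- The inclusion of a subgraph. -/
def incl (Γ' : Γ.Sub) : Mor Γ'.toGraph Γ where
  onV x := x.1
  onE e := e.1
  map_inv _ := rfl
  map_ini _ := rfl

/-- The restriction of a morphism to a subgraph. -/
def restrict (Γ' : Γ.Sub) (f : Mor Γ Δ) : Mor Γ'.toGraph Δ where
  onV x := f.onV x.1
  onE e := f.onE e.1
  map_inv e := f.map_inv e.1
  map_ini e := f.map_ini e.1

/-- A subgraph is proper if it is not the whole graph. -/
def IsProper (Γ' : Γ.Sub) : Prop := ¬ (Γ'.verts = Set.univ ∧ Γ'.edges = Set.univ)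

end Sub

/-- `(Γ, x)` is a connected core graph (with respect to the vertex `x`): `Γ` is connected and no
proper subgraph of `Γ` containing `x` is such that its inclusion is a homotopy equivalence. -/
def IsCorePair (Γ : SGraph.{u, v}) (x : Γ.V) : Prop :=
  Γ.Connected ∧ ∀ Γ' : Γ.Sub, x ∈ Γ'.verts → Γ'.IsProper → ¬ Γ'.incl.IsHomotopyEquiv

/-! ### The first Betti number -/

/-- The first homology of `Γ` with rational coefficients, as the space of simplicial 1-cycles.
A 1-chain is a finitely supported function `c` on oriented edges with `c e⁻¹ = -c e`, and the
boundary of an oriented edge `e` is `ter e - ini e`. -/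
noncomputable def cycles (Γ : SGraph.{u, v}) : Submodule ℚ (Γ.E →₀ ℚ) :=
  LinearMap.ker (Finsupp.lmapDomain ℚ ℚ Γ.inv + LinearMap.id) ⊓
    LinearMap.ker (Finsupp.lmapDomain ℚ ℚ Γ.ter - Finsupp.lmapDomain ℚ ℚ Γ.ini)

/-- The first Betti number of `Γ` (a cardinal, so that it is meaningful for every graph). -/
noncomputable def betti (Γ : SGraph.{u, v}) : Cardinal.{v} := Module.rank ℚ Γ.cycles

/-! ### The rose and its reduced paths -/

/-- The rose with `n` petals: one vertex, and `n` loops `e_i`. The oriented edge `(i, true)` is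
`e_i` and `(i, false)` is its inverse. -/
def rose (n : ℕ) : SGraph.{0, 0} where
  V := Unit
  E := Fin n × Bool
  inv e := (e.1, !e.2)
  inv_inv e := by simp
  inv_ne e h := by simpa using congrArg Prod.snd h
  ini _ := ()

/-- The set `Ω` of all reduced paths in the rose with `n` petals. -/
def reducedPaths (n : ℕ) : Set (rose n).EdgePath := {s | s.IsReduced}

/-- The set `Ω_N` of all reduced paths of length `N` in the rose with `n` petals. -/
def reducedPathsOfLength (n N : ℕ) : Set (rose n).EdgePath := {s | s.IsReduced ∧ s.length = N}

/-- A set `S` of reduced paths in the rose is generic if `|S ∩ Ω_N| / |Ω_N| → 1`. -/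
def IsGeneric (n : ℕ) (S : Set (rose n).EdgePath) : Prop :=
  S ⊆ reducedPaths n ∧
    Tendsto (fun N : ℕ => ((S ∩ reducedPathsOfLength n N).ncard : ℝ) /
      ((reducedPathsOfLength n N).ncard : ℝ)) atTop (𝓝 1)

end SGraph

/-! # Generic words lift injectively -/

/-! ## Labelled graphs -/

namespace Labelled

open scoped Classical

/-! Why the theorem holds. A graph over the rose is treated as a labelled graph, and lifting a word
means reading it along a path. Suppose that a reduced word of length `N` has a lift crossing fewer
than `α * N` edges, and let `T` be the finite connected graph traced by the lift. The Betti bound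
gives `exc T ≤ 2 * n - 2` (`exc_le_of_betti`).

The structural half is `hasRose_or_hasDouble`: a connected graph of such small excess that reads
every reduced word contains a covering of degree one or two. The proof is an induction on the
alphabet. For disjoint alphabets the components that read all words in one of them form two
edge-disjoint subgraphs which meet in pivots, and additivity of the Euler characteristic gives
`Split.exc_le`: the two excesses and the number of pivots add up to at most the excess of `T`. When
this is sharp, reduced paths between the two subgraphs cannot leave them (`Split.stay`), so single
letters and prescribed words act on the pivots. The case of two labels is `Split.pair`. In the
induction step a double cover with a swapping label extends over the missing label
(`Split.hasDouble_insert`), and roses for all the alphabets with one label removed must share a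
vertex (`hasRose_of_forall_erase`). As no covering of degree one or two is available, `T` misses a
reduced word.

The counting half shows that such words are exponentially rare. A walk without backtracking can turn
from new edges to old ones only after a closing step, that is, a new edge to an old vertex, and
there are at most `2 * n - 1` of these. So some run of old edges has length `m` proportional to `N`
(`NamedWalk.exists_old_run`). The graph traced before the run is a union of at most `2 * n - 1`
arcs, determined by the prefix of the word and boundedly many integers up to `N`
(`NamedWalk.exists_arcs`). It still misses a word, so by `exists_sparse_bound` it reads at most
about `N * μ ^ m` words of length `m`, with `μ < 2 * n - 1` depending on `n` alone. Against the
roughly `(2 * n - 1) ^ m` reduced words this beats the polynomial number of choices (`tendsto_bad`).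

The uniformity of `μ`, although arcs may be arbitrarily long, comes from a renewal argument. At a
suitable scale the edges leaving the branch points either return soon, and those returns span a core
of bounded size that misses a word, or do not return for a very long time, during which the path is
forced. -/

/-- Letters: the oriented edges of the rose. -/
abbrev Letter (n : ℕ) := Fin n × Bool

variable {V : Type*} {W : Type*} {n : ℕ}

/-- The inverse letter. -/
def linv (l : Letter n) : Letter n := (l.1, !l.2)

@[simp] theorem linv_linv (l : Letter n) : linv (linv l) = l := by simp [linv]

@[simp] theorem linv_fst (l : Letter n) : (linv l).1 = l.1 := rfl

theorem linv_ne (l : Letter n) : linv l ≠ l := fun h => by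
  have := congrArg Prod.snd h
  simp [linv] at this

theorem eq_linv_comm {a b : Letter n} : a = linv b ↔ b = linv a := by
  constructor <;> rintro rfl <;> simp

/-- The topological edge traversed when the letter `l` is read from `x` to `y`. A labelled graph
is a finite set of triples `(x, i, y)`, the edges from `x` to `y` with label `i`. -/
def tri (x : V) (l : Letter n) (y : V) : V × Fin n × V := if l.2 then (x, l.1, y) else (y, l.1, x)

theorem tri_linv (x : V) (l : Letter n) (y : V) : tri y (linv l) x = tri x l y := by
  obtain ⟨i, b⟩ := l
  cases b <;> simp [tri, linv]

theorem tri_label (x : V) (l : Letter n) (y : V) : (tri x l y).2.1 = l.1 := by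
  unfold tri; split_ifs <;> rfl

theorem tri_eq {x y x' y' : V} {l l' : Letter n} (h : tri x l y = tri x' l' y') :
    (x = x' ∧ l = l' ∧ y = y') ∨ (x = y' ∧ y = x' ∧ l' = linv l) := by
  obtain ⟨i, b⟩ := l
  obtain ⟨i', b'⟩ := l'
  cases b <;> cases b' <;> simp_all [tri, linv]

/-- `Reads T x w y`: some path from `x` to `y` in `T` is labelled by the word `w`. -/
def Reads (T : Finset (V × Fin n × V)) : V → List (Letter n) → V → Prop
  | x, [], y => x = y
  | x, l :: w, y => ∃ z, tri x l z ∈ T ∧ Reads T z w y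

/-- Reduced words. -/
def Red (w : List (Letter n)) : Prop := w.IsChain (fun a b => b ≠ linv a)

/-- The inverse word. -/
def winv (w : List (Letter n)) : List (Letter n) := (w.map linv).reverse

/-- The vertices of a labelled graph. -/
noncomputable def verts (T : Finset (V × Fin n × V)) : Finset V :=
  T.image (fun e => e.1) ∪ T.image (fun e => e.2.2)

/-- The number of edges minus the number of vertices. -/
noncomputable def exc (T : Finset (V × Fin n × V)) : ℤ := (T.card : ℤ) - ((verts T).card : ℤ)

section basic

variable {T T' : Finset (V × Fin n × V)} {x y z : V} {w w' : List (Letter n)} {l : Letter n}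

theorem mem_verts {v : V} : v ∈ verts T ↔ ∃ e ∈ T, e.1 = v ∨ e.2.2 = v := by
  simp only [verts, Finset.mem_union, Finset.mem_image]
  constructor
  · rintro (⟨e, he, h⟩ | ⟨e, he, h⟩)
    exacts [⟨e, he, .inl h⟩, ⟨e, he, .inr h⟩]
  · rintro ⟨e, he, h | h⟩
    exacts [.inl ⟨e, he, h⟩, .inr ⟨e, he, h⟩]

theorem fst_mem_verts {e : V × Fin n × V} (h : e ∈ T) : e.1 ∈ verts T :=
  mem_verts.2 ⟨e, h, .inl rfl⟩

theorem snd_mem_verts {e : V × Fin n × V} (h : e ∈ T) : e.2.2 ∈ verts T :=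
  mem_verts.2 ⟨e, h, .inr rfl⟩

theorem verts_mono (h : T ⊆ T') : verts T ⊆ verts T' := by
  intro v hv
  obtain ⟨e, he, h'⟩ := mem_verts.1 hv
  exact mem_verts.2 ⟨e, h he, h'⟩

theorem left_mem_of {U : Finset V} (hU : ∀ e ∈ T, e.1 ∈ U ∧ e.2.2 ∈ U) (h : tri x l y ∈ T) :
    x ∈ U ∧ y ∈ U := by
  have := hU _ h
  unfold tri at this
  split_ifs at this
  exacts [this, this.symm]

theorem left_mem_verts (h : tri x l y ∈ T) : x ∈ verts T :=
  (left_mem_of (fun _ he => ⟨fst_mem_verts he, snd_mem_verts he⟩) h).1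

theorem right_mem_verts (h : tri x l y ∈ T) : y ∈ verts T :=
  (left_mem_of (fun _ he => ⟨fst_mem_verts he, snd_mem_verts he⟩) h).2

theorem exists_tri_of_mem_verts (h : x ∈ verts T) : ∃ l y, tri x l y ∈ T := by
  obtain ⟨e, he, rfl | rfl⟩ := mem_verts.1 h
  · exact ⟨(e.2.1, true), e.2.2, he⟩
  · exact ⟨(e.2.1, false), e.1, he⟩

theorem reads_append : Reads T x (w ++ w') y ↔ ∃ z, Reads T x w z ∧ Reads T z w' y := by
  induction w generalizing x with
  | nil => simp [Reads]
  | cons l w ih =>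
    simp only [List.cons_append, Reads, ih]
    constructor
    · rintro ⟨z, h, z', h1, h2⟩
      exact ⟨z', ⟨z, h, h1⟩, h2⟩
    · rintro ⟨z', ⟨z, h, h1⟩, h2⟩
      exact ⟨z, h, z', h1, h2⟩

theorem reads_singleton : Reads T x [l] y ↔ tri x l y ∈ T := by simp [Reads]

theorem Reads.mono (h : T ⊆ T') (hr : Reads T x w y) : Reads T' x w y := by
  induction w generalizing x with
  | nil => exact hr
  | cons l w ih =>
    obtain ⟨z, h1, h2⟩ := hr
    exact ⟨z, h h1, ih h2⟩

theorem Reads.symm (hr : Reads T x w y) : Reads T y (winv w) x := by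
  induction w generalizing x with
  | nil => exact Eq.symm hr
  | cons l w ih =>
    obtain ⟨z, h1, h2⟩ := hr
    simp only [winv, List.map_cons, List.reverse_cons]
    exact reads_append.2 ⟨z, ih h2, reads_singleton.2 (by rwa [tri_linv])⟩

theorem Reads.map {S : Finset (W × Fin n × W)} (g : V → W)
    (hg : ∀ e ∈ T, (g e.1, e.2.1, g e.2.2) ∈ S) (hr : Reads T x w y) :
    Reads S (g x) w (g y) := by
  induction w generalizing x with
  | nil => exact congrArg g hr
  | cons l w ih =>
    obtain ⟨z, h1, h2⟩ := hr
    refine ⟨g z, ?_, ih h2⟩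
    have := hg _ h1
    unfold tri at this ⊢
    split_ifs at this ⊢ <;> exact this

theorem Reads.start_mem (hr : Reads T x w y) (hw : w ≠ []) : x ∈ verts T := by
  cases w with
  | nil => exact absurd rfl hw
  | cons l w =>
    obtain ⟨z, h1, -⟩ := hr
    exact left_mem_verts h1

theorem winv_ne_nil (hw : w ≠ []) : winv w ≠ [] := by simpa [winv] using hw

theorem Reads.end_mem (hr : Reads T x w y) (hw : w ≠ []) : y ∈ verts T :=
  hr.symm.start_mem (winv_ne_nil hw)

theorem Reads.end_mem_of_start_mem (hr : Reads T x w y) (hx : x ∈ verts T) : y ∈ verts T := by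
  by_cases hw : w = []
  · subst hw; exact (show x = y from hr) ▸ hx
  · exact hr.end_mem hw

theorem Reads.of_label {I : Finset (Fin n)} (hr : Reads T x w y) (hw : ∀ l ∈ w, l.1 ∈ I) :
    Reads (T.filter (fun e => e.2.1 ∈ I)) x w y := by
  induction w generalizing x with
  | nil => exact hr
  | cons l w ih =>
    obtain ⟨z, h1, h2⟩ := hr
    refine ⟨z, Finset.mem_filter.2 ⟨h1, ?_⟩, ih h2 fun l' hl' => hw l' (List.mem_cons_of_mem _ hl')⟩
    rw [tri_label]
    exact hw l List.mem_cons_self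

theorem Red.tail (h : Red (l :: w)) : Red w := by
  rw [Red, List.isChain_cons] at h
  exact h.2

theorem red_cons_cons {a b : Letter n} : Red (a :: b :: w) ↔ b ≠ linv a ∧ Red (b :: w) := by
  simp [Red]

theorem red_append : Red (w ++ w') ↔
    Red w ∧ Red w' ∧ ∀ a ∈ w.getLast?, ∀ b ∈ w'.head?, b ≠ linv a := List.isChain_append

theorem Red.infix (h : Red w) (h' : w' <:+: w) : Red w' := List.IsChain.infix h h'

theorem Red.winv (h : Red w) : Red (winv w) := by
  unfold Red Labelled.winv
  rw [List.isChain_reverse, List.isChain_map]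
  refine List.IsChain.imp (fun a b hab => ?_) h
  intro h'
  apply hab
  rw [h']
  simp

theorem red_nil : Red ([] : List (Letter n)) := by simp [Red]

theorem red_singleton (a : Letter n) : Red [a] := by simp [Red]

theorem red_replicate (a : Letter n) (k : ℕ) : Red (List.replicate k a) :=
  List.isChain_replicate_of_rel _ (linv_ne a).symm

end basic


/-! ### Relative Euler characteristic and forests outside a subgraph -/

section forest

variable {T X : Finset (V × Fin n × V)} {U Y : Finset V}

/-- A path that leaves the subgraph through parent edges keeps moving away from it. -/
theorem Reads.climb {d : V → ℕ} {π : V → V × Fin n × V} (hX : ∀ e ∈ X, e.1 ∈ U ∧ e.2.2 ∈ U)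
    (hπ : ∀ v ∈ Y \ U, ∃ z l, π v = tri z l v ∧ d v = d z + 1)
    (hsurj : ∀ e ∈ T \ X, ∃ v ∈ Y \ U, π v = e) (w : List (Letter n)) :
    ∀ (u v z : V) (l : Letter n), v ∉ U → tri u l v = π v → d v = d u + 1 → Red (l :: w) →
      Reads T v w z → d z = d v + w.length := by
  induction w with
  | nil =>
    intro u v z l _ _ _ _ hr
    rw [show v = z from hr]
    simp
  | cons l' w ih =>
    intro u v z l hv h1 h2 hred hr
    obtain ⟨v', h3, h4⟩ := hr
    obtain ⟨t, ht, h5⟩ := hsurj _ (Finset.mem_sdiff.2 ⟨h3, fun h => hv (left_mem_of hX h).1⟩)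
    obtain ⟨z0, l0, h6, h7⟩ := hπ t ht
    obtain ⟨h8, h9⟩ := red_cons_cons.1 hred
    rcases tri_eq (h5.symm.trans h6) with ⟨h10, h11, h12⟩ | ⟨h10, h11, h12⟩
    · subst h10 h11 h12
      have := ih v v' z l' (Finset.mem_sdiff.1 ht).2 h5.symm h7 h9 h4
      simp only [List.length_cons]
      omega
    -- The next edge would be the parent edge of the current vertex, which is the edge just crossed;
    -- this would be backtracking.
    · subst h10 h11
      rcases tri_eq (h1.trans h5) with ⟨h13, -, -⟩ | ⟨-, -, h13⟩
      · subst h13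
        omega
      · exact absurd h13 h8

variable [NeZero n]

/-- Every vertex of `Y \ U` has a parent edge, the first edge of a shortest path to `U`. -/
theorem exists_parent (hX : ∀ e ∈ X, e.1 ∈ U ∧ e.2.2 ∈ U)
    (hreach : ∀ v ∈ Y, ∃ u ∈ U, ∃ w, Reads T u w v) :
    ∃ (d : V → ℕ) (π : V → V × Fin n × V), (∀ u ∈ U, d u = 0) ∧
      (∀ v ∈ Y \ U, d v ≠ 0) ∧
      (∀ v ∈ Y \ U, π v ∈ T \ X ∧ ∃ z l, π v = tri z l v ∧ d v = d z + 1) ∧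
      Set.InjOn π (Y \ U : Finset V) := by
  -- `D v` holds the lengths of paths from `U` to `v`, and its infimum is the distance from `U`.
  set D : V → Set ℕ := fun v => {k | ∃ u ∈ U, ∃ w : List (Letter n), w.length = k ∧ Reads T u w v}
    with hD
  have hne : ∀ v ∈ Y, (D v).Nonempty := by
    intro v hv
    obtain ⟨u, hu, w, hw⟩ := hreach v hv
    exact ⟨_, u, hu, w, rfl, hw⟩
  have h0 : ∀ u ∈ U, sInf (D u) = 0 := fun u hu =>
    Nat.sInf_eq_zero.2 (.inl ⟨u, hu, [], rfl, rfl⟩)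
  have hpar : ∀ v ∈ Y \ U, ∃ e, e ∈ T \ X ∧ ∃ z l, e = tri z l v ∧ sInf (D v) = sInf (D z) + 1 := by
    intro v hv
    obtain ⟨hvY, hvU⟩ := Finset.mem_sdiff.1 hv
    obtain ⟨u, hu, w, hw, hr⟩ := Nat.sInf_mem (hne v hvY)
    rcases List.eq_nil_or_concat w with rfl | ⟨w', l, rfl⟩
    · exact absurd ((show u = v from hr) ▸ hu) hvU
    · rw [List.concat_eq_append] at hr hw
      obtain ⟨z, h1, h2⟩ := reads_append.1 hr
      rw [reads_singleton] at h2
      refine ⟨_, Finset.mem_sdiff.2 ⟨h2, fun h => hvU (left_mem_of hX h).2⟩, z, l, rfl, ?_⟩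
      have ha : sInf (D z) ≤ w'.length := Nat.sInf_le ⟨u, hu, w', rfl, h1⟩
      obtain ⟨u', hu', w'', hw'', hr''⟩ := Nat.sInf_mem (s := D z) ⟨_, u, hu, w', rfl, h1⟩
      have hb : sInf (D v) ≤ w''.length + 1 :=
        Nat.sInf_le ⟨u', hu', w'' ++ [l], by simp,
          reads_append.2 ⟨z, hr'', reads_singleton.2 h2⟩⟩
      simp only [List.length_append, List.length_singleton] at hw
      omega
  have : V → Nonempty (V × Fin n × V) := fun v => ⟨(v, 0, v)⟩
  choose! π hπ1 hπ2 using hpar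
  refine ⟨fun v => sInf (D v), π, h0, ?_, fun v hv => ⟨hπ1 v hv, hπ2 v hv⟩, ?_⟩
  · intro v hv
    obtain ⟨z, l, -, h⟩ := hπ2 v hv
    dsimp only
    omega
  · intro v hv v' hv' heq
    obtain ⟨z, l, h1, h2⟩ := hπ2 v hv
    obtain ⟨z', l', h1', h2'⟩ := hπ2 v' hv'
    -- If one edge were the parent edge of both of its ends, each end would be farther from `U` than
    -- the other.
    rcases tri_eq (h1.symm.trans (heq.trans h1')) with ⟨-, -, h⟩ | ⟨h3, h4, -⟩
    · exact h
    · subst h3 h4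
      omega

/-- Relative Euler characteristic: outside of a subgraph `(U, X)` from which everything can be
reached there are at least as many edges, even without loops, as vertices. -/
theorem card_sdiff_le_nonloop (hX : ∀ e ∈ X, e.1 ∈ U ∧ e.2.2 ∈ U)
    (hreach : ∀ v ∈ Y, ∃ u ∈ U, ∃ w, Reads T u w v) :
    (Y \ U).card ≤ ((T \ X).filter (fun e => e.1 ≠ e.2.2)).card := by
  obtain ⟨d, π, -, -, h3, h4⟩ := exists_parent hX hreach
  refine Finset.card_le_card_of_injOn π (fun v hv => ?_) h4
  obtain ⟨h, z, l, h5, h6⟩ := h3 v hv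
  -- The distance grows by one along a parent edge, so a parent edge is not a loop.
  refine Finset.mem_coe.2 (Finset.mem_filter.2 ⟨h, fun h7 => ?_⟩)
  have : z = v := by
    rw [h5] at h7
    unfold tri at h7
    split_ifs at h7
    exacts [h7, h7.symm]
  subst this
  omega

theorem card_sdiff_le (hX : ∀ e ∈ X, e.1 ∈ U ∧ e.2.2 ∈ U)
    (hreach : ∀ v ∈ Y, ∃ u ∈ U, ∃ w, Reads T u w v) :
    (Y \ U).card ≤ (T \ X).card :=
  (card_sdiff_le_nonloop hX hreach).trans (Finset.card_filter_le _ _)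

/-- In the case of equality in `card_sdiff_le` the injection of vertices to parent edges is onto. So
outside of `X` the graph is a forest rooted at `U` and graded by the distance. -/
theorem exists_tight (hX : ∀ e ∈ X, e.1 ∈ U ∧ e.2.2 ∈ U)
    (hreach : ∀ v ∈ Y, ∃ u ∈ U, ∃ w, Reads T u w v) (hcard : (T \ X).card ≤ (Y \ U).card) :
    ∃ (d : V → ℕ) (π : V → V × Fin n × V), (∀ u ∈ U, d u = 0) ∧
      (∀ v ∈ Y \ U, d v ≠ 0) ∧
      (∀ v ∈ Y \ U, ∃ z l, π v = tri z l v ∧ d v = d z + 1) ∧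
      (∀ e ∈ T \ X, ∃ v ∈ Y \ U, π v = e) := by
  obtain ⟨d, π, h1, h2, h3, h4⟩ := exists_parent hX hreach
  refine ⟨d, π, h1, h2, fun v hv => (h3 v hv).2, fun e he => ?_⟩
  obtain ⟨v, hv, h⟩ := Finset.surj_on_of_inj_on_of_card_le (fun v _ => π v) (fun v hv => (h3 v hv).1)
    (fun a b ha hb hab => h4 ha hb hab) hcard e he
  exact ⟨v, hv, h.symm⟩

/-- If there are as many edges as vertices outside of `(U, X)`, reduced paths between vertices of
`U` stay in `X`. -/
theorem Reads.stay (hX : ∀ e ∈ X, e.1 ∈ U ∧ e.2.2 ∈ U)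
    (hreach : ∀ v ∈ Y, ∃ u ∈ U, ∃ w, Reads T u w v) (hcard : (T \ X).card ≤ (Y \ U).card)
    {w : List (Letter n)} (hw : Red w) {x y : V} (hx : x ∈ U) (hy : y ∈ U) (hr : Reads T x w y) :
    Reads X x w y := by
  obtain ⟨d, π, h1, h2, h3, h4⟩ := exists_tight hX hreach hcard
  induction w generalizing x with
  | nil => exact hr
  | cons l w ih =>
    obtain ⟨z, h5, h6⟩ := hr
    by_cases hXe : tri x l z ∈ X
    · exact ⟨z, hXe, ih hw.tail (left_mem_of hX hXe).2 h6⟩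
    -- The first edge outside of `X` starts in `U`, so it is a parent edge crossed away from `U`.
    -- From there on the distance increases, whereas it is zero at `y`.
    · exfalso
      obtain ⟨t, ht, h7⟩ := h4 _ (Finset.mem_sdiff.2 ⟨h5, hXe⟩)
      obtain ⟨z0, l0, h8, h9⟩ := h3 t ht
      have htU := (Finset.mem_sdiff.1 ht).2
      rcases tri_eq (h7.symm.trans h8) with ⟨h10, h11, h12⟩ | ⟨h10, h11, h12⟩
      · subst h10 h11 h12
        have := Reads.climb hX h3 h4 w x z y l htU h7.symm h9 hw h6
        rw [h1 y hy] at this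
        have := h2 z ht
        omega
      · subst h10
        exact htU hx

/-- In the situation of `Reads.stay`, from a vertex outside of `U` only bounded words can be read
unless they begin with the one letter that leads back to `U`. -/
theorem exists_return_letter (hX : ∀ e ∈ X, e.1 ∈ U ∧ e.2.2 ∈ U)
    (hreach : ∀ v ∈ Y, ∃ u ∈ U, ∃ w, Reads T u w v) (hcard : (T \ X).card ≤ (Y \ U).card) :
    ∃ (M : ℕ) (p : V → Letter n), ∀ z ∈ Y \ U, ∀ f w z', z' ∈ Y → Red (f :: w) → f ≠ p z →
      Reads T z (f :: w) z' → w.length < M := by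
  obtain ⟨d, π, h1, h2, h3, h4⟩ := exists_tight hX hreach hcard
  -- The exceptional letter at `z` is that of its parent edge, read towards `U`. A reduced path
  -- beginning with any other letter climbs, so the largest distance in `Y` bounds its length.
  have : ∀ z : V, ∃ l : Letter n, z ∈ Y \ U → ∃ z0, π z = tri z l z0 ∧ d z = d z0 + 1 := by
    intro z
    by_cases hz : z ∈ Y \ U
    swap
    · exact ⟨(0, true), fun h => absurd h hz⟩
    obtain ⟨z0, l, h5, h6⟩ := h3 z hz
    exact ⟨linv l, fun _ => ⟨z0, by rw [tri_linv, h5], h6⟩⟩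
  choose p hp using this
  refine ⟨Y.sup d, p, fun z hz f w z' hz' hred hne hr => ?_⟩
  obtain ⟨v, h5, h6⟩ := hr
  obtain ⟨z0, h7, h8⟩ := hp z hz
  obtain ⟨t, ht, h9⟩ := h4 _ (Finset.mem_sdiff.2 ⟨h5, fun h =>
    (Finset.mem_sdiff.1 hz).2 (left_mem_of hX h).1⟩)
  obtain ⟨z1, l1, h10, h11⟩ := h3 t ht
  rcases tri_eq (h9.symm.trans h10) with ⟨h12, h13, h14⟩ | ⟨h12, h13, h14⟩
  · subst h12 h13 h14
    have := Reads.climb hX h3 h4 w z v z' f (Finset.mem_sdiff.1 ht).2 h9.symm h11 hred h6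
    have h15 : d z' ≤ Y.sup d := Finset.le_sup hz'
    omega
  · subst h12 h13
    exfalso
    rcases tri_eq (h9.symm.trans h7) with ⟨-, h, -⟩ | ⟨h, -, -⟩
    · exact hne h
    · subst h
      omega

end forest


/-! ### Components that read all words over a sub-alphabet -/

/-- A labelled graph reads a word if the word labels some path. -/
def Readable (T : Finset (V × Fin n × V)) (w : List (Letter n)) : Prop := ∃ x y, Reads T x w y

/-- All reduced words with labels in `J` can be read. -/
def AllReads (J : Finset (Fin n)) (T : Finset (V × Fin n × V)) : Prop :=
  ∀ w : List (Letter n), w ≠ [] → Red w → (∀ l ∈ w, l.1 ∈ J) → Readable T w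

/-- Connectedness of a labelled graph. -/
def Conn (T : Finset (V × Fin n × V)) : Prop := ∀ x ∈ verts T, ∀ y ∈ verts T, ∃ w, Reads T x w y

/-- The edges with labels in `J`. -/
noncomputable def restr (J : Finset (Fin n)) (T : Finset (V × Fin n × V)) :
    Finset (V × Fin n × V) := T.filter (fun e => e.2.1 ∈ J)

/-- The connected component of a vertex. -/
noncomputable def comp (T : Finset (V × Fin n × V)) (x : V) : Finset (V × Fin n × V) :=
  T.filter (fun e => ∃ w, Reads T x w e.1)

/-- The union of those components of the subgraph with labels in `J` that read all reduced words
with labels in `J`. -/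
noncomputable def good (J : Finset (Fin n)) (T : Finset (V × Fin n × V)) :
    Finset (V × Fin n × V) :=
  (restr J T).filter (fun e => AllReads J (comp (restr J T) e.1))

section comp

variable {T T' R : Finset (V × Fin n × V)} {x y z : V} {w w' : List (Letter n)} {l : Letter n}
  {J : Finset (Fin n)}

theorem Readable.infix (h : Readable T w) (h' : w' <:+: w) : Readable T w' := by
  obtain ⟨s, t, rfl⟩ := h'
  obtain ⟨x, y, hr⟩ := h
  obtain ⟨z, h1, -⟩ := reads_append.1 hr
  obtain ⟨z', -, h2⟩ := reads_append.1 h1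
  exact ⟨z', z, h2⟩

theorem Readable.winv (h : Readable T w) : Readable T (winv w) := by
  obtain ⟨x, y, hr⟩ := h
  exact ⟨y, x, hr.symm⟩

theorem Readable.mono (h : T ⊆ T') (hr : Readable T w) : Readable T' w := by
  obtain ⟨x, y, hr⟩ := hr
  exact ⟨x, y, hr.mono h⟩

theorem comp_subset : comp T x ⊆ T := Finset.filter_subset _ _

theorem restr_subset : restr J T ⊆ T := Finset.filter_subset _ _

theorem good_subset_restr : good J T ⊆ restr J T := Finset.filter_subset _ _

theorem good_subset : good J T ⊆ T := good_subset_restr.trans restr_subset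

theorem Reads.restr (hr : Reads T x w y) (hw : ∀ l ∈ w, l.1 ∈ J) : Reads (restr J T) x w y :=
  hr.of_label hw

theorem tri_mem_comp (h : ∃ w, Reads T x w y) (ht : tri y l z ∈ T) : tri y l z ∈ comp T x := by
  obtain ⟨w, hw⟩ := h
  refine Finset.mem_filter.2 ⟨ht, ?_⟩
  obtain ⟨i, b⟩ := l
  cases b
  · exact ⟨w ++ [(i, false)], reads_append.2 ⟨y, hw, reads_singleton.2 ht⟩⟩
  · exact ⟨w, hw⟩

theorem Reads.comp (h : ∃ w, Reads T x w y) (hr : Reads T y w z) : Reads (comp T x) y w z := by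
  induction w generalizing y with
  | nil => exact hr
  | cons l w ih =>
    obtain ⟨y', h1, h2⟩ := hr
    refine ⟨y', tri_mem_comp h h1, ih ?_ h2⟩
    obtain ⟨w0, hw0⟩ := h
    exact ⟨w0 ++ [l], reads_append.2 ⟨y, hw0, reads_singleton.2 h1⟩⟩

theorem comp_congr (h : ∃ w, Reads T x w y) : comp T x = comp T y := by
  obtain ⟨w, hw⟩ := h
  refine Finset.filter_congr fun e _ => ⟨?_, ?_⟩
  · rintro ⟨w', hw'⟩
    exact ⟨winv w ++ w', reads_append.2 ⟨x, hw.symm, hw'⟩⟩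
  · rintro ⟨w', hw'⟩
    exact ⟨w ++ w', reads_append.2 ⟨y, hw, hw'⟩⟩

theorem reach_of_mem_verts_comp (h : y ∈ verts (comp T x)) : ∃ w, Reads T x w y := by
  obtain ⟨e, he, rfl | rfl⟩ := mem_verts.1 h
  · exact (Finset.mem_filter.1 he).2
  · obtain ⟨h1, w, hw⟩ := Finset.mem_filter.1 he
    exact ⟨w ++ [(e.2.1, true)], reads_append.2 ⟨_, hw, reads_singleton.2 h1⟩⟩

theorem conn_comp : Conn (comp T x) := by
  intro y hy z hz
  obtain ⟨w, hw⟩ := reach_of_mem_verts_comp hy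
  obtain ⟨w', hw'⟩ := reach_of_mem_verts_comp hz
  exact ⟨winv w ++ w', Reads.comp ⟨w, hw⟩ (reads_append.2 ⟨x, hw.symm, hw'⟩)⟩

theorem mem_verts_comp (h : ∃ w, Reads T x w y) (hy : y ∈ verts T) : y ∈ verts (comp T x) := by
  obtain ⟨l, z, ht⟩ := exists_tri_of_mem_verts hy
  exact left_mem_verts (tri_mem_comp h ht)

theorem mem_comp_fst {e : V × Fin n × V} (he : e ∈ T) : e ∈ comp T e.1 :=
  Finset.mem_filter.2 ⟨he, [], rfl⟩

theorem comp_fst_eq_snd {e : V × Fin n × V} (he : e ∈ T) : comp T e.1 = comp T e.2.2 :=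
  comp_congr ⟨[(e.2.1, true)], reads_singleton.2 he⟩

theorem comp_eq_of_mem {e : V × Fin n × V} (he : e ∈ comp T x) : comp T e.1 = comp T x :=
  (comp_congr (Finset.mem_filter.1 he).2).symm

theorem allReads_of_mem_verts_good (h : x ∈ verts (good J T)) :
    AllReads J (comp (restr J T) x) := by
  obtain ⟨e, he, rfl | rfl⟩ := mem_verts.1 h
  · exact (Finset.mem_filter.1 he).2
  · rw [← comp_fst_eq_snd (good_subset_restr he)]
    exact (Finset.mem_filter.1 he).2

theorem comp_subset_good (h : AllReads J (comp (restr J T) x)) :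
    comp (restr J T) x ⊆ good J T := by
  intro e he
  refine Finset.mem_filter.2 ⟨comp_subset he, ?_⟩
  rwa [comp_eq_of_mem he]

/-- Good components are entire components of the subgraph with labels in `J`, so a path with labels
in `J` cannot leave them. -/
theorem Reads.good (hx : x ∈ verts (good J T)) (hr : Reads T x w y) (hw : ∀ l ∈ w, l.1 ∈ J) :
    Reads (good J T) x w y :=
  ((hr.restr hw).comp ⟨[], rfl⟩).mono (comp_subset_good (allReads_of_mem_verts_good hx))

/-- The components that make up `good J T`. -/
noncomputable def goodComps (J : Finset (Fin n)) (T : Finset (V × Fin n × V)) :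
    Finset (Finset (V × Fin n × V)) := (good J T).image (fun e => comp (restr J T) e.1)

theorem mem_goodComps_of_mem_verts (h : x ∈ verts (good J T)) :
    comp (restr J T) x ∈ goodComps J T := by
  obtain ⟨e, he, rfl | rfl⟩ := mem_verts.1 h
  · exact Finset.mem_image_of_mem _ he
  · rw [← comp_fst_eq_snd (good_subset_restr he)]
    exact Finset.mem_image_of_mem _ he

/-- Distinct components share neither edges nor vertices. -/
theorem exc_good_eq_sum : exc (good J T) = ∑ D ∈ goodComps J T, exc D := by
  have h1 : (good J T).card = ∑ D ∈ goodComps J T, D.card := by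
    rw [Finset.card_eq_sum_card_image (fun e => comp (restr J T) e.1)]
    refine Finset.sum_congr rfl fun D hD => congrArg _ ?_
    obtain ⟨e, he, rfl⟩ := Finset.mem_image.1 hD
    ext e'
    rw [Finset.mem_filter]
    constructor
    · rintro ⟨h1, h2⟩
      rw [← h2]
      exact mem_comp_fst (good_subset_restr h1)
    · intro h
      exact ⟨comp_subset_good (Finset.mem_filter.1 he).2 h, comp_eq_of_mem h⟩
  have h2 : (verts (good J T)).card = ∑ D ∈ goodComps J T, (verts D).card := by
    rw [Finset.card_eq_sum_card_fiberwise (f := fun v => comp (restr J T) v) (t := goodComps J T)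
      (fun v hv => mem_goodComps_of_mem_verts hv)]
    refine Finset.sum_congr rfl fun D hD => congrArg _ ?_
    obtain ⟨e, he, rfl⟩ := Finset.mem_image.1 hD
    ext v
    rw [Finset.mem_filter]
    constructor
    · rintro ⟨h1, h2⟩
      rw [← h2]
      exact mem_verts_comp ⟨[], rfl⟩ (verts_mono good_subset_restr h1)
    · intro h
      exact ⟨verts_mono (comp_subset_good (Finset.mem_filter.1 he).2) h,
        (comp_congr (reach_of_mem_verts_comp h)).symm⟩
  simp only [exc, h1, h2, Nat.cast_sum, Finset.sum_sub_distrib]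

end comp

section path

variable {T : Finset (V × Fin n × V)} {x y z : V} {w : List (Letter n)}

/-- The sequence of vertices of a path, with all its subpaths; closed subpaths are cut out of it. -/
theorem Reads.exists_fun (hr : Reads T x w y) : ∃ f : ℕ → V, f 0 = x ∧ f w.length = y ∧
    ∀ i j, i ≤ j → j ≤ w.length → Reads T (f i) ((w.drop i).take (j - i)) (f j) := by
  induction w generalizing x with
  | nil =>
    refine ⟨fun _ => x, rfl, hr, fun i j hij hj => ?_⟩
    simp [Reads]
  | cons l w ih =>
    obtain ⟨z, h1, h2⟩ := hr
    obtain ⟨f, h3, h4, h5⟩ := ih h2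
    refine ⟨fun i => if i = 0 then x else f (i - 1), by simp, by simpa using h4, ?_⟩
    intro i j hij hj
    rcases i with - | i
    · rcases j with - | j
      · simp [Reads]
      · simp only [List.drop_zero, Nat.sub_zero, List.take_succ_cons, if_true, Nat.succ_ne_zero,
          if_false, Nat.add_sub_cancel]
        refine ⟨z, h1, ?_⟩
        have := h5 0 j (Nat.zero_le _) (by simpa using hj)
        simpa [h3] using this
    · rcases j with - | j
      · omega
      · have := h5 i j (by omega) (by simpa using hj)
        simpa using this

variable [NeZero n]

/-- A connected graph that reads a long reduced word is not a tree. -/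
theorem exc_nonneg_of_long (hT : Conn T) (hw : Red w) (hlen : (verts T).card ≤ w.length)
    (hne : w ≠ []) (hr : Readable T w) : 0 ≤ exc T := by
  obtain ⟨x, y, hr⟩ := hr
  have hx := hr.start_mem hne
  obtain ⟨f, h1, h2, h3⟩ := hr.exists_fun
  have hf : ∀ i ∈ Finset.range (w.length + 1), f i ∈ verts T := by
    intro i hi
    have := h3 0 i (Nat.zero_le _) (by simpa [Nat.lt_succ_iff] using hi)
    rw [h1] at this
    exact this.end_mem_of_start_mem hx
  -- The path visits `w.length + 1` positions, more than there are vertices, so it has a closed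
  -- reduced subpath.
  obtain ⟨i, hi, j, hj, hij, heq⟩ := Finset.exists_ne_map_eq_of_card_lt_of_maps_to
    (by rw [Finset.card_range]; omega) hf
  wlog hlt : i < j generalizing i j
  · exact this j hj i hi (Ne.symm hij) heq.symm (by omega)
  have hj' : j ≤ w.length := by simpa [Nat.lt_succ_iff] using hj
  have hc := h3 i j hlt.le hj'
  rw [← heq] at hc
  have hne' : (w.drop i).take (j - i) ≠ [] := by
    intro h
    have := congrArg List.length h
    simp at this
    omega
  by_contra hneg
  have hfi := hf i hi
  -- With negative excess the graph is a tree rooted at `f i`. Then the closed subpath would have to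
  -- be read in the empty graph.
  have hst := Reads.stay (T := T) (X := ∅) (U := {f i}) (Y := verts T) (by simp)
    (fun v hv => ⟨f i, by simp, hT _ hfi _ hv⟩)
    (by
      rw [Finset.sdiff_empty, Finset.card_sdiff_of_subset (by simpa using hfi),
        Finset.card_singleton]
      have : 0 < (verts T).card := Finset.card_pos.2 ⟨_, hfi⟩
      unfold exc at hneg
      omega)
    (hw.infix ((List.take_prefix _ _).isInfix.trans (List.drop_suffix _ _).isInfix))
    (by simp) (by simp) hc
  have := hst.start_mem hne'
  simp [verts] at this

/-- Powers of a single letter are reduced words of any length. -/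
theorem exc_nonneg_of_allReads {J : Finset (Fin n)} (hJ : J.Nonempty) (hT : Conn T)
    (h : AllReads J T) : 0 ≤ exc T := by
  obtain ⟨j, hj⟩ := hJ
  set w : List (Letter n) := List.replicate ((verts T).card + 1) (j, true) with hw
  have hne : w ≠ [] := by simp [hw, List.replicate_succ]
  exact exc_nonneg_of_long hT (red_replicate _ _) (by simp) hne
    (h w hne (red_replicate _ _) (by simp [hw, hj]))

theorem exc_goodComp_nonneg {J : Finset (Fin n)} (hJ : J.Nonempty) {D}
    (hD : D ∈ goodComps J T) : 0 ≤ exc D := by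
  obtain ⟨e, he, rfl⟩ := Finset.mem_image.1 hD
  exact exc_nonneg_of_allReads hJ conn_comp (Finset.mem_filter.1 he).2

theorem exc_good_nonneg {J : Finset (Fin n)} (hJ : J.Nonempty) : 0 ≤ exc (good J T) := by
  rw [exc_good_eq_sum]
  exact Finset.sum_nonneg fun D hD => exc_goodComp_nonneg hJ hD

theorem exc_goodComp_le {J : Finset (Fin n)} (hJ : J.Nonempty) {D}
    (hD : D ∈ goodComps J T) : exc D ≤ exc (good J T) := by
  rw [exc_good_eq_sum]
  exact Finset.single_le_sum (fun D hD => exc_goodComp_nonneg hJ hD) hD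

end path


/-! ### Connecting and combining reduced words -/

section words

variable {w w' u v : List (Letter n)} {J J₁ J₂ : Finset (Fin n)}

/-- All letters of the word have labels in `J`. -/
def Over (J : Finset (Fin n)) (w : List (Letter n)) : Prop := ∀ l ∈ w, l.1 ∈ J

theorem over_append : Over J (w ++ w') ↔ Over J w ∧ Over J w' := by
  simp only [Over, List.mem_append]
  exact ⟨fun h => ⟨fun l hl => h l (.inl hl), fun l hl => h l (.inr hl)⟩,
    fun h l hl => hl.elim (h.1 l) (h.2 l)⟩

theorem over_cons {l : Letter n} : Over J (l :: w) ↔ l.1 ∈ J ∧ Over J w := by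
  simp [Over]

theorem Over.mono (h : J₁ ⊆ J₂) (hw : Over J₁ w) : Over J₂ w := fun l hl => h (hw l hl)

theorem over_replicate {j : Fin n} {b : Bool} {k : ℕ} (hj : j ∈ J) :
    Over J (List.replicate k (j, b)) := by
  intro l hl
  rw [List.eq_of_mem_replicate hl]
  exact hj

theorem red_append_of_disjoint (hJ : Disjoint J₁ J₂) (hu : Red u) (hv : Red v)
    (hu' : Over J₁ u) (hv' : Over J₂ v) : Red (u ++ v) := by
  refine red_append.2 ⟨hu, hv, fun a ha b hb h => ?_⟩
  have h1 := hu' a (List.mem_of_getLast? ha)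
  have h2 := hv' b (List.mem_of_head? hb)
  rw [h, linv_fst] at h2
  exact Finset.disjoint_left.1 hJ h1 h2

theorem red_single_label {j : Fin n} (hw : Red w) (h : Over {j} w) :
    ∃ b, w = List.replicate w.length (j, b) := by
  induction w with
  | nil => exact ⟨true, rfl⟩
  | cons l w ih =>
    obtain ⟨h1, h2⟩ := over_cons.1 h
    obtain ⟨b, hb⟩ := ih hw.tail h2
    obtain ⟨i, c⟩ := l
    obtain rfl : i = j := by simpa using h1
    rcases w with - | ⟨l', w⟩
    · exact ⟨c, rfl⟩
    · have h3 := (red_cons_cons.1 hw).1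
      have h4 : l' = (i, b) := by
        simp only [List.length_cons, List.replicate_succ, List.cons.injEq] at hb
        exact hb.1
      have : b = c := by
        subst h4
        clear hb hw ih h h1 h2
        revert h3
        cases b <;> cases c <;> simp [linv]
      subst this
      exact ⟨b, by rw [List.length_cons, List.replicate_succ, ← hb]⟩

/-- Two labels provide four letters, and each of the two constraints excludes just one. -/
theorem exists_connect {a b : Letter n} {j k : Fin n} (hj : j ∈ J) (hk : k ∈ J) (hjk : j ≠ k) :
    ∃ c : Letter n, c.1 ∈ J ∧ c ≠ linv a ∧ b ≠ linv c := by
  by_contra! h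
  have h1 := h (j, true) hj
  have h2 := h (j, false) hj
  have h3 := h (k, true) hk
  have h4 := h (k, false) hk
  simp only [eq_linv_comm (a := b)] at h1 h2 h3 h4
  by_cases ha : a.1 = j
  · have h5 := h3 (fun e => hjk (by rw [← ha, ← linv_fst a, ← e]))
    have h6 := h4 (fun e => hjk (by rw [← ha, ← linv_fst a, ← e]))
    simpa using h5.trans h6.symm
  · have h5 := h1 (fun e => ha (by rw [← linv_fst a, ← e]))
    have h6 := h2 (fun e => ha (by rw [← linv_fst a, ← e]))
    simpa using h5.trans h6.symm

theorem readable_replicate {T : Finset (V × Fin n × V)} {j : Fin n} {b c : Bool} {k m : ℕ}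
    (hkm : k ≤ m) (h : Readable T (List.replicate m (j, b))) :
    Readable T (List.replicate k (j, c)) := by
  have h1 : Readable T (List.replicate k (j, b)) := by
    refine h.infix (List.IsPrefix.isInfix ⟨List.replicate (m - k) (j, b), ?_⟩)
    rw [← List.replicate_add]
    congr 1
    omega
  by_cases hbc : c = b
  · rwa [hbc]
  · have h2 := h1.winv
    have : linv (j, b) = (j, c) := by
      cases b <;> cases c <;> simp_all [linv]
    simpa [winv, this] using h2

/-- Two words can be combined into one that is readable only where both are. -/
theorem exists_combine (hJ : J.Nonempty) (hu : Red u) (hv : Red v) (hu' : Over J u) (hv' : Over J v)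
    (hune : u ≠ []) :
    ∃ w, w ≠ [] ∧ Red w ∧ Over J w ∧ ∀ D : Finset (V × Fin n × V), Readable D w →
      Readable D u ∧ Readable D v := by
  obtain ⟨j, hj⟩ := hJ
  by_cases hJ1 : J = {j}
  · subst hJ1
    obtain ⟨b, hb⟩ := red_single_label hu hu'
    obtain ⟨c, hc⟩ := red_single_label hv hv'
    -- With a single label no connecting letter is available. But then reduced words are powers, and
    -- a long power contains every shorter one up to inversion.
    refine ⟨List.replicate (u.length + v.length) (j, true), ?_, red_replicate _ _,
      over_replicate hj, fun D hD => ⟨?_, ?_⟩⟩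
    · intro h
      have := congrArg List.length h
      simp only [List.length_replicate, List.length_nil] at this
      exact hune (List.length_eq_zero_iff.1 (by omega))
    · rw [hb]
      exact readable_replicate (by omega) hD
    · rw [hc]
      exact readable_replicate (by omega) hD
  · obtain ⟨k, hk, hkj⟩ : ∃ k ∈ J, k ≠ j := by
      by_contra! h
      exact hJ1 (Finset.eq_singleton_iff_unique_mem.2 ⟨hj, h⟩)
    by_cases hvne : v = []
    · subst hvne
      exact ⟨u, hune, hu, hu', fun D hD => ⟨hD, hD.infix (List.nil_infix)⟩⟩
    obtain ⟨c, hc1, hc2, hc3⟩ := exists_connect (a := u.getLast hune) (b := v.head hvne) hk hj hkj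
    refine ⟨u ++ ([c] ++ v), by simp, ?_, ?_, fun D hD => ⟨hD.infix ⟨[], _, rfl⟩,
      hD.infix ⟨u ++ [c], [], by simp⟩⟩⟩
    · refine red_append.2 ⟨hu, red_append.2 ⟨red_singleton _, hv, ?_⟩, ?_⟩
      · intro a ha b hb
        simp only [List.getLast?_singleton, Option.mem_def, Option.some.injEq] at ha
        rw [List.head?_eq_some_head hvne] at hb
        simp only [Option.mem_def, Option.some.injEq] at hb
        subst ha hb
        exact hc3
      · intro a ha b hb
        rw [List.getLast?_eq_some_getLast hune] at ha
        simp only [List.singleton_append, List.head?_cons, Option.mem_def, Option.some.injEq]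
          at ha hb
        subst ha hb
        exact hc2
    · exact over_append.2 ⟨hu', over_append.2 ⟨by simpa [Over] using hc1, hv'⟩⟩

end words

/-! ### Synchronising words -/

/-- A reduced word that can only be read in `good J T`. -/
def IsSync (J : Finset (Fin n)) (T : Finset (V × Fin n × V)) (w : List (Letter n)) : Prop :=
  w ≠ [] ∧ Red w ∧ Over J w ∧ ∀ z z', Reads T z w z' → z ∈ verts (good J T)

section sync

variable {T : Finset (V × Fin n × V)} {J : Finset (Fin n)} {x y z : V} {w u : List (Letter n)}

/-- Each component that is not good misses some reduced word. By `exists_combine` finitely many such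
words are assembled into one, which then no bad component can read. -/
theorem exists_isSync (hJ : J.Nonempty) : ∃ w, IsSync J T w := by
  have key : ∀ s : Finset (Finset (V × Fin n × V)), (∀ D ∈ s, ¬ AllReads J D) →
      ∃ w, w ≠ [] ∧ Red w ∧ Over J w ∧ ∀ D ∈ s, ¬ Readable D w := by
    intro s
    induction s using Finset.induction_on with
    | empty =>
      intro _
      obtain ⟨j, hj⟩ := hJ
      exact ⟨[(j, true)], by simp, red_singleton _, by simpa [Over] using hj, by simp⟩
    | insert D s _ ih =>
      intro h
      obtain ⟨w, h1, h2, h3, h4⟩ := ih fun D' hD' => h D' (Finset.mem_insert_of_mem hD')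
      have h5 := h D (Finset.mem_insert_self _ _)
      unfold AllReads at h5
      push Not at h5
      obtain ⟨v, h6, h7, h8, h9⟩ := h5
      obtain ⟨w', h10, h11, h12, h13⟩ := exists_combine (V := V) hJ h2 h7 h3 h8 h1
      refine ⟨w', h10, h11, h12, fun D' hD' hr => ?_⟩
      rcases Finset.mem_insert.1 hD' with rfl | hD'
      · exact h9 (h13 _ hr).2
      · exact h4 _ hD' (h13 _ hr).1
  obtain ⟨w, h1, h2, h3, h4⟩ := key (((restr J T).image (fun e => comp (restr J T) e.1)).filter
    (fun D => ¬ AllReads J D)) (fun D hD => (Finset.mem_filter.1 hD).2)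
  refine ⟨w, h1, h2, h3, fun z z' hr => ?_⟩
  have hr' := hr.restr h3
  have hz := hr'.start_mem h1
  have hread : Readable (comp (restr J T) z) w := ⟨z, z', hr'.comp ⟨[], rfl⟩⟩
  obtain ⟨e, he, hez⟩ := mem_verts.1 hz
  have hcomp : comp (restr J T) e.1 = comp (restr J T) z := by
    rcases hez with rfl | rfl
    · rfl
    · exact comp_fst_eq_snd he
  have hall : AllReads J (comp (restr J T) e.1) := by
    by_contra hneg
    refine h4 _ (Finset.mem_filter.2 ⟨Finset.mem_image_of_mem _ he, hneg⟩) ?_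
    rwa [hcomp]
  exact mem_verts.2 ⟨e, Finset.mem_filter.2 ⟨he, hall⟩, hez⟩

/-- The synchronising subword places one vertex of the path in the good part, and the path, having
labels in `J`, remains there in both directions. -/
theorem IsSync.reads (hs : IsSync J T w) (hwu : w <:+: u) (hu : Over J u) (hr : Reads T x u y) :
    Reads (good J T) x u y := by
  obtain ⟨s, t, rfl⟩ := hwu
  obtain ⟨z, h1, h2⟩ := reads_append.1 hr
  obtain ⟨z', h3, h4⟩ := reads_append.1 h1
  have hz' := hs.2.2.2 _ _ h4
  obtain ⟨h5, h6⟩ := over_append.1 hu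
  obtain ⟨h7, h8⟩ := over_append.1 h5
  have h9 : Over J (winv s) := by
    intro l hl
    obtain ⟨l', hl', rfl⟩ := List.mem_map.1 (List.mem_reverse.1 hl)
    exact h7 l' hl'
  exact (h3.symm.good hz' h9).end_mem_of_start_mem hz' |> fun hx => hr.good hx hu

theorem IsSync.start_mem (hs : IsSync J T w) (hwu : w <:+: u) (hu : Over J u)
    (hr : Reads T x u y) : x ∈ verts (good J T) := by
  refine (hs.reads hwu hu hr).start_mem ?_
  rintro rfl
  exact hs.1 (List.infix_nil.1 hwu)

theorem IsSync.end_mem (hs : IsSync J T w) (hwu : w <:+: u) (hu : Over J u)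
    (hr : Reads T x u y) : y ∈ verts (good J T) :=
  (hs.reads hwu hu hr).end_mem_of_start_mem (hs.start_mem hwu hu hr)

end sync

/-! ### Two disjoint alphabets and their pivots -/

/-- A connected labelled graph that reads all words in two disjoint alphabets. -/
structure Split (T : Finset (V × Fin n × V)) (J₁ J₂ : Finset (Fin n)) : Prop where
  conn : Conn T
  reads : AllReads (J₁ ∪ J₂) T
  disj : Disjoint J₁ J₂
  ne₁ : J₁.Nonempty
  ne₂ : J₂.Nonempty

/-- The common vertices of the good subgraphs for two alphabets. -/
noncomputable def pivots (T : Finset (V × Fin n × V)) (J₁ J₂ : Finset (Fin n)) : Finset V :=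
  verts (good J₁ T) ∩ verts (good J₂ T)

theorem pivots_comm (T : Finset (V × Fin n × V)) (J₁ J₂ : Finset (Fin n)) :
    pivots T J₁ J₂ = pivots T J₂ J₁ := Finset.inter_comm _ _

namespace Split

variable {T : Finset (V × Fin n × V)} {J₁ J₂ : Finset (Fin n)} {x y z : V}
  {w w₁ w₂ u u' v : List (Letter n)}

theorem symm (h : Split T J₁ J₂) : Split T J₂ J₁ :=
  ⟨h.conn, Finset.union_comm J₁ J₂ ▸ h.reads, h.disj.symm, h.ne₂, h.ne₁⟩

/-- Words that force a path into `good J₁ T` start and end at pivots when read between words that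
force a path into `good J₂ T`. -/
theorem exists_block (h : Split T J₁ J₂) (hs : IsSync J₁ T w) (hwu : w <:+: u) (hu : Red u)
    (hu' : Over J₁ u) : ∃ p ∈ pivots T J₁ J₂, ∃ q ∈ pivots T J₁ J₂, Reads (good J₁ T) p u q := by
  -- Between synchronising words for `J₂` both ends of `u` belong to the two good subgraphs at once.
  obtain ⟨w₂, hs₂⟩ := exists_isSync (T := T) h.ne₂
  obtain ⟨x, y, hr⟩ := h.reads (w₂ ++ (u ++ w₂)) (by simp [hs₂.1])
    (by
      refine red_append.2 ⟨hs₂.2.1, red_append_of_disjoint h.disj hu hs₂.2.1 hu' hs₂.2.2.1, ?_⟩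
      have := (red_append.1 (red_append_of_disjoint h.disj.symm hs₂.2.1 hu hs₂.2.2.1 hu')).2.2
      have hne : u ≠ [] := by rintro rfl; exact hs.1 (List.infix_nil.1 hwu)
      intro a ha b hb
      refine this a ha b ?_
      rwa [List.head?_append_of_ne_nil _ hne] at hb)
    (over_append.2 ⟨hs₂.2.2.1.mono Finset.subset_union_right, over_append.2
      ⟨hu'.mono Finset.subset_union_left, hs₂.2.2.1.mono Finset.subset_union_right⟩⟩)
  obtain ⟨p, h1, h2⟩ := reads_append.1 hr
  obtain ⟨q, h3, h4⟩ := reads_append.1 h2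
  exact ⟨p, Finset.mem_inter.2 ⟨hs.start_mem hwu hu' h3,
    hs₂.end_mem (List.infix_refl _) hs₂.2.2.1 h1⟩, q,
    Finset.mem_inter.2 ⟨hs.end_mem hwu hu' h3,
    hs₂.start_mem (List.infix_refl _) hs₂.2.2.1 h4⟩, hs.reads hwu hu' h3⟩

theorem pivots_nonempty (h : Split T J₁ J₂) : (pivots T J₁ J₂).Nonempty := by
  obtain ⟨w, hs⟩ := exists_isSync (T := T) h.ne₁
  obtain ⟨p, hp, -⟩ := h.exists_block hs (List.infix_refl _) hs.2.1 hs.2.2.1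
  exact ⟨p, hp⟩

theorem disjoint_good (h : Split T J₁ J₂) : Disjoint (good J₁ T) (good J₂ T) := by
  rw [Finset.disjoint_left]
  intro e he he'
  exact Finset.disjoint_left.1 h.disj (Finset.mem_filter.1 (good_subset_restr he)).2
    (Finset.mem_filter.1 (good_subset_restr he')).2

theorem mem_union {e : V × Fin n × V} (he : e ∈ good J₁ T ∪ good J₂ T) :
    e.1 ∈ verts (good J₁ T) ∪ verts (good J₂ T) ∧ e.2.2 ∈ verts (good J₁ T) ∪ verts (good J₂ T) := by
  rcases Finset.mem_union.1 he with he | he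
  · exact ⟨Finset.mem_union_left _ (fst_mem_verts he), Finset.mem_union_left _ (snd_mem_verts he)⟩
  · exact ⟨Finset.mem_union_right _ (fst_mem_verts he), Finset.mem_union_right _ (snd_mem_verts he)⟩

theorem reach (h : Split T J₁ J₂) : ∀ v ∈ verts T, ∃ u ∈ verts (good J₁ T) ∪ verts (good J₂ T),
    ∃ w, Reads T u w v := by
  intro v hv
  obtain ⟨p, hp⟩ := h.pivots_nonempty
  have hp' := (Finset.mem_inter.1 hp).1
  exact ⟨p, Finset.mem_union_left _ hp', h.conn p (verts_mono good_subset hp') v hv⟩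

/-- Inclusion-exclusion: the good subgraphs have no common edge and meet exactly in the pivots, so
the excess of their union is the sum of the excesses plus the number of pivots. -/
theorem card_eq (h : Split T J₁ J₂) :
    (((T \ (good J₁ T ∪ good J₂ T)).card : ℤ) -
      ((verts T \ (verts (good J₁ T) ∪ verts (good J₂ T))).card : ℤ)) =
    exc T - (exc (good J₁ T) + exc (good J₂ T) + (pivots T J₁ J₂).card) := by
  have h1 : ((T \ (good J₁ T ∪ good J₂ T)).card : ℤ) =
      T.card - ((good J₁ T).card + (good J₂ T).card) := by
    have := Finset.card_sdiff_add_card_eq_card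
      (Finset.union_subset (good_subset (T := T) (J := J₁)) (good_subset (J := J₂)))
    rw [Finset.card_union_of_disjoint h.disjoint_good] at this
    omega
  have h2 : ((verts T \ (verts (good J₁ T) ∪ verts (good J₂ T))).card : ℤ) =
      (verts T).card - ((verts (good J₁ T)).card + (verts (good J₂ T)).card
        - (pivots T J₁ J₂).card) := by
    have h3 := Finset.card_sdiff_add_card_eq_card
      (Finset.union_subset (verts_mono (good_subset (T := T) (J := J₁)))
        (verts_mono (good_subset (T := T) (J := J₂))))
    have h4 := Finset.card_union_add_card_inter (verts (good J₁ T)) (verts (good J₂ T))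
    unfold pivots
    omega
  rw [h1, h2]
  unfold exc
  ring

theorem reads_left (h : Split T J₁ J₂) (hu : Over J₁ u)
    (hr : Reads (good J₁ T ∪ good J₂ T) x u y) : Reads (good J₁ T) x u y := by
  refine (hr.restr hu).mono fun e he => ?_
  obtain ⟨h1, h2⟩ := Finset.mem_filter.1 he
  refine (Finset.mem_union.1 h1).resolve_right fun h3 => ?_
  exact Finset.disjoint_left.1 h.disj h2 (Finset.mem_filter.1 (good_subset_restr h3)).2

theorem reads_right (h : Split T J₁ J₂) (hu : Over J₂ u)
    (hr : Reads (good J₁ T ∪ good J₂ T) x u y) : Reads (good J₂ T) x u y :=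
  h.symm.reads_left hu (by rwa [Finset.union_comm])

variable [NeZero n]

/-- The basic budget. By connectedness every vertex is reached from the union of the two good
subgraphs, so the part outside has at least as many edges as vertices. -/
theorem exc_le (h : Split T J₁ J₂) :
    exc (good J₁ T) + exc (good J₂ T) + (pivots T J₁ J₂).card ≤ exc T := by
  have := card_sdiff_le (fun e he => mem_union he) h.reach
  have := h.card_eq
  omega

/-- If the two good subgraphs account for the whole Euler characteristic, then paths between their
vertices stay in them. -/
theorem stay (h : Split T J₁ J₂)
    (ht : exc T ≤ exc (good J₁ T) + exc (good J₂ T) + (pivots T J₁ J₂).card) (hw : Red w)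
    (hx : x ∈ verts (good J₁ T) ∪ verts (good J₂ T))
    (hy : y ∈ verts (good J₁ T) ∪ verts (good J₂ T)) (hr : Reads T x w y) :
    Reads (good J₁ T ∪ good J₂ T) x w y := by
  have := h.card_eq
  exact Reads.stay (fun e he => mem_union he) h.reach (by omega) hw hx hy hr

/-- When the budget is exhausted, a path between the flanking synchronising words stays in the union
of the good subgraphs. So the block `u` need not contain a synchronising word, and may be a single
letter. -/
theorem exists_block_tight (h : Split T J₁ J₂)
    (ht : exc T ≤ exc (good J₁ T) + exc (good J₂ T) + (pivots T J₁ J₂).card)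
    (hu : Red u) (hu' : Over J₁ u) (hne : u ≠ []) :
    ∃ p ∈ pivots T J₁ J₂, ∃ q ∈ pivots T J₁ J₂, Reads (good J₁ T) p u q := by
  obtain ⟨w₂, hs₂⟩ := exists_isSync (T := T) h.ne₂
  have hred : Red (w₂ ++ (u ++ w₂)) := by
    refine red_append.2 ⟨hs₂.2.1, red_append_of_disjoint h.disj hu hs₂.2.1 hu' hs₂.2.2.1, ?_⟩
    have := (red_append.1 (red_append_of_disjoint h.disj.symm hs₂.2.1 hu hs₂.2.2.1 hu')).2.2
    intro a ha b hb
    refine this a ha b ?_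
    rwa [List.head?_append_of_ne_nil _ hne] at hb
  obtain ⟨x, y, hr⟩ := h.reads (w₂ ++ (u ++ w₂)) (by simp [hs₂.1]) hred
    (over_append.2 ⟨hs₂.2.2.1.mono Finset.subset_union_right, over_append.2
      ⟨hu'.mono Finset.subset_union_left, hs₂.2.2.1.mono Finset.subset_union_right⟩⟩)
  have hx : x ∈ verts (good J₂ T) := by
    obtain ⟨p, h1, -⟩ := reads_append.1 hr
    exact hs₂.start_mem (List.infix_refl _) hs₂.2.2.1 h1
  have hy : y ∈ verts (good J₂ T) := by
    obtain ⟨p, -, h2⟩ := reads_append.1 hr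
    obtain ⟨q, -, h4⟩ := reads_append.1 h2
    exact hs₂.end_mem (List.infix_refl _) hs₂.2.2.1 h4
  have hr' := h.stay ht hred (Finset.mem_union_right _ hx) (Finset.mem_union_right _ hy) hr
  obtain ⟨p, h1, h2⟩ := reads_append.1 hr'
  obtain ⟨q, h3, h4⟩ := reads_append.1 h2
  have h5 := h.reads_right hs₂.2.2.1 h1
  have h6 := h.reads_left hu' h3
  have h7 := h.reads_right hs₂.2.2.1 h4
  exact ⟨p, Finset.mem_inter.2 ⟨h6.start_mem hne, h5.end_mem hs₂.1⟩, q,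
    Finset.mem_inter.2 ⟨h6.end_mem hne, h7.start_mem hs₂.1⟩, h6⟩

/-- Consecutive blocks meet in a common pivot. This couples the actions of the two alphabets on the
pivots. -/
theorem exists_blocks_tight (h : Split T J₁ J₂)
    (ht : exc T ≤ exc (good J₁ T) + exc (good J₂ T) + (pivots T J₁ J₂).card)
    (hu : Red u) (hu' : Over J₁ u) (hune : u ≠ []) (hv : Red v) (hv' : Over J₂ v) (hvne : v ≠ [])
    (hw : Red w) (hw' : Over J₁ w) (hwne : w ≠ []) :
    ∃ p₀ ∈ pivots T J₁ J₂, ∃ p₁ ∈ pivots T J₁ J₂, ∃ p₂ ∈ pivots T J₁ J₂, ∃ p₃ ∈ pivots T J₁ J₂,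
      Reads (good J₁ T) p₀ u p₁ ∧ Reads (good J₂ T) p₁ v p₂ ∧ Reads (good J₁ T) p₂ w p₃ := by
  obtain ⟨w₂, hs₂⟩ := exists_isSync (T := T) h.ne₂
  have hred : Red (w₂ ++ (u ++ (v ++ (w ++ w₂)))) := by
    have e1 := red_append_of_disjoint h.disj hw hs₂.2.1 hw' hs₂.2.2.1
    have e2 := red_append_of_disjoint h.disj.symm hv hw hv' hw'
    have e3 := red_append_of_disjoint h.disj hu hv hu' hv'
    have e4 := red_append_of_disjoint h.disj.symm hs₂.2.1 hu hs₂.2.2.1 hu'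
    refine red_append.2 ⟨hs₂.2.1, red_append.2 ⟨hu, red_append.2 ⟨hv, e1, ?_⟩, ?_⟩, ?_⟩
    · rw [List.head?_append_of_ne_nil _ hwne]
      exact (red_append.1 e2).2.2
    · rw [List.head?_append_of_ne_nil _ hvne]
      exact (red_append.1 e3).2.2
    · rw [List.head?_append_of_ne_nil _ hune]
      exact (red_append.1 e4).2.2
  obtain ⟨x, y, hr⟩ := h.reads _ (by simp [hs₂.1]) hred
    (over_append.2 ⟨hs₂.2.2.1.mono Finset.subset_union_right, over_append.2
      ⟨hu'.mono Finset.subset_union_left, over_append.2 ⟨hv'.mono Finset.subset_union_right,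
        over_append.2 ⟨hw'.mono Finset.subset_union_left,
          hs₂.2.2.1.mono Finset.subset_union_right⟩⟩⟩⟩)
  have hx : x ∈ verts (good J₂ T) := by
    obtain ⟨p, h1, -⟩ := reads_append.1 hr
    exact hs₂.start_mem (List.infix_refl _) hs₂.2.2.1 h1
  have hy : y ∈ verts (good J₂ T) := by
    obtain ⟨p, -, h2⟩ := reads_append.1 hr
    obtain ⟨q, -, h3⟩ := reads_append.1 h2
    obtain ⟨q, -, h4⟩ := reads_append.1 h3
    obtain ⟨q, -, h5⟩ := reads_append.1 h4
    exact hs₂.end_mem (List.infix_refl _) hs₂.2.2.1 h5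
  have hr' := h.stay ht hred (Finset.mem_union_right _ hx) (Finset.mem_union_right _ hy) hr
  obtain ⟨p₀, h1, h2⟩ := reads_append.1 hr'
  obtain ⟨p₁, h3, h4⟩ := reads_append.1 h2
  obtain ⟨p₂, h5, h6⟩ := reads_append.1 h4
  obtain ⟨p₃, h7, h8⟩ := reads_append.1 h6
  have g1 := h.reads_right hs₂.2.2.1 h1
  have g2 := h.reads_left hu' h3
  have g3 := h.reads_right hv' h5
  have g4 := h.reads_left hw' h7
  have g5 := h.reads_right hs₂.2.2.1 h8
  exact ⟨p₀, Finset.mem_inter.2 ⟨g2.start_mem hune, g1.end_mem hs₂.1⟩,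
    p₁, Finset.mem_inter.2 ⟨g2.end_mem hune, g3.start_mem hvne⟩,
    p₂, Finset.mem_inter.2 ⟨g4.start_mem hwne, g3.end_mem hvne⟩,
    p₃, Finset.mem_inter.2 ⟨g4.end_mem hwne, g5.start_mem hs₂.1⟩, g2, g3, g4⟩

end Split


/-! ### Roses, double covers and the case of two labels -/

/-- A vertex with loops for all labels in `I`. -/
def HasRose (I : Finset (Fin n)) (T : Finset (V × Fin n × V)) : Prop := ∃ x, ∀ i ∈ I, (x, i, x) ∈ T

/-- Two vertices on which each label in `I` acts by a permutation. -/
def HasDouble (I : Finset (Fin n)) (T : Finset (V × Fin n × V)) : Prop :=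
  ∃ c : Bool → V, Function.Injective c ∧ ∃ s : Fin n → Bool, ∀ i ∈ I, ∀ b,
    (c b, i, c (xor b (s i))) ∈ T

theorem HasRose.mono {I : Finset (Fin n)} {T T' : Finset (V × Fin n × V)} (hT : T ⊆ T')
    (h : HasRose I T) : HasRose I T' := by
  obtain ⟨x, hx⟩ := h
  exact ⟨x, fun i hi => hT (hx i hi)⟩

section

variable {T : Finset (V × Fin n × V)} {J J₁ J₂ : Finset (Fin n)} {w u v : List (Letter n)}

theorem IsSync.winv (hs : IsSync J T w) : IsSync J T (winv w) := by
  refine ⟨winv_ne_nil hs.1, hs.2.1.winv, ?_, fun z z' hr => ?_⟩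
  · intro l hl
    obtain ⟨l', hl', rfl⟩ := List.mem_map.1 (List.mem_reverse.1 hl)
    exact hs.2.2.1 l' hl'
  · have h1 := hr.symm
    have h2 : Labelled.winv (Labelled.winv w) = w := by simp [Labelled.winv, Function.comp_def]
    rw [h2] at h1
    exact hs.end_mem (List.infix_refl _) hs.2.2.1 h1

theorem exists_isSync_replicate (a : Fin n) :
    ∃ k, IsSync {a} T (List.replicate k (a, true)) := by
  obtain ⟨w, hs⟩ := exists_isSync (T := T) (Finset.singleton_nonempty a)
  obtain ⟨b, hb⟩ := red_single_label hs.2.1 hs.2.2.1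
  cases b
  · have := hs.winv
    rw [hb] at this
    simp only [Labelled.winv, List.map_replicate, List.reverse_replicate] at this
    exact ⟨_, this⟩
  · rw [hb] at hs
    exact ⟨_, hs⟩

theorem split_erase (hT : Conn T) (hJ : 2 ≤ J.card) (h : AllReads J T) {j : Fin n} (hj : j ∈ J) :
    Split T (J.erase j) {j} where
  conn := hT
  reads := by rwa [Finset.union_comm, ← Finset.insert_eq, Finset.insert_erase hj]
  disj := by simp
  ne₁ := Finset.card_pos.1 (by rw [Finset.card_erase_of_mem hj]; omega)
  ne₂ := Finset.singleton_nonempty j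

theorem Split.tight_symm (ht : exc T ≤ exc (good J₁ T) + exc (good J₂ T) + (pivots T J₁ J₂).card) :
    exc T ≤ exc (good J₂ T) + exc (good J₁ T) + (pivots T J₂ J₁).card := by
  rw [pivots_comm]
  omega

/-- Used with two pivots: `A p q` and `B p q` say whether an edge with the first or second label
leads from pivot `p` to pivot `q`. The first two premises come from reading words `a^±1 b a^±1` and
`b^±1 a b^±1` between pivots. The alternatives are a common loop, hence a rose, and a permutation
inside each relation, hence a double cover. -/
theorem bool_rel_dichotomy : ∀ a₀ a₁ a₂ a₃ b₀ b₁ b₂ b₃ : Bool,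
    let A : Bool → Bool → Bool := fun p q => cond p (cond q a₀ a₁) (cond q a₂ a₃)
    let B : Bool → Bool → Bool := fun p q => cond p (cond q b₀ b₁) (cond q b₂ b₃)
    (∀ d e : Bool, ∃ p₀ p₁ p₂ p₃, cond d (A p₀ p₁) (A p₁ p₀) = true ∧ B p₁ p₂ = true ∧
      cond e (A p₂ p₃) (A p₃ p₂) = true) →
    (∀ d e : Bool, ∃ p₀ p₁ p₂ p₃, cond d (B p₀ p₁) (B p₁ p₀) = true ∧ A p₁ p₂ = true ∧
      cond e (B p₂ p₃) (B p₃ p₂) = true) →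
    ¬ (∀ p q, A p q = true) → ¬ (∀ p q, B p q = true) →
    (∃ p, A p p = true ∧ B p p = true) ∨
      ((∃ s, ∀ p, A p (xor p s) = true) ∧ (∃ s, ∀ p, B p (xor p s) = true)) := by
  decide

end

section

variable [NeZero n] {T : Finset (V × Fin n × V)} {J J₁ J₂ : Finset (Fin n)}
  {w u v : List (Letter n)}

theorem Split.one_le_exc (h : Split T J₁ J₂) : 1 ≤ exc T := by
  have h1 := h.exc_le
  have h2 := Finset.card_pos.2 h.pivots_nonempty
  have h3 := exc_good_nonneg (T := T) h.ne₁
  have h4 := exc_good_nonneg (T := T) h.ne₂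
  omega

theorem one_le_exc_of_allReads (hT : Conn T) (hJ : 2 ≤ J.card) (h : AllReads J T) : 1 ≤ exc T := by
  obtain ⟨j, hj⟩ : J.Nonempty := Finset.card_pos.1 (by omega)
  exact (split_erase hT hJ h hj).one_le_exc

/-- A block of one letter runs between pivots, and there is only one. -/
theorem Split.loop_of_tight (h : Split T J₁ J₂)
    (ht : exc T ≤ exc (good J₁ T) + exc (good J₂ T) + (pivots T J₁ J₂).card) {x : V}
    (hx : pivots T J₁ J₂ = {x}) {i : Fin n} (hi : i ∈ J₁) : (x, i, x) ∈ T := by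
  obtain ⟨p, hp, q, hq, hr⟩ := h.exists_block_tight ht (red_singleton (i, true))
    (by simpa [Over] using hi) (by simp)
  rw [hx, Finset.mem_singleton] at hp hq
  subst hp hq
  exact good_subset (reads_singleton.1 hr)

theorem Split.hasRose_of_tight (h : Split T J₁ J₂)
    (ht : exc T ≤ exc (good J₁ T) + exc (good J₂ T) + (pivots T J₁ J₂).card)
    (hp : (pivots T J₁ J₂).card = 1) : HasRose (J₁ ∪ J₂) T := by
  obtain ⟨x, hx⟩ := Finset.card_eq_one.1 hp
  refine ⟨x, fun i hi => ?_⟩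
  rcases Finset.mem_union.1 hi with hi | hi
  · exact h.loop_of_tight ht hx hi
  · exact h.symm.loop_of_tight (tight_symm ht) (pivots_comm T J₁ J₂ ▸ hx) hi

/-- If a component with vanishing Euler characteristic has closed paths of lengths `k` and `k + 1`
at `x` whose labels are powers of `a`, it has a loop at `x`. -/
theorem loop_of_reads {D : Finset (V × Fin n × V)} (hD : Conn D) (he : exc D ≤ 0) {x : V} {k : ℕ}
    (hk : k ≠ 0) {a : Fin n} (h1 : Reads D x (List.replicate k (a, true)) x)
    (h2 : Reads D x (List.replicate (k + 1) (a, true)) x) : (x, a, x) ∈ D := by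
  have hxD : x ∈ verts D := h1.start_mem (by simpa using hk)
  obtain ⟨f, f0, fk, hf⟩ := h1.exists_fun
  rw [List.length_replicate] at fk hf
  have hstep : ∀ i < k, (f i, a, f (i + 1)) ∈ D := by
    intro i hi
    have := hf i (i + 1) (by omega) (by omega)
    rw [Nat.add_sub_cancel_left, List.drop_replicate, List.take_replicate,
      min_eq_left (by omega), List.replicate_one, reads_singleton] at this
    exact this
  -- `X` and `U` are the edges and vertices of the closed path labelled by `a ^ k`.
  set X : Finset (V × Fin n × V) := (Finset.range k).image (fun i => (f i, a, f (i + 1))) with hX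
  set U : Finset V := (Finset.range k).image f with hU
  have hmX : ∀ i < k, (f i, a, f (i + 1)) ∈ X := fun i hi =>
    Finset.mem_image.2 ⟨i, Finset.mem_range.2 hi, rfl⟩
  have hmU : ∀ i ≤ k, f i ∈ U := by
    intro i hi
    rcases hi.eq_or_lt with rfl | hi
    · exact Finset.mem_image.2 ⟨0, Finset.mem_range.2 (by omega), by rw [f0, fk]⟩
    · exact Finset.mem_image.2 ⟨i, Finset.mem_range.2 hi, rfl⟩
  have hXD : X ⊆ D := by
    intro e he
    obtain ⟨i, hi, rfl⟩ := Finset.mem_image.1 he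
    exact hstep i (Finset.mem_range.1 hi)
  have hXU : ∀ e ∈ X, e.1 ∈ U ∧ e.2.2 ∈ U := by
    intro e he
    obtain ⟨i, hi, rfl⟩ := Finset.mem_image.1 he
    have := Finset.mem_range.1 hi
    exact ⟨hmU _ this.le, hmU _ this⟩
  have hUD : U ⊆ verts D := by
    intro v hv
    obtain ⟨i, hi, rfl⟩ := Finset.mem_image.1 hv
    exact fst_mem_verts (hstep i (Finset.mem_range.1 hi))
  have hsurj : U ⊆ X.image (fun e => e.1) := by
    intro v hv
    obtain ⟨i, hi, rfl⟩ := Finset.mem_image.1 hv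
    exact Finset.mem_image.2 ⟨_, hmX i (Finset.mem_range.1 hi), rfl⟩
  have hxU : x ∈ U := f0 ▸ hmU 0 (Nat.zero_le _)
  have hreach : ∀ v ∈ verts D, ∃ u ∈ U, ∃ w, Reads D u w v := fun v hv => ⟨x, hxU, hD x hxD v hv⟩
  -- Each vertex of `U` is the origin of an edge in `X`, so `X` has at least as many edges as `U`
  -- has vertices. As the excess is not positive, equality holds both here and in the count outside
  -- of `X`.
  have c1 := (Finset.card_le_card hsurj).trans Finset.card_image_le
  have c2 := card_sdiff_le hXU hreach
  have c3 := Finset.card_sdiff_add_card_eq_card hXD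
  have c4 := Finset.card_sdiff_add_card_eq_card hUD
  unfold exc at he
  have hst := Reads.stay hXU hreach (by omega) (red_replicate _ _) hxU hxU h2
  -- By equality each vertex of `U` is the origin of exactly one edge of `X`, so powers of `a` are
  -- read deterministically in `X`.
  have hdet : ∀ e ∈ X, ∀ e' ∈ X, e.1 = e'.1 → e = e' := by
    intro e he e' he' hee
    have hU' : X.image (fun e => e.1) = U := by
      refine Finset.Subset.antisymm ?_ hsurj
      intro v hv
      obtain ⟨e, he, rfl⟩ := Finset.mem_image.1 hv
      exact (hXU e he).1
    have hcard : (X.image (fun e => e.1)).card = X.card := by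
      rw [hU']
      omega
    exact Finset.card_image_iff.1 hcard he he' hee
  have hun : ∀ m (z y y' : V), Reads X z (List.replicate m (a, true)) y →
      Reads X z (List.replicate m (a, true)) y' → y = y' := by
    intro m
    induction m with
    | zero =>
      intro z y y' h h'
      exact (show z = y from h).symm.trans h'
    | succ m ih =>
      intro z y y' h h'
      rw [List.replicate_succ] at h h'
      obtain ⟨q, h3, h4⟩ := h
      obtain ⟨q', h3', h4'⟩ := h'
      have := hdet _ h3 _ h3' rfl
      have hq : q = q' := congrArg (fun e => e.2.2) this
      subst hq
      exact ih q y y' h4 h4'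
  have h1' := Reads.stay hXU hreach (by omega) (red_replicate _ _) hxU hxU h1
  -- After `k` of the `k + 1` letters the path is back at `x`, so the last letter is read on a loop.
  rw [List.replicate_succ', reads_append] at hst
  obtain ⟨q, h3, h4⟩ := hst
  obtain rfl := hun k x x q h1' h3
  exact hXD (reads_singleton.1 h4)

/-- All sufficiently high powers of `a` contain a synchronising word, hence are read from the only
pivot to itself. Two consecutive exponents then produce the loop. -/
theorem Split.loop_of_exc_zero {a : Fin n} (h : Split T {a} J₂) (hg : exc (good {a} T) ≤ 0) {x : V}
    (hx : pivots T {a} J₂ = {x}) : (x, a, x) ∈ T := by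
  obtain ⟨k, hs⟩ := exists_isSync_replicate (T := T) a
  have hk : k ≠ 0 := fun h0 => hs.1 (by simp [h0])
  have key : ∀ m, k ≤ m → Reads (good {a} T) x (List.replicate m (a, true)) x := by
    intro m hm
    obtain ⟨p, hp, q, hq, hr⟩ := h.exists_block hs
      (u := List.replicate m (a, true))
      (List.IsPrefix.isInfix ⟨List.replicate (m - k) (a, true), by
        rw [← List.replicate_add]; congr 1; omega⟩)
      (red_replicate _ _) (over_replicate (by simp))
    rw [hx, Finset.mem_singleton] at hp hq
    subst hp hq
    exact hr
  have hxG : x ∈ verts (good {a} T) := (key k le_rfl).start_mem (by simpa using hk)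
  have key' : ∀ m, k ≤ m → Reads (comp (restr {a} T) x) x (List.replicate m (a, true)) x :=
    fun m hm => ((key m hm).mono good_subset_restr).comp ⟨[], rfl⟩
  have hD := exc_goodComp_le (Finset.singleton_nonempty a) (mem_goodComps_of_mem_verts hxG)
  exact restr_subset (comp_subset (loop_of_reads conn_comp (hD.trans hg) hk (key' k le_rfl)
    (key' (k + 1) (by omega))))

end


/-- Two pivots, as the values of an injective function on the Booleans. -/
theorem exists_bool_fun {P : Finset V} (h : P.card = 2) :
    ∃ c : Bool → V, Function.Injective c ∧ ∀ v, v ∈ P ↔ ∃ b, v = c b := by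
  obtain ⟨x, y, hxy, rfl⟩ := Finset.card_eq_two.1 h
  refine ⟨fun b => cond b y x, ?_, fun v => by simp⟩
  intro b b' hb
  cases b <;> cases b' <;> simp_all

section

variable [NeZero n] {T : Finset (V × Fin n × V)} {J J₁ J₂ : Finset (Fin n)}
  {w u v : List (Letter n)}

/-- Five edges on two vertices would already have excess three. -/
theorem not_all_edges {c : Bool → V} (hc : Function.Injective c) (hT : Conn T) {a b : Fin n}
    (hab : a ≠ b) (hexc : exc T ≤ 2) {p q : Bool} (ha : (c p, a, c q) ∈ T) :
    ¬ ∀ p q : Bool, (c p, b, c q) ∈ T := by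
  intro hb
  set U : Finset V := Finset.univ.image c
  set Y : Finset (V × Fin n × V) :=
    (Finset.univ : Finset (Bool × Bool)).image (fun r => (c r.1, b, c r.2))
  have hU : U.card = 2 := by
    rw [Finset.card_image_of_injective _ hc]
    simp
  have hY : Y.card = 4 := by
    rw [Finset.card_image_of_injective]
    · simp
    · rintro ⟨r, s⟩ ⟨r', s'⟩ h
      simp only [Prod.mk.injEq, true_and] at h
      exact Prod.ext (hc h.1) (hc h.2)
  have hins : (insert (c p, a, c q) Y).card = 5 := by
    rw [Finset.card_insert_of_notMem, hY]
    intro h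
    obtain ⟨r, -, h⟩ := Finset.mem_image.1 h
    exact hab (congrArg (fun e => e.2.1) h).symm
  have hsub : insert (c p, a, c q) Y ⊆ T := by
    refine Finset.insert_subset ha fun e he => ?_
    obtain ⟨r, -, rfl⟩ := Finset.mem_image.1 he
    exact hb _ _
  have hcU : ∀ r, c r ∈ U := fun r => Finset.mem_image_of_mem _ (Finset.mem_univ r)
  have hUT : U ⊆ verts T := by
    intro v hv
    obtain ⟨r, -, rfl⟩ := Finset.mem_image.1 hv
    exact fst_mem_verts (hb r r)
  have h1 := card_sdiff_le (T := T) (X := insert (c p, a, c q) Y) (U := U) (Y := verts T)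
    (by
      intro e he
      rcases Finset.mem_insert.1 he with rfl | he
      · exact ⟨hcU _, hcU _⟩
      · obtain ⟨r, -, rfl⟩ := Finset.mem_image.1 he
        exact ⟨hcU _, hcU _⟩)
    (fun v hv => ⟨c true, hcU _, hT _ (hUT (hcU _)) _ hv⟩)
  have h2 := Finset.card_sdiff_add_card_eq_card hsub
  have h3 := Finset.card_sdiff_add_card_eq_card hUT
  unfold exc at hexc
  omega

theorem Split.bool_rel {a b : Fin n} (h : Split T {a} {b})
    (ht : exc T ≤ exc (good {a} T) + exc (good {b} T) + (pivots T {a} {b}).card)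
    {c : Bool → V} (hc : ∀ v, v ∈ pivots T {a} {b} ↔ ∃ r, v = c r) (d e : Bool) :
    ∃ p₀ p₁ p₂ p₃, cond d (decide ((c p₀, a, c p₁) ∈ T)) (decide ((c p₁, a, c p₀) ∈ T)) = true ∧
      decide ((c p₁, b, c p₂) ∈ T) = true ∧
      cond e (decide ((c p₂, a, c p₃) ∈ T)) (decide ((c p₃, a, c p₂) ∈ T)) = true := by
  obtain ⟨p₀, h0, p₁, h1, p₂, h2, p₃, h3, r1, r2, r3⟩ := h.exists_blocks_tight ht
    (red_singleton (a, d)) (by simp [Over]) (by simp) (red_singleton (b, true)) (by simp [Over])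
    (by simp) (red_singleton (a, e)) (by simp [Over]) (by simp)
  obtain ⟨r₀, rfl⟩ := (hc _).1 h0
  obtain ⟨r₁, rfl⟩ := (hc _).1 h1
  obtain ⟨r₂, rfl⟩ := (hc _).1 h2
  obtain ⟨r₃, rfl⟩ := (hc _).1 h3
  have r1 := good_subset (reads_singleton.1 r1)
  have r2 := good_subset (reads_singleton.1 r2)
  have r3 := good_subset (reads_singleton.1 r3)
  refine ⟨r₀, r₁, r₂, r₃, ?_, decide_eq_true r2, ?_⟩
  · cases d <;> exact decide_eq_true r1
  · cases e <;> exact decide_eq_true r3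

/-- The budget of two leaves few cases. If the inequality of `exc_le` is strict, there is one pivot
and both good subgraphs have excess zero, so each label has a loop there. If it is sharp, there is
one pivot, which carries a rose, or there are two, and the Boolean dichotomy applies. -/
theorem Split.pair {a b : Fin n} (h : Split T {a} {b}) (hexc : exc T ≤ 2) :
    HasRose {a, b} T ∨ HasDouble {a, b} T := by
  have hab : a ≠ b := by simpa using h.disj
  have h1 := h.exc_le
  have h2 := Finset.card_pos.2 h.pivots_nonempty
  have h3 := exc_good_nonneg (T := T) h.ne₁
  have h4 := exc_good_nonneg (T := T) h.ne₂
  by_cases ht : exc T ≤ exc (good {a} T) + exc (good {b} T) + (pivots T {a} {b}).card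
  swap
  · have hp : (pivots T {a} {b}).card = 1 := by omega
    obtain ⟨x, hx⟩ := Finset.card_eq_one.1 hp
    refine .inl ⟨x, fun i hi => ?_⟩
    rcases Finset.mem_insert.1 hi with rfl | hi
    · exact h.loop_of_exc_zero (by omega) hx
    · obtain rfl := Finset.mem_singleton.1 hi
      exact h.symm.loop_of_exc_zero (by omega) (by rwa [pivots_comm])
  have hcases : (pivots T {a} {b}).card = 1 ∨ (pivots T {a} {b}).card = 2 := by omega
  rcases hcases with hp | hp
  · exact .inl (h.hasRose_of_tight ht hp)
  obtain ⟨c, hc, hcP⟩ := exists_bool_fun hp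
  have hA := h.bool_rel ht hcP
  have hB := h.symm.bool_rel (Split.tight_symm ht)
    (c := c) (fun v => by rw [pivots_comm]; exact hcP v)
  obtain ⟨p₀, p₁, p₂, p₃, ha1, hb1, -⟩ := hA true true
  simp only [cond_true, decide_eq_true_eq] at ha1 hb1
  have nA : ¬ ∀ p q : Bool, (c p, a, c q) ∈ T := not_all_edges hc h.conn hab.symm hexc hb1
  have nB : ¬ ∀ p q : Bool, (c p, b, c q) ∈ T := not_all_edges hc h.conn hab hexc ha1
  have hfun : ∀ (i : Fin n) (p q : Bool), cond p (cond q (decide ((c true, i, c true) ∈ T))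
      (decide ((c true, i, c false) ∈ T))) (cond q (decide ((c false, i, c true) ∈ T))
      (decide ((c false, i, c false) ∈ T))) = decide ((c p, i, c q) ∈ T) := by
    intro i p q
    cases p <;> cases q <;> rfl
  have key := bool_rel_dichotomy (decide ((c true, a, c true) ∈ T))
    (decide ((c true, a, c false) ∈ T)) (decide ((c false, a, c true) ∈ T))
    (decide ((c false, a, c false) ∈ T)) (decide ((c true, b, c true) ∈ T))
    (decide ((c true, b, c false) ∈ T)) (decide ((c false, b, c true) ∈ T))
    (decide ((c false, b, c false) ∈ T))
  simp only [hfun] at key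
  rcases key hA hB (by simpa using nA) (by simpa using nB) with ⟨p, h5, h6⟩ | ⟨⟨s, hs⟩, s', hs'⟩
  · refine .inl ⟨c p, fun i hi => ?_⟩
    rcases Finset.mem_insert.1 hi with rfl | hi
    · exact of_decide_eq_true h5
    · obtain rfl := Finset.mem_singleton.1 hi
      exact of_decide_eq_true h6
  · refine .inr ⟨c, hc, fun i => if i = a then s else s', fun i hi r => ?_⟩
    rcases Finset.mem_insert.1 hi with rfl | hi
    · simp only [if_true]
      exact of_decide_eq_true (hs r)
    · obtain rfl := Finset.mem_singleton.1 hi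
      simp only [if_neg hab.symm]
      exact of_decide_eq_true (hs' r)

end

/-! ### The action of words on a double cover -/

section parity

variable {s : Fin n → Bool} {w u v : List (Letter n)} {J : Finset (Fin n)}

/-- The permutation of the two vertices of a double cover effected by a word. -/
def parity (s : Fin n → Bool) : List (Letter n) → Bool
  | [] => false
  | l :: w => xor (s l.1) (parity s w)

theorem parity_append : parity s (u ++ v) = xor (parity s u) (parity s v) := by
  induction u with
  | nil => simp [parity]
  | cons l u ih => simp [parity, ih]

theorem reads_double {c : Bool → V} (hc : Function.Injective c) {D : Finset (V × Fin n × V)}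
    (hD : ∀ e ∈ D, ∃ r, e = (c r, e.2.1, c (xor r (s e.2.1)))) {r : Bool} {z : V}
    (h : Reads D (c r) w z) : z = c (xor r (parity s w)) := by
  induction w generalizing r with
  | nil => simpa [parity] using (show c r = z from h).symm
  | cons l w ih =>
    obtain ⟨z', h1, h2⟩ := h
    obtain ⟨r', h3⟩ := hD _ h1
    obtain ⟨i, b⟩ := l
    cases b
    · simp only [tri, Bool.false_eq_true, if_false, Prod.mk.injEq, true_and] at h3
      obtain ⟨rfl, h3⟩ := h3
      have h4 := hc h3
      have := ih h2
      rw [this, parity]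
      congr 1
      rw [h4]
      cases r' <;> cases s i <;> cases parity s w <;> rfl
    · simp only [tri, if_true, Prod.mk.injEq, true_and] at h3
      obtain ⟨h3, rfl⟩ := h3
      obtain rfl := hc h3
      have := ih h2
      rw [this, parity]
      congr 1
      cases r <;> cases s i <;> cases parity s w <;> rfl

/-- The connecting word is `b^±1 a^k b^±1`. The signs prevent cancellation at the ends, the two
letters `b` cancel in the parity, and `a` swaps, so the parity of `k` is decisive. -/
theorem exists_connect_parity {a b : Fin n} (ha : a ∈ J) (hb : b ∈ J) (hab : a ≠ b)
    (hsa : s a = true) (hu : Red u) (hv : Red v) (hune : u ≠ []) (hvne : v ≠ []) (m : ℕ) (r : Bool) :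
    ∃ c, m ≤ c.length ∧ Over J c ∧ Red (u ++ (c ++ v)) ∧ parity s c = r := by
  have hsign : ∀ l : Letter n, ∃ d : Bool, (b, d) ≠ linv l := by
    intro l
    by_contra! h
    simpa using (h true).trans (h false).symm
  obtain ⟨d₁, hd₁⟩ := hsign (u.getLast hune)
  obtain ⟨d₂, hd₂⟩ := hsign (v.head hvne)
  have hpar : ∀ k, parity s (List.replicate k (a, true)) = decide (k % 2 = 1) := by
    intro k
    induction k with
    | zero => rfl
    | succ k ih =>
      rw [List.replicate_succ, parity, ih, hsa]
      rcases Nat.mod_two_eq_zero_or_one k with h | h <;> simp [h, Nat.add_mod]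
  obtain ⟨k, hk, hkp⟩ : ∃ k, m + 1 ≤ k ∧ decide (k % 2 = 1) = r := by
    cases r
    · exact ⟨2 * (m + 1), by omega, by simp⟩
    · exact ⟨2 * (m + 1) + 1, by omega, by simp⟩
  refine ⟨(b, d₁) :: (List.replicate k (a, true) ++ [(b, d₂)]), by simp; omega, ?_, ?_, ?_⟩
  · refine over_cons.2 ⟨hb, over_append.2 ⟨over_replicate ha, by simpa [Over] using hb⟩⟩
  · have hne : List.replicate k (a, true) ≠ [] := by simp; omega
    have e1 : Red ([(b, d₂)] ++ v) := by
      refine red_append.2 ⟨red_singleton _, hv, fun x hx y hy h => hd₂ ?_⟩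
      rw [List.head?_eq_some_head hvne] at hy
      simp only [List.getLast?_singleton, Option.mem_def, Option.some.injEq] at hx hy
      rw [hy, eq_linv_comm, hx, h]
    have e2 : Red (List.replicate k (a, true) ++ ([(b, d₂)] ++ v)) := by
      refine red_append.2 ⟨red_replicate _ _, e1, fun x hx y hy h => hab ?_⟩
      have hx' := List.eq_of_mem_replicate (List.mem_of_getLast? hx)
      simp only [List.singleton_append, List.head?_cons, Option.mem_def, Option.some.injEq] at hy
      rw [hx', ← hy] at h
      exact (congrArg Prod.fst h).symm
    have e3 : Red ([(b, d₁)] ++ (List.replicate k (a, true) ++ ([(b, d₂)] ++ v))) := by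
      refine red_append.2 ⟨red_singleton _, e2, fun x hx y hy h => hab ?_⟩
      rw [List.head?_append_of_ne_nil _ hne] at hy
      have hy' := List.eq_of_mem_replicate (List.mem_of_head? hy)
      simp only [List.getLast?_singleton, Option.mem_def, Option.some.injEq] at hx
      rw [hy', ← hx] at h
      exact congrArg Prod.fst h
    have e4 : Red (u ++ ([(b, d₁)] ++ (List.replicate k (a, true) ++ ([(b, d₂)] ++ v)))) := by
      refine red_append.2 ⟨hu, e3, fun x hx y hy h => hd₁ ?_⟩
      rw [List.getLast?_eq_some_getLast hune] at hx
      simp only [List.singleton_append, List.head?_cons, Option.mem_def, Option.some.injEq] at hx hy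
      rw [hy, hx, h]
    simpa using e4
  · rw [parity, parity_append, hpar, hkp, parity, parity]
    cases s b <;> cases r <;> rfl

end parity


/-- Hall's marriage theorem for two points. -/
theorem exists_bool_perm : ∀ A : Bool → Bool → Bool, (∀ q, ∃ p, A p q = true) →
    (∀ p, ∃ q, A p q = true) → ∃ s, ∀ p, A p (xor p s) = true := by
  decide

/-! ### Induction on the alphabet -/

/-- The edges of a double cover. -/
noncomputable def doubleEdges (c : Bool → V) (s : Fin n → Bool) (J : Finset (Fin n)) :
    Finset (V × Fin n × V) :=
  (J ×ˢ (Finset.univ : Finset Bool)).image (fun r => (c r.2, r.1, c (xor r.2 (s r.1))))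

theorem card_doubleEdges {c : Bool → V} (hc : Function.Injective c) (s : Fin n → Bool)
    (J : Finset (Fin n)) : (doubleEdges c s J).card = 2 * J.card := by
  unfold doubleEdges
  rw [Finset.card_image_of_injective, Finset.card_product, Finset.card_univ, Fintype.card_bool,
    mul_comm]
  rintro ⟨i, r⟩ ⟨i', r'⟩ h
  simp only [Prod.mk.injEq] at h
  exact Prod.ext h.2.1 (hc h.1)

section

variable [NeZero n] {T : Finset (V × Fin n × V)} {J : Finset (Fin n)} {j : Fin n}

/-- For at least two labels every good component has positive excess, so a component that has the
whole excess leaves nothing for another. -/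
theorem Split.goodComps_eq_singleton (h : Split T J {j}) (hJ : 2 ≤ J.card)
    {D : Finset (V × Fin n × V)} (hD : D ∈ goodComps J T) (hexc : exc (good J T) ≤ exc D) :
    goodComps J T = {D} := by
  refine Finset.eq_singleton_iff_unique_mem.2 ⟨hD, fun D' hD' => ?_⟩
  by_contra hne
  have h1 : 1 ≤ exc D' := by
    obtain ⟨e, he, rfl⟩ := Finset.mem_image.1 hD'
    exact one_le_exc_of_allReads conn_comp hJ (Finset.mem_filter.1 he).2
  have h2 : ∑ E ∈ {D, D'}, exc E ≤ ∑ E ∈ goodComps J T, exc E :=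
    Finset.sum_le_sum_of_subset_of_nonneg
      (by
        intro E hE
        rcases Finset.mem_insert.1 hE with rfl | hE
        · exact hD
        · rwa [Finset.mem_singleton.1 hE])
      fun E hE _ => exc_goodComp_nonneg h.ne₁ hE
  rw [Finset.sum_pair (Ne.symm hne), ← exc_good_eq_sum] at h2
  omega

/-- A double cover for the alphabet `J` extends to one for `insert j J`. -/
theorem Split.hasDouble_insert (h : Split T J {j}) (hJ : 2 ≤ J.card)
    (hexc : exc T ≤ 2 * (J.card : ℤ)) (hg : exc (good J T) ≤ 2 * (J.card : ℤ) - 2)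
    {D : Finset (V × Fin n × V)} (hD : D ∈ goodComps J T) {c : Bool → V}
    (hc : Function.Injective c) {s : Fin n → Bool} (hs : ∀ i ∈ J, ∀ b, (c b, i, c (xor b (s i))) ∈ D)
    {a : Fin n} (ha : a ∈ J) (hsa : s a = true) : HasDouble (insert j J) T := by
  have hDconn : Conn D := by
    obtain ⟨e, he, rfl⟩ := Finset.mem_image.1 hD
    exact conn_comp
  set U : Finset V := Finset.univ.image c
  have hU : U.card = 2 := by
    rw [Finset.card_image_of_injective _ hc]
    simp
  have hcU : ∀ r, c r ∈ U := fun r => Finset.mem_image_of_mem _ (Finset.mem_univ r)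
  have hΔ := card_doubleEdges hc s J
  set Δ := doubleEdges c s J with hΔdef
  have hΔD : Δ ⊆ D := by
    intro e he
    obtain ⟨r, hr, rfl⟩ := Finset.mem_image.1 he
    exact hs _ (Finset.mem_product.1 hr).1 _
  have hUD : U ⊆ verts D := by
    intro v hv
    obtain ⟨r, -, rfl⟩ := Finset.mem_image.1 hv
    exact fst_mem_verts (hs a ha r)
  have hΔU : ∀ e ∈ Δ, e.1 ∈ U ∧ e.2.2 ∈ U := by
    intro e he
    obtain ⟨r, -, rfl⟩ := Finset.mem_image.1 he
    exact ⟨hcU _, hcU _⟩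
  have hreach : ∀ v ∈ verts D, ∃ u ∈ U, ∃ w, Reads D u w v := fun v hv =>
    ⟨c true, hcU _, hDconn _ (hUD (hcU _)) v hv⟩
  -- `Δ` has `2 * J.card` edges on two vertices, so its excess is the largest that `hg` allows.
  -- Hence `D` is `Δ` with trees attached and is the only good component for `J`; at most two pivots
  -- remain affordable.
  have c1 := card_sdiff_le hΔU hreach
  have c2 := Finset.card_sdiff_add_card_eq_card hΔD
  have c3 := Finset.card_sdiff_add_card_eq_card hUD
  have c4 := exc_goodComp_le h.ne₁ hD
  have hexcD : exc D = (D.card : ℤ) - (verts D).card := rfl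
  have htight : (D \ Δ).card ≤ (verts D \ U).card := by omega
  have hsing := h.goodComps_eq_singleton hJ hD (by omega)
  have hGD : good J T ⊆ D := by
    intro e he
    have : comp (restr J T) e.1 ∈ goodComps J T := Finset.mem_image_of_mem _ he
    rw [hsing, Finset.mem_singleton] at this
    rw [← this]
    exact mem_comp_fst (good_subset_restr he)
  have hDT : D ⊆ T := by
    obtain ⟨e, he, rfl⟩ := Finset.mem_image.1 hD
    exact comp_subset.trans restr_subset
  have hstay : ∀ {w : List (Letter n)} {x y : V}, Red w → x ∈ U → y ∈ U →
      Reads (good J T) x w y → Reads Δ x w y := fun hw hx hy hr =>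
    Reads.stay hΔU hreach htight hw hx hy (hr.mono hGD)
  have hact : ∀ {w : List (Letter n)} {r : Bool} {z : V}, Reads Δ (c r) w z →
      z = c (xor r (parity s w)) := fun hr => reads_double hc (by
    intro e he
    obtain ⟨r, -, rfl⟩ := Finset.mem_image.1 he
    exact ⟨r.2, rfl⟩) hr
  have e1 := h.exc_le
  have e2 := exc_good_nonneg (T := T) h.ne₂
  have hP : (pivots T J {j}).card ≤ 2 := by omega
  obtain ⟨M, p, hM⟩ := exists_return_letter hΔU hreach htight
  -- a letter that leads no pivot outside of `U` back to `U`
  obtain ⟨f, hfJ, hf⟩ : ∃ f : Letter n, f.1 ∈ J ∧ ∀ z ∈ pivots T J {j}, f ≠ p z := by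
    by_contra! hcon
    have : J ×ˢ (Finset.univ : Finset Bool) ⊆ (pivots T J {j}).image p := by
      intro f hf
      obtain ⟨z, hz, hzf⟩ := hcon f (Finset.mem_product.1 hf).1
      exact Finset.mem_image.2 ⟨z, hz, hzf.symm⟩
    have := (Finset.card_le_card this).trans Finset.card_image_le
    rw [Finset.card_product, Finset.card_univ, Fintype.card_bool] at this
    omega
  obtain ⟨w, hw⟩ := exists_isSync (T := T) h.ne₁
  obtain ⟨b, hb, hba⟩ : ∃ b ∈ J, b ≠ a := by
    by_contra! hcon
    have := Finset.card_le_one.2 fun x hx y hy => (hcon x hx).trans (hcon y hy).symm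
    omega
  obtain ⟨c₁, -, hc1, hc2, -⟩ := exists_connect_parity (s := s) ha hb hba.symm hsa
    (red_singleton f) hw.2.1 (by simp) hw.1 0 true
  obtain ⟨c₂, hc3, hc4, hc5, hc6⟩ := exists_connect_parity (s := s) ha hb hba.symm hsa
    hc2 (red_singleton (linv f)) (by simp) (by simp) M (!(parity s ([f] ++ (c₁ ++ w)) ^^ s f.1))
  -- The word `u` contains a synchronising word, it is longer than `M`, it swaps the two vertices of
  -- `Δ`, and both `u` and its inverse begin with `f`. By the choice of `f` and `M` a path labelled
  -- `u` between pivots can neither start nor end on an attached tree.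
  set u := ([f] ++ (c₁ ++ w)) ++ (c₂ ++ [linv f]) with hu
  have huJ : Over J u := by
    refine over_append.2 ⟨over_append.2 ⟨by simpa [Over] using hfJ, over_append.2 ⟨hc1, hw.2.2.1⟩⟩,
      over_append.2 ⟨hc4, by simpa [Over] using hfJ⟩⟩
  have hpar : parity s u = true := by
    rw [hu, parity_append, parity_append (u := c₂), hc6]
    simp only [parity, linv_fst]
    cases parity s ([f] ++ (c₁ ++ w)) <;> cases s f.1 <;> rfl
  have hwu : w <:+: u := ⟨[f] ++ c₁, c₂ ++ [linv f], by simp [hu]⟩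
  have hune : u ≠ [] := by simp [hu]
  have hPD : ∀ z ∈ pivots T J {j}, z ∈ verts D := fun z hz =>
    verts_mono hGD (Finset.mem_inter.1 hz).1
  obtain ⟨z, hz, z', hz', hr⟩ := h.exists_block hw hwu hc5 huJ
  have hzU : z ∈ U := by
    by_contra hzU
    have := hM z (Finset.mem_sdiff.2 ⟨hPD z hz, hzU⟩) f (c₁ ++ w ++ (c₂ ++ [linv f])) z'
      (hPD z' hz') (by simpa [hu] using hc5) (hf z hz) (by simpa [hu] using hr.mono hGD)
    simp only [List.length_append, List.length_singleton] at this
    omega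
  have hz'U : z' ∈ U := by
    by_contra hzU
    have hwinv : winv u = f :: winv ([f] ++ (c₁ ++ w) ++ c₂) := by
      simp [hu, winv]
    have := hM z' (Finset.mem_sdiff.2 ⟨hPD z' hz', hzU⟩) f (winv ([f] ++ (c₁ ++ w) ++ c₂)) z
      (hPD z hz) (by rw [← hwinv]; exact hc5.winv) (hf z' hz')
      (by rw [← hwinv]; exact (hr.mono hGD).symm)
    simp only [winv, List.length_reverse, List.length_map, List.length_append] at this
    omega
  have hzz := hstay hc5 hzU hz'U hr
  obtain ⟨r, -, rfl⟩ := Finset.mem_image.1 hzU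
  have hz'eq := hact hzz
  rw [hpar] at hz'eq
  subst hz'eq
  -- The path labelled `u` joins the two vertices of `Δ`, so both are pivots. This exhausts the
  -- budget.
  have hUP : U = pivots T J {j} := by
    refine Finset.eq_of_subset_of_card_le (fun v hv => ?_) (by omega)
    obtain ⟨r', -, rfl⟩ := Finset.mem_image.1 hv
    cases r <;> cases r' <;> assumption
  have ht : exc T ≤ exc (good J T) + exc (good {j} T) + (pivots T J {j}).card := by
    rw [← hUP, hU]
    omega
  -- Read `j^±1`, then `u`, then the inverse of the first letter. Since `u` swaps the two vertices,
  -- the outer letters provide an edge labelled `j^±1` into each of them.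
  have hblock : ∀ d : Bool, ∀ q, ∃ p, tri (c p) (j, d) (c q) ∈ T := by
    intro d
    obtain ⟨p₀, h0, p₁, h1, p₂, h2, p₃, h3, r1, r2, r3⟩ := h.symm.exists_blocks_tight
      (Split.tight_symm ht) (red_singleton (j, d)) (by simp [Over]) (by simp) hc5 huJ hune
      (red_singleton (j, !d)) (by simp [Over]) (by simp)
    rw [pivots_comm, ← hUP] at h0 h1 h2 h3
    have r4 := hstay hc5 h1 h2 r2
    obtain ⟨q₀, -, rfl⟩ := Finset.mem_image.1 h0
    obtain ⟨q₁, -, rfl⟩ := Finset.mem_image.1 h1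
    obtain ⟨q₃, -, rfl⟩ := Finset.mem_image.1 h3
    have r5 := hact r4
    rw [hpar] at r5
    subst r5
    have r6 := good_subset (reads_singleton.1 r1)
    have r7 := good_subset (reads_singleton.1 r3)
    rw [← tri_linv] at r7
    intro q
    rcases eq_or_ne q q₁ with rfl | hq
    · exact ⟨q₀, r6⟩
    · refine ⟨q₃, ?_⟩
      have : q = (q₁ ^^ true) := by cases q <;> cases q₁ <;> simp_all
      rw [this]
      simpa [linv] using r7
  obtain ⟨σ, hσ⟩ := exists_bool_perm (fun p q => decide ((c p, j, c q) ∈ T))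
    (fun q => by
      obtain ⟨p, hp⟩ := hblock true q
      exact ⟨p, decide_eq_true hp⟩)
    (fun q => by
      obtain ⟨p, hp⟩ := hblock false q
      exact ⟨p, decide_eq_true hp⟩)
  have hjJ : j ∉ J := by simpa using h.disj
  refine ⟨c, hc, fun i => if i = j then σ else s i, fun i hi r => ?_⟩
  rcases Finset.mem_insert.1 hi with rfl | hi
  · simp only [if_true]
    exact of_decide_eq_true (hσ r)
  · have : i ≠ j := fun hij => hjJ (hij ▸ hi)
    simp only [if_neg this]
    exact hDT (hs i hi r)

/-- Loops at distinct vertices contribute to the Euler characteristic. -/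
theorem card_loops_le (hT : Conn T) (hne : (verts T).Nonempty) :
    ((T.filter (fun e => e.1 = e.2.2)).card : ℤ) ≤ exc T + 1 := by
  obtain ⟨v, hv⟩ := hne
  -- Relative to a single root, the edges that are not loops already number at least all vertices
  -- but one.
  have h1 := card_sdiff_le_nonloop (T := T) (X := ∅) (U := {v}) (Y := verts T) (by simp)
    (fun y hy => ⟨v, by simp, hT v hv y hy⟩)
  rw [Finset.sdiff_empty] at h1
  have h2 := Finset.card_filter_add_card_filter_not (s := T) (fun e => e.1 = e.2.2)
  have h3 := Finset.card_sdiff_add_card_eq_card (Finset.singleton_subset_iff.2 hv)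
  rw [Finset.card_singleton] at h3
  simp only [ne_eq] at h1
  unfold exc
  omega

/-- If the roses for the various `J.erase j` had distinct centres, they would contain `k * (k - 1)`
loops, where `k = J.card`; only `2 * k - 1` are allowed, which is less for `k ≥ 3`. Two roses with a
common centre together have every label. -/
theorem hasRose_of_forall_erase (hT : Conn T) (hJ : 3 ≤ J.card)
    (hexc : exc T ≤ 2 * (J.card : ℤ) - 2) (h : ∀ j ∈ J, HasRose (J.erase j) T) : HasRose J T := by
  obtain ⟨j₀, hj₀⟩ : J.Nonempty := Finset.card_pos.1 (by omega)
  have : ∀ j, ∃ x, j ∈ J → ∀ i ∈ J.erase j, (x, i, x) ∈ T := by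
    intro j
    by_cases hj : j ∈ J
    · obtain ⟨x, hx⟩ := h j hj
      exact ⟨x, fun _ => hx⟩
    · obtain ⟨x, hx⟩ := h j₀ hj₀
      exact ⟨x, fun h' => absurd h' hj⟩
  choose x hx using this
  by_cases hinj : Set.InjOn x J
  · exfalso
    have hmap : ∀ r ∈ J.offDiag, (x r.1, r.2, x r.1) ∈ T.filter (fun e => e.1 = e.2.2) := by
      intro r hr
      obtain ⟨h1, h2, h3⟩ := Finset.mem_offDiag.1 hr
      exact Finset.mem_filter.2 ⟨hx _ h1 _ (Finset.mem_erase.2 ⟨h3.symm, h2⟩), rfl⟩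
    have h1 := Finset.card_le_card_of_injOn (s := J.offDiag)
      (t := T.filter (fun e : V × Fin n × V => e.1 = e.2.2)) (fun r => (x r.1, r.2, x r.1))
      (fun r hr => hmap r hr)
      (by
        intro r hr r' hr' hrr
        simp only [Prod.mk.injEq] at hrr
        exact Prod.ext (hinj (Finset.mem_offDiag.1 hr).1 (Finset.mem_offDiag.1 hr').1 hrr.1)
          hrr.2.1)
    rw [Finset.offDiag_card] at h1
    obtain ⟨j₁, hj₁⟩ : (J.erase j₀).Nonempty := Finset.card_pos.1 (by
      rw [Finset.card_erase_of_mem hj₀]; omega)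
    have h2 := card_loops_le hT ⟨_, fst_mem_verts (hx j₀ hj₀ j₁ hj₁)⟩
    have h3 : ((J.card * J.card - J.card : ℕ) : ℤ) = (J.card : ℤ) * J.card - J.card := by
      rw [Nat.cast_sub (Nat.le_mul_self _)]
      push_cast
      ring
    have h4 : ((J.card * J.card - J.card : ℕ) : ℤ) ≤
        ((T.filter (fun e => e.1 = e.2.2)).card : ℤ) := by exact_mod_cast h1
    have h5 : (3 : ℤ) ≤ J.card := by exact_mod_cast hJ
    nlinarith
  · unfold Set.InjOn at hinj
    push Not at hinj
    obtain ⟨j, hj, k, hk, hjk, hne⟩ := hinj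
    refine ⟨x j, fun i hi => ?_⟩
    by_cases hij : i = j
    · subst hij
      rw [hjk]
      exact hx k hk i (Finset.mem_erase.2 ⟨hne, hi⟩)
    · exact hx j hj i (Finset.mem_erase.2 ⟨hij, hi⟩)

/-- A connected labelled graph of small first Betti number that reads all reduced words contains
a covering of degree one or two. -/
theorem hasRose_or_hasDouble (hT : Conn T) (hJ : 2 ≤ J.card) (h : AllReads J T)
    (hexc : exc T ≤ 2 * (J.card : ℤ) - 2) : HasRose J T ∨ HasDouble J T := by
  obtain ⟨k, hk⟩ : ∃ k, J.card = k + 2 := ⟨J.card - 2, by omega⟩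
  induction k generalizing J T with
  | zero =>
    obtain ⟨a, b, hab, rfl⟩ := Finset.card_eq_two.1 hk
    refine Split.pair ⟨hT, ?_, by simpa using hab, by simp, by simp⟩ (by rw [hk] at hexc; simpa using hexc)
    rwa [← Finset.insert_eq]
  | succ k ih =>
    by_contra! hcon
    obtain ⟨hcon1, hcon2⟩ := hcon
    refine hcon1 (hasRose_of_forall_erase hT (by omega) hexc fun j hj => ?_)
    have hsp := split_erase hT hJ h hj
    have hcard : (J.erase j).card = k + 2 := by rw [Finset.card_erase_of_mem hj]; omega
    have hins : J.erase j ∪ {j} = J := by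
      rw [Finset.union_comm, ← Finset.insert_eq, Finset.insert_erase hj]
    have h1 := hsp.exc_le
    have h2 := Finset.card_pos.2 hsp.pivots_nonempty
    have h4 := exc_good_nonneg (T := T) hsp.ne₂
    -- Above the inductive bound the good subgraph for `J.erase j` uses up the budget except for one
    -- pivot, and `Split.hasRose_of_tight` applies.
    by_cases hg : exc (good (J.erase j) T) ≤ 2 * ((J.erase j).card : ℤ) - 2
    swap
    · refine absurd ?_ hcon1
      rw [← hins]
      exact hsp.hasRose_of_tight (by omega) (by omega)
    obtain ⟨x, hx⟩ := hsp.pivots_nonempty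
    have hD := mem_goodComps_of_mem_verts (Finset.mem_inter.1 hx).1
    have hall := allReads_of_mem_verts_good (Finset.mem_inter.1 hx).1
    rcases ih (T := comp (restr (J.erase j) T) x) conn_comp (by omega) hall
      ((exc_goodComp_le hsp.ne₁ hD).trans hg) hcard with hrose | ⟨c, hc, s, hs⟩
    · exact hrose.mono (comp_subset.trans restr_subset)
    · by_cases hswap : ∃ a ∈ J.erase j, s a = true
      · obtain ⟨a, ha, hsa⟩ := hswap
        refine absurd ?_ hcon2
        rw [← Finset.insert_erase hj]
        exact hsp.hasDouble_insert (by omega) (by omega) hg hD hc hs ha hsa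
      -- If no label swaps the two vertices, each of them is the centre of a rose.
      · push Not at hswap
        refine ⟨c true, fun i hi => ?_⟩
        have := restr_subset (comp_subset (hs i hi true))
        rwa [Bool.eq_false_iff.2 (hswap i hi), Bool.xor_false] at this

end


/-! ### Counting words -/

/-- The words of length `m`. -/
noncomputable def words (n m : ℕ) : Finset (List (Letter n)) :=
  (List.finite_length_eq (Letter n) m).toFinset

/-- The number of words of length `m` in a set of words. -/
noncomputable def wcount (S : Set (List (Letter n))) (m : ℕ) : ℕ :=
  ((words n m).filter (fun w => w ∈ S)).card

section count

variable {S S' : Set (List (Letter n))} {a b m : ℕ}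

theorem mem_words {w : List (Letter n)} : w ∈ words n m ↔ w.length = m := by
  simp [words]

theorem wcount_eq_ncard : wcount S m = (S ∩ {w | w.length = m}).ncard := by
  rw [wcount, ← Set.ncard_coe_finset]
  congr 1
  ext w
  simp [mem_words, and_comm]

theorem wcount_mono (h : ∀ w ∈ S, w.length = m → w ∈ S') : wcount S m ≤ wcount S' m := by
  refine Finset.card_le_card fun w hw => ?_
  obtain ⟨h1, h2⟩ := Finset.mem_filter.1 hw
  exact Finset.mem_filter.2 ⟨h1, h w h2 (mem_words.1 h1)⟩

theorem wcount_zero_le : wcount S 0 ≤ 1 := by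
  refine Finset.card_le_one.2 fun w hw w' hw' => ?_
  have h1 := mem_words.1 (Finset.mem_filter.1 hw).1
  have h2 := mem_words.1 (Finset.mem_filter.1 hw').1
  rw [List.length_eq_zero_iff.1 h1, List.length_eq_zero_iff.1 h2]

theorem wcount_le_sum {ι : Type*} (F : Finset ι) (A : ι → Set (List (Letter n)))
    (h : ∀ w ∈ S, w.length = m → ∃ i ∈ F, w ∈ A i) : wcount S m ≤ ∑ i ∈ F, wcount (A i) m := by
  refine le_trans (Finset.card_le_card (t := F.biUnion fun i =>
    (words n m).filter (fun w => w ∈ A i)) fun w hw => ?_) Finset.card_biUnion_le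
  obtain ⟨h1, h2⟩ := Finset.mem_filter.1 hw
  obtain ⟨i, hi, h3⟩ := h w h2 (mem_words.1 h1)
  exact Finset.mem_biUnion.2 ⟨i, hi, Finset.mem_filter.2 ⟨h1, h3⟩⟩

theorem wcount_le_add {A B : Set (List (Letter n))}
    (h : ∀ w ∈ S, w.length = m → w ∈ A ∨ w ∈ B) : wcount S m ≤ wcount A m + wcount B m := by
  refine le_trans (Finset.card_le_card (t := (words n m).filter (fun w => w ∈ A) ∪
    (words n m).filter (fun w => w ∈ B)) fun w hw => ?_) (Finset.card_union_le _ _)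
  obtain ⟨h1, h2⟩ := Finset.mem_filter.1 hw
  rcases h w h2 (mem_words.1 h1) with h3 | h3
  · exact Finset.mem_union_left _ (Finset.mem_filter.2 ⟨h1, h3⟩)
  · exact Finset.mem_union_right _ (Finset.mem_filter.2 ⟨h1, h3⟩)

/-- The number of concatenations of words `u ∈ A` with words in a set that depends on `u`. -/
theorem wcount_le_mul {A : Set (List (Letter n))} {B : List (Letter n) → Set (List (Letter n))}
    {C : ℕ} (h : ∀ w ∈ S, w.length = a + b → ∃ u ∈ A, ∃ v ∈ B u, u.length = a ∧ w = u ++ v)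
    (hB : ∀ u ∈ A, u.length = a → wcount (B u) b ≤ C) : wcount S (a + b) ≤ wcount A a * C := by
  refine le_trans (Finset.card_le_card (t := ((words n a).filter (fun w => w ∈ A)).biUnion fun u =>
    ((words n b).filter (fun w => w ∈ B u)).image (fun v => u ++ v)) fun w hw => ?_) ?_
  · obtain ⟨h1, h2⟩ := Finset.mem_filter.1 hw
    rw [mem_words] at h1
    obtain ⟨u, hu, v, hv, hlen, rfl⟩ := h w h2 h1
    rw [List.length_append, hlen] at h1
    exact Finset.mem_biUnion.2 ⟨u, Finset.mem_filter.2 ⟨mem_words.2 hlen, hu⟩,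
      Finset.mem_image_of_mem _ (Finset.mem_filter.2 ⟨mem_words.2 (by omega), hv⟩)⟩
  · refine Finset.card_biUnion_le_card_mul _ _ _ fun u hu => Finset.card_image_le.trans ?_
    obtain ⟨h1, h2⟩ := Finset.mem_filter.1 hu
    exact hB u h2 (mem_words.1 h1)

theorem wcount_cons_le {l : Letter n} (h : ∀ w ∈ S, w.length = m + 1 → ∃ v ∈ S', w = l :: v) :
    wcount S (m + 1) ≤ wcount S' m := by
  refine le_trans (Finset.card_le_card (t := ((words n m).filter (fun w => w ∈ S')).image
    (fun v => l :: v)) fun w hw => ?_) Finset.card_image_le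
  obtain ⟨h1, h2⟩ := Finset.mem_filter.1 hw
  rw [mem_words] at h1
  obtain ⟨v, hv, rfl⟩ := h w h2 h1
  exact Finset.mem_image_of_mem _ (Finset.mem_filter.2 ⟨mem_words.2 (by simpa using h1), hv⟩)

/-- The words that continue a reduced word ending in `a`. -/
def after (a : Letter n) : Set (List (Letter n)) := {w | Red (a :: w)}

theorem wcount_cons_eq (F : Finset (Letter n))
    (h : ∀ w, w ∈ S ↔ w = [] ∨ ∃ l ∈ F, ∃ v ∈ after l, w = l :: v) :
    wcount S (m + 1) = ∑ l ∈ F, wcount (after l) m := by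
  have : (words n (m + 1)).filter (fun w => w ∈ S) =
      F.biUnion fun l => ((words n m).filter (fun w => w ∈ after l)).image (fun v => l :: v) := by
    ext w
    simp only [Finset.mem_filter, mem_words, Finset.mem_biUnion, Finset.mem_image, h]
    constructor
    · rintro ⟨h1, rfl | ⟨l, hl, v, hv, rfl⟩⟩
      · simp at h1
      · exact ⟨l, hl, v, ⟨by simpa using h1, hv⟩, rfl⟩
    · rintro ⟨l, hl, v, ⟨h1, hv⟩, rfl⟩
      exact ⟨by simpa using h1, .inr ⟨l, hl, v, hv, rfl⟩⟩
  rw [wcount, this, Finset.card_biUnion]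
  · refine Finset.sum_congr rfl fun l _ => Finset.card_image_of_injective _ fun v v' hv => ?_
    exact (List.cons.inj hv).2
  · intro l _ l' _ hll
    rw [Function.onFun, Finset.disjoint_left]
    intro w hw hw'
    obtain ⟨v, -, rfl⟩ := Finset.mem_image.1 hw
    obtain ⟨v', -, h'⟩ := Finset.mem_image.1 hw'
    exact hll (List.cons.inj h').1.symm

theorem wcount_after (a : Letter n) (m : ℕ) : wcount (after a) m = (2 * n - 1) ^ m := by
  induction m generalizing a with
  | zero =>
    rw [wcount, pow_zero, Finset.card_eq_one]
    refine ⟨[], ?_⟩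
    ext w
    simp only [Finset.mem_filter, mem_words, List.length_eq_zero_iff, Finset.mem_singleton,
      and_iff_left_iff_imp]
    rintro rfl
    exact red_singleton a
  | succ m ih =>
    rw [wcount_cons_eq (Finset.univ.erase (linv a)), Finset.sum_congr rfl fun l _ => ih l,
      Finset.sum_const, Finset.card_erase_of_mem (Finset.mem_univ _), Finset.card_univ,
      smul_eq_mul, pow_succ, mul_comm]
    · simp [mul_comm]
    · intro w
      cases w with
      | nil => simp [after, red_singleton]
      | cons l v =>
        simp only [after, Set.mem_ofPred_eq, red_cons_cons, reduceCtorEq, false_or,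
          Finset.mem_erase, Finset.mem_univ, and_true, List.cons.injEq]
        constructor
        · rintro ⟨h1, h2⟩
          exact ⟨l, h1, v, h2, rfl, rfl⟩
        · rintro ⟨l', h1, v', h2, rfl, rfl⟩
          exact ⟨h1, h2⟩

theorem wcount_red_succ (m : ℕ) :
    wcount {w : List (Letter n) | Red w} (m + 1) = 2 * n * (2 * n - 1) ^ m := by
  rw [wcount_cons_eq Finset.univ, Finset.sum_congr rfl fun l _ => wcount_after l m,
    Finset.sum_const, Finset.card_univ, smul_eq_mul]
  · simp [mul_comm]
  · intro w
    cases w with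
    | nil => simp [red_nil]
    | cons l v => simp [after]

theorem wcount_red_le (hn : 1 ≤ n) (m : ℕ) :
    wcount {w : List (Letter n) | Red w} m ≤ 2 * (2 * n - 1) ^ m := by
  cases m with
  | zero => exact wcount_zero_le.trans (by simp)
  | succ m =>
    rw [wcount_red_succ, pow_succ, ← mul_assoc, mul_comm _ (2 * n - 1), ← mul_assoc]
    exact Nat.mul_le_mul_right _ (by omega)

theorem le_wcount_red (hn : 1 ≤ n) (m : ℕ) :
    (2 * n - 1) ^ m ≤ wcount {w : List (Letter n) | Red w} m := by
  cases m with
  | zero =>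
    rw [pow_zero, Nat.one_le_iff_ne_zero, ← Nat.pos_iff_ne_zero, wcount, Finset.card_pos]
    exact ⟨[], Finset.mem_filter.2 ⟨mem_words.2 rfl, red_nil⟩⟩
  | succ m =>
    rw [wcount_red_succ, pow_succ, mul_comm]
    exact Nat.mul_le_mul_right _ (by omega)

end count

/-! ### Graphs of bounded size that miss a word -/

section unreadable

variable {H : Finset (V × Fin n × V)} {u : List (Letter n)}

/-- The readable continuations of a reduced word ending in `a`. -/
def readableAfter (H : Finset (V × Fin n × V)) (a : Letter n) : Set (List (Letter n)) :=
  {w | Red (a :: w) ∧ Readable H w}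

/-- Submultiplicativity: cut after `m₁` letters, of which the last, present as `m₁ ≠ 0`, constrains
the rest. -/
theorem wcount_readableAfter_add_le {C m₁ m₂ : ℕ} (hm : m₁ ≠ 0) (a : Letter n)
    (hC : ∀ b, wcount (readableAfter H b) m₂ ≤ C) :
    wcount (readableAfter H a) (m₁ + m₂) ≤ wcount (readableAfter H a) m₁ * C := by
  refine wcount_le_mul (A := readableAfter H a)
    (B := fun u => {v | ∀ b ∈ u.getLast?, v ∈ readableAfter H b}) (fun w hw hlen => ?_) ?_
  · obtain ⟨h1, h2⟩ := hw
    rw [← List.take_append_drop m₁ w] at h1 h2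
    refine ⟨w.take m₁, ⟨?_, h2.infix ⟨[], _, rfl⟩⟩, w.drop m₁, fun b hb => ⟨?_, h2.infix ⟨w.take m₁, [],
      by simp⟩⟩, by simp; omega, (List.take_append_drop _ _).symm⟩
    · exact ((red_append (w := a :: w.take m₁) (w' := w.drop m₁)).1 h1).1
    · have h3 := (red_append (w := a :: w.take m₁) (w' := w.drop m₁)).1 h1
      refine (red_append (w := [b]) (w' := w.drop m₁)).2 ⟨red_singleton _, h3.2.1, fun x hx y hy => h3.2.2 x ?_ y hy⟩
      simp only [List.getLast?_singleton, Option.mem_def, Option.some.injEq] at hx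
      subst hx
      rw [List.getLast?_cons]
      simp only [Option.mem_def] at hb ⊢
      rw [hb]
      rfl
  · intro u _ hu
    have hne : u ≠ [] := by
      rintro rfl
      exact hm hu.symm
    refine le_trans (wcount_mono fun v hv _ => ?_) (hC (u.getLast hne))
    exact hv _ (List.getLast?_eq_some_getLast hne)

theorem wcount_readableAfter_le (a : Letter n) (m : ℕ) :
    wcount (readableAfter H a) m ≤ (2 * n - 1) ^ m := by
  rw [← wcount_after a m]
  exact wcount_mono fun w hw _ => hw.1

/-- At least one continuation is lost, a connecting letter followed by the unreadable word. -/
theorem wcount_readableAfter_lt (hn : 2 ≤ n) (hu : Red u) (hne : u ≠ []) (h : ¬ Readable H u)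
    (a : Letter n) :
    wcount (readableAfter H a) (u.length + 1) ≤ (2 * n - 1) ^ (u.length + 1) - 1 := by
  refine Nat.le_sub_one_of_lt ?_
  rw [← wcount_after a (u.length + 1)]
  obtain ⟨c, -, hc1, hc2⟩ := exists_connect (J := Finset.univ) (a := a) (b := u.head hne)
    (j := (⟨0, by omega⟩ : Fin n)) (k := ⟨1, by omega⟩) (Finset.mem_univ _) (Finset.mem_univ _)
    (by simp)
  refine Finset.card_lt_card ⟨fun w hw => ?_, fun hsub => ?_⟩
  · obtain ⟨h1, h2⟩ := Finset.mem_filter.1 hw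
    exact Finset.mem_filter.2 ⟨h1, h2.1⟩
  · have : c :: u ∈ (words n (u.length + 1)).filter (fun w => w ∈ after a) := by
      refine Finset.mem_filter.2 ⟨mem_words.2 rfl, ?_⟩
      refine red_cons_cons.2 ⟨hc1, (red_append (w := [c]) (w' := u)).2 ⟨red_singleton _, hu, ?_⟩⟩
      intro x hx y hy
      rw [List.head?_eq_some_head hne] at hy
      simp only [List.getLast?_singleton, Option.mem_def, Option.some.injEq] at hx hy
      subst hx hy
      exact hc2
    have h3 := (Finset.mem_filter.1 (hsub this)).2.2
    exact h (h3.infix ⟨[c], [], by simp⟩)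

theorem exists_eight_mul_pow_le {q : ℕ} (hq : 1 ≤ q) : ∃ k, 8 * (q - 1) ^ k ≤ q ^ k := by
  have hlt : ((q - 1 : ℕ) : ℝ) / q < 1 := by
    rw [div_lt_one (by exact_mod_cast hq)]
    exact_mod_cast (by omega : q - 1 < q)
  obtain ⟨k, hk⟩ := exists_pow_lt_of_lt_one (show (0 : ℝ) < 1 / 8 by norm_num) hlt
  refine ⟨k, ?_⟩
  have hq' : (0 : ℝ) < q := by exact_mod_cast hq
  rw [div_pow, div_lt_div_iff₀ (by positivity) (by norm_num)] at hk
  have : ((8 * (q - 1) ^ k : ℕ) : ℝ) ≤ ((q ^ k : ℕ) : ℝ) := by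
    push_cast
    linarith
  exact_mod_cast this

theorem wcount_readable_succ_le {C m : ℕ} (hC : ∀ a, wcount (readableAfter H a) m ≤ C) :
    wcount {w : List (Letter n) | Red w ∧ Readable H w} (m + 1) ≤ 2 * n * C := by
  refine (wcount_le_sum Finset.univ (fun a => {w | ∃ v ∈ readableAfter H a, w = a :: v})
    fun w hw hlen => ?_).trans ((Finset.sum_le_card_nsmul _ _ C fun a _ => ?_).trans ?_)
  · cases w with
    | nil => simp at hlen
    | cons a v =>
      exact ⟨a, Finset.mem_univ _, v, ⟨hw.1, hw.2.infix ⟨[a], [], by simp⟩⟩, rfl⟩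
  · exact (wcount_cons_le (l := a) fun w hw _ => hw).trans (hC a)
  · simp [Finset.card_univ, mul_comm]

theorem wcount_readableAfter_mul_le {h C : ℕ} (hh : h ≠ 0)
    (hC : ∀ a, wcount (readableAfter H a) h ≤ C) (k : ℕ) :
    ∀ a, wcount (readableAfter H a) (h * k) ≤ C ^ k := by
  induction k with
  | zero => intro a; exact wcount_zero_le.trans (by simp)
  | succ k ih =>
    intro a
    rw [Nat.mul_succ, Nat.add_comm, pow_succ, mul_comm (C ^ k)]
    exact (wcount_readableAfter_add_le hh a ih).trans (Nat.mul_le_mul_right _ (hC a))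

/-- If some reduced word is not readable, long words are rarely readable. -/
theorem exists_readable_bound [Nonempty V] (hn : 2 ≤ n)
    (h : ∃ u : List (Letter n), Red u ∧ ¬ Readable H u) :
    ∃ ℓ₀, ∀ ℓ, ℓ₀ ≤ ℓ →
      2 * wcount {w : List (Letter n) | Red w ∧ Readable H w} ℓ ≤ (2 * n - 1) ^ ℓ := by
  obtain ⟨u, hu, hur⟩ := h
  have hune : u ≠ [] := by
    rintro rfl
    obtain ⟨x⟩ := ‹Nonempty V›
    exact hur ⟨x, x, rfl⟩
  have hlt := wcount_readableAfter_lt hn hu hune hur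
  obtain ⟨h, hh⟩ : ∃ h, h = u.length + 1 := ⟨_, rfl⟩
  obtain ⟨lam, hlam⟩ : ∃ lam, lam = 2 * n - 1 := ⟨_, rfl⟩
  obtain ⟨q, hq⟩ : ∃ q, q = lam ^ h := ⟨_, rfl⟩
  have hq1 : 1 ≤ q := hq ▸ Nat.one_le_pow _ _ (by omega)
  rw [← hh, ← hlam, ← hq] at hlt
  -- Each block of length `h` loses at least one of its `q` continuations. The factor 8 gained after
  -- `k` blocks pays for the factor 2 in the claim and for the `2 * n` choices of a first letter.
  obtain ⟨k, hk⟩ := exists_eight_mul_pow_le hq1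
  refine ⟨h * (k + 1) + 1, fun ℓ hℓ => ?_⟩
  obtain ⟨r, rfl⟩ : ∃ r, ℓ = h * (k + 1) + r + 1 := ⟨ℓ - (h * (k + 1) + 1), by omega⟩
  have h1 : ∀ a, wcount (readableAfter H a) (h * (k + 1) + r) ≤ (q - 1) ^ (k + 1) * lam ^ r :=
    fun a => (wcount_readableAfter_add_le (by rw [hh]; positivity) a fun b =>
      (wcount_readableAfter_le b r).trans_eq (by rw [hlam])).trans (Nat.mul_le_mul_right _
        (wcount_readableAfter_mul_le (by omega) hlt _ _))
  have h2 := wcount_readable_succ_le h1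
  have h3 : (q - 1) ^ (k + 1) * 8 ≤ q ^ (k + 1) := by
    rw [pow_succ, pow_succ]
    calc (q - 1) ^ k * (q - 1) * 8 = (8 * (q - 1) ^ k) * (q - 1) := by ring
      _ ≤ q ^ k * q := Nat.mul_le_mul hk (by omega)
  rw [← hlam]
  calc 2 * wcount {w : List (Letter n) | Red w ∧ Readable H w} (h * (k + 1) + r + 1)
      ≤ 2 * (2 * n * ((q - 1) ^ (k + 1) * lam ^ r)) := Nat.mul_le_mul_left _ h2
    _ = n * ((q - 1) ^ (k + 1) * 4) * lam ^ r := by ring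
    _ ≤ lam * (q ^ (k + 1)) * lam ^ r := by
      refine Nat.mul_le_mul_right _ (Nat.mul_le_mul (by omega) (le_trans ?_ h3))
      exact Nat.mul_le_mul_left _ (by norm_num)
    _ = lam ^ (h * (k + 1) + r + 1) := by
      rw [hq]
      ring

/-- Relabelling of the vertices by numbers less than `M`. -/
theorem exists_relabel [Nonempty V] {M : ℕ} (H : Finset (V × Fin n × V))
    (hH : (verts H).card ≤ M) : ∃ H' : Finset (Fin (M + 1) × Fin n × Fin (M + 1)),
      ∀ w, Readable H' w ↔ Readable H w := by
  obtain ⟨φ⟩ : Nonempty ((verts H : Set V) ↪ Fin (M + 1)) := by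
    refine Function.Embedding.nonempty_of_card_le ?_
    simp
    omega
  let g : V → Fin (M + 1) := fun v => if hv : v ∈ (verts H : Set V) then φ ⟨v, hv⟩ else 0
  have hg : Set.InjOn g (verts H) := by
    intro v hv v' hv' h
    simp only [g, dif_pos hv, dif_pos hv'] at h
    exact congrArg Subtype.val (φ.injective h)
  refine ⟨H.image (fun e => (g e.1, e.2.1, g e.2.2)), fun w => ⟨?_, ?_⟩⟩
  · rintro ⟨x, y, hr⟩
    refine ⟨_, _, hr.map (Function.invFunOn g (verts H)) fun e he => ?_⟩
    obtain ⟨e', he', rfl⟩ := Finset.mem_image.1 he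
    have h3 := hg.leftInvOn_invFunOn (fst_mem_verts he')
    have h4 := hg.leftInvOn_invFunOn (snd_mem_verts he')
    dsimp only
    rw [h3, h4]
    exact he'
  · rintro ⟨x, y, hr⟩
    exact ⟨g x, g y, hr.map g fun e he => Finset.mem_image_of_mem _ he⟩

/-- The bound of `exists_readable_bound` is uniform for graphs with few vertices. -/
theorem exists_uniform_readable_bound (V : Type*) [Nonempty V] (hn : 2 ≤ n) (M : ℕ) : ∃ ℓ, 1 ≤ ℓ ∧
    ∀ H : Finset (V × Fin n × V), (verts H).card ≤ M →
      (∃ u : List (Letter n), Red u ∧ ¬ Readable H u) →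
      2 * wcount {w : List (Letter n) | Red w ∧ Readable H w} ℓ ≤ (2 * n - 1) ^ ℓ := by
  have : ∀ H : Finset (Fin (M + 1) × Fin n × Fin (M + 1)), ∃ ℓ₀,
      (∃ u : List (Letter n), Red u ∧ ¬ Readable H u) → ∀ ℓ, ℓ₀ ≤ ℓ →
        2 * wcount {w : List (Letter n) | Red w ∧ Readable H w} ℓ ≤ (2 * n - 1) ^ ℓ := by
    intro H
    by_cases h : ∃ u : List (Letter n), Red u ∧ ¬ Readable H u
    · obtain ⟨ℓ₀, hℓ⟩ := exists_readable_bound hn h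
      exact ⟨ℓ₀, fun _ => hℓ⟩
    · exact ⟨0, fun h' => absurd h' h⟩
  choose f hf using this
  -- Up to relabelling only finitely many graphs occur, so their thresholds have a maximum.
  refine ⟨Finset.univ.sup f + 1, by omega, fun H hH hun => ?_⟩
  obtain ⟨H', hH'⟩ := exists_relabel H hH
  simp only [← hH'] at hun ⊢
  exact hf H' hun _ ((Finset.le_sup (Finset.mem_univ H')).trans (Nat.le_succ _))

end unreadable


/-! ### Renewal argument for sparse graphs -/

/-- The oriented edges that start at a vertex. -/
noncomputable def outs (T : Finset (V × Fin n × V)) (v : V) : Finset (Letter n × V) :=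
  (Finset.univ ×ˢ verts T).filter (fun o => tri v o.1 o.2 ∈ T)

/-- A labelled graph of degree at most `q`, and of degree at most two outside of the set `Q` of at
most `q` vertices. -/
structure Sparse (T : Finset (V × Fin n × V)) (Q : Finset V) (q : ℕ) : Prop where
  card_le : Q.card ≤ q
  outs_le : ∀ v, (outs T v).card ≤ q
  outs_le_two : ∀ v, v ∉ Q → (outs T v).card ≤ 2

/-- Some reduced path of length at most `k` that starts with the oriented edge labelled `l` with end
`y` leads to `Q`. -/
def Ret (T : Finset (V × Fin n × V)) (Q : Finset V) (k : ℕ) (l : Letter n) (y : V) : Prop :=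
  ∃ w z, Red (l :: w) ∧ w.length + 1 ≤ k ∧ z ∈ Q ∧ Reads T y w z

/-- The reduced words that can be read from some vertex in `X`. -/
def readFrom (T : Finset (V × Fin n × V)) (X : Finset V) : Set (List (Letter n)) :=
  {w | Red w ∧ ∃ x ∈ X, ∃ y, Reads T x w y}

/-- The words that continue a reduced path that ends with the letter `l` at the vertex `y`. -/
def cont (T : Finset (V × Fin n × V)) (y : V) (l : Letter n) : Set (List (Letter n)) :=
  {w | Red (l :: w) ∧ ∃ z, Reads T y w z}

/-- The edges on reduced paths of length at most `L` from `Q` to `Q`. -/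
noncomputable def core (T : Finset (V × Fin n × V)) (Q : Finset V) (L : ℕ) :
    Finset (V × Fin n × V) :=
  T.filter fun e => ∃ x ∈ Q, ∃ z ∈ Q, ∃ w₁ l w₂ a b, Red (w₁ ++ l :: w₂) ∧
    (w₁ ++ l :: w₂).length ≤ L ∧ Reads T x w₁ a ∧ e = tri a l b ∧ Reads T b w₂ z

/-- The vertices at distance at most `k` from `Q`. -/
noncomputable def ball (T : Finset (V × Fin n × V)) (Q : Finset V) : ℕ → Finset V
  | 0 => Q
  | k + 1 => ball T Q k ∪ (ball T Q k).biUnion fun v => (outs T v).image Prod.snd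

section renewal

variable {T H : Finset (V × Fin n × V)} {Q X : Finset V} {q L L' k r ℓ : ℕ} {x y v : V}
  {l : Letter n} {w : List (Letter n)} {K μ : ℝ}

theorem mem_outs {o : Letter n × V} : o ∈ outs T v ↔ tri v o.1 o.2 ∈ T := by
  rw [outs, Finset.mem_filter, Finset.mem_product]
  exact ⟨fun h => h.2, fun h => ⟨⟨Finset.mem_univ _, right_mem_verts h⟩, h⟩⟩

theorem wcount_univ_le (m : ℕ) : wcount (Set.univ : Set (List (Letter n))) m ≤ (2 * n) ^ m := by
  induction m with
  | zero => exact wcount_zero_le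
  | succ m ih =>
    refine (wcount_le_sum Finset.univ (fun a => {w | ∃ v : List (Letter n), w = a :: v})
      fun w _ hlen => ?_).trans ((Finset.sum_le_card_nsmul _ _ ((2 * n) ^ m) fun a _ => ?_).trans ?_)
    · cases w with
      | nil => simp at hlen
      | cons a v => exact ⟨a, Finset.mem_univ _, v, rfl⟩
    · refine (wcount_cons_le (l := a) (S' := Set.univ) fun w hw _ => ?_).trans ih
      obtain ⟨v, rfl⟩ := hw
      exact ⟨v, trivial, rfl⟩
    · simp [Finset.card_univ, pow_succ, mul_comm]

/-- Outside of `Q` there is at most one way to continue a reduced path. -/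
theorem Sparse.unique (hs : Sparse T Q q) (hy : y ∉ Q) (ht : tri x l y ∈ T) {l₁ l₂ : Letter n}
    {y₁ y₂ : V} (h₁ : tri y l₁ y₁ ∈ T) (h₂ : tri y l₂ y₂ ∈ T) (hl₁ : l₁ ≠ linv l)
    (hl₂ : l₂ ≠ linv l) : l₁ = l₂ ∧ y₁ = y₂ := by
  by_contra hne
  have hne' : ((l₁, y₁) : Letter n × V) ≠ (l₂, y₂) := fun h => hne (Prod.ext_iff.1 h)
  have hsub : ({(linv l, x), (l₁, y₁), (l₂, y₂)} : Finset (Letter n × V)) ⊆ outs T y := by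
    intro o ho
    simp only [Finset.mem_insert, Finset.mem_singleton] at ho
    rw [mem_outs]
    rcases ho with rfl | rfl | rfl
    · rwa [tri_linv]
    · exact h₁
    · exact h₂
  have h3 : ({(linv l, x), (l₁, y₁), (l₂, y₂)} : Finset (Letter n × V)).card = 3 :=
    Finset.card_eq_three.2 ⟨_, _, _, fun h => hl₁ (Prod.ext_iff.1 h).1.symm,
      fun h => hl₂ (Prod.ext_iff.1 h).1.symm, hne', rfl⟩
  have := (Finset.card_le_card hsub).trans (hs.outs_le_two y hy)
  omega

/-- Paths that do not return to `Q` within `r` steps are forced for `r` steps. -/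
theorem pow_mul_wcount_cont_le (hs : Sparse T Q q) (hK : 1 ≤ K) (hμ : 1 ≤ μ)
    (hQ : ∀ j ≤ k, (wcount (readFrom T Q) j : ℝ) ≤ K * μ ^ j) (hrk : r ≤ k)
    (ht : tri x l y ∈ T) (hno : ¬ Ret T Q r l y) :
    μ ^ r * wcount (cont T y l) k ≤ K * μ ^ k := by
  induction k generalizing r x l y with
  | zero =>
    obtain rfl : r = 0 := by omega
    have : (wcount (cont T y l) 0 : ℝ) ≤ 1 := by exact_mod_cast wcount_zero_le
    simpa using this.trans hK
  | succ k ih =>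
    by_cases hy : y ∈ Q
    -- Being in `Q` already is a return of length one, so no step is forced and the words are
    -- counted from `Q`.
    · have hr : r = 0 := by
        by_contra hr
        exact hno ⟨[], y, red_singleton l, by simp; omega, hy, rfl⟩
      subst hr
      rw [pow_zero, one_mul]
      refine le_trans ?_ (hQ (k + 1) le_rfl)
      exact Nat.cast_le.2 (wcount_mono (S' := readFrom T Q) fun w hw _ =>
        ⟨hw.1.tail, y, hy, hw.2⟩)
    · by_cases hex : ∃ l' y', l' ≠ linv l ∧ tri y l' y' ∈ T
      -- Outside of `Q` the next letter is forced: the count does not grow, while the bound gains a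
      -- factor `μ`.
      · obtain ⟨l', y', hl', ht'⟩ := hex
        have hno' : ¬ Ret T Q (r - 1) l' y' := by
          rintro ⟨w, z, h1, h2, h3, h4⟩
          exact hno ⟨l' :: w, z, red_cons_cons.2 ⟨hl', h1⟩, by simp; omega, h3, y', ht', h4⟩
        have h1 := ih (fun j hj => hQ j (hj.trans (Nat.le_succ _))) (by omega) ht' hno'
        have h2 : (wcount (cont T y l) (k + 1) : ℝ) ≤ wcount (cont T y' l') k := by
          refine Nat.cast_le.2 (wcount_cons_le (l := l') fun w hw hlen => ?_)
          obtain ⟨hw1, z, hw2⟩ := hw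
          cases w with
          | nil => simp at hlen
          | cons l'' w =>
            obtain ⟨y'', ht'', hr⟩ := hw2
            obtain ⟨hl'', hw1⟩ := red_cons_cons.1 hw1
            obtain ⟨rfl, rfl⟩ := hs.unique hy ht ht'' ht' hl'' hl'
            exact ⟨w, ⟨hw1, z, hr⟩, rfl⟩
        have h3 : μ ^ r ≤ μ ^ (r - 1) * μ := by
          rw [← pow_succ]
          exact pow_le_pow_right₀ hμ (by omega)
        have h0 : (0 : ℝ) ≤ μ := by linarith
        calc μ ^ r * wcount (cont T y l) (k + 1)
            ≤ (μ ^ (r - 1) * μ) * wcount (cont T y' l') k := by gcongr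
          _ = (μ ^ (r - 1) * wcount (cont T y' l') k) * μ := by ring
          _ ≤ (K * μ ^ k) * μ := by gcongr
          _ = K * μ ^ (k + 1) := by ring
      · have h1 : wcount (cont T y l) (k + 1) ≤ wcount (∅ : Set (List (Letter n))) (k + 1) := by
          refine wcount_mono fun w hw hlen => ?_
          obtain ⟨hw1, z, hw2⟩ := hw
          cases w with
          | nil => simp at hlen
          | cons l'' w =>
            obtain ⟨y'', ht'', hr⟩ := hw2
            exact absurd ⟨l'', y'', (red_cons_cons.1 hw1).1, ht''⟩ hex
        have h2 : wcount (cont T y l) (k + 1) = 0 := by simpa [wcount] using h1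
        have h0 : (0 : ℝ) ≤ μ := by linarith
        rw [h2]
        simp only [Nat.cast_zero, mul_zero]
        positivity

theorem core_subset : core T Q L ⊆ T := Finset.filter_subset _ _

theorem tri_mem_core (hx : x ∈ Q) (ht : tri x l y ∈ T) (h : Ret T Q L l y) :
    tri x l y ∈ core T Q L := by
  obtain ⟨w, z, h1, h2, h3, h4⟩ := h
  exact Finset.mem_filter.2 ⟨ht, x, hx, z, h3, [], l, w, x, y, h1, by simpa using h2, rfl, rfl, h4⟩

/-- A reduced path through a core vertex outside of `Q` uses two different oriented edges there, and
the degree is at most two. So the core contains all edges at this vertex, and a path can leave the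
core only from `Q`. -/
theorem tri_mem_core_of_mem_verts (hs : Sparse T Q q) (hv : v ∈ verts (core T Q L)) (hvQ : v ∉ Q)
    (ht : tri v l y ∈ T) : tri v l y ∈ core T Q L := by
  have key : ∃ x ∈ Q, ∃ z ∈ Q, ∃ w₁ l₁ l₂ w₂ a b, Red (w₁ ++ l₁ :: l₂ :: w₂) ∧
      (w₁ ++ l₁ :: l₂ :: w₂).length ≤ L ∧ Reads T x w₁ a ∧ tri a l₁ v ∈ T ∧ tri v l₂ b ∈ T ∧
      Reads T b w₂ z := by
    obtain ⟨e, he, hev⟩ := mem_verts.1 hv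
    obtain ⟨heT, x, hx, z, hz, w₁, l, w₂, a, b, h1, h2, h3, h4, h5⟩ := Finset.mem_filter.1 he
    have hev : v = a ∨ v = b := by
      rw [h4] at hev
      unfold tri at hev
      split_ifs at hev
      · exact hev.imp Eq.symm Eq.symm
      · exact hev.symm.imp Eq.symm Eq.symm
    rw [h4] at heT
    rcases hev with rfl | rfl
    · rcases List.eq_nil_or_concat w₁ with rfl | ⟨w₁', l₁, rfl⟩
      · exact absurd ((show x = v from h3) ▸ hx) hvQ
      · obtain ⟨a', h6, h7⟩ := reads_append.1 (by simpa using h3)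
        refine ⟨x, hx, z, hz, w₁', l₁, l, w₂, a', b, ?_, ?_, h6, reads_singleton.1 h7, heT, h5⟩
        · simpa using h1
        · simpa using h2
    · cases w₂ with
      | nil => exact absurd ((show v = z from h5) ▸ hz) hvQ
      | cons l₂ w₂ =>
        obtain ⟨b', h6, h7⟩ := h5
        exact ⟨x, hx, z, hz, w₁, l, l₂, w₂, a, b', h1, h2, h3, heT, h6, h7⟩
  obtain ⟨x, hx, z, hz, w₁, l₁, l₂, w₂, a, b, h1, h2, h3, h4, h5, h6⟩ := key
  by_cases hl : l = linv l₁ ∧ y = a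
  · obtain ⟨rfl, rfl⟩ := hl
    rw [tri_linv]
    exact Finset.mem_filter.2 ⟨h4, x, hx, z, hz, w₁, l₁, l₂ :: w₂, y, v, h1, h2, h3, rfl, b, h5, h6⟩
  · have hl₂ : l₂ ≠ linv l₁ := (red_cons_cons.1 (h1.infix (w' := [l₁, l₂]) ⟨w₁, w₂, by simp⟩)).1
    have hcard := hs.outs_le_two v hvQ
    have h7 : (l, y) = (l₂, b) := by
      by_contra hne
      have hsub : ({(linv l₁, a), (l₂, b), (l, y)} : Finset (Letter n × V)) ⊆ outs T v := by
        intro o ho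
        simp only [Finset.mem_insert, Finset.mem_singleton] at ho
        rw [mem_outs]
        rcases ho with rfl | rfl | rfl
        · rwa [tri_linv]
        · exact h5
        · exact ht
      have h3 : ({(linv l₁, a), (l₂, b), (l, y)} : Finset (Letter n × V)).card = 3 :=
        Finset.card_eq_three.2 ⟨_, _, _, fun h => hl₂ (Prod.ext_iff.1 h).1.symm,
          fun h => hl ⟨(Prod.ext_iff.1 h).1.symm, (Prod.ext_iff.1 h).2.symm⟩, Ne.symm hne, rfl⟩
      have := Finset.card_le_card hsub
      omega
    obtain ⟨rfl, rfl⟩ := Prod.ext_iff.1 h7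
    refine Finset.mem_filter.2 ⟨h5, x, hx, z, hz, w₁ ++ [l₁], _, w₂, v, _, ?_, ?_,
      reads_append.2 ⟨a, h3, reads_singleton.2 h4⟩, rfl, h6⟩
    · simpa using h1
    · simpa using h2

theorem ball_subset_succ : ball T Q k ⊆ ball T Q (k + 1) := Finset.subset_union_left

theorem ball_mono {k k' : ℕ} (h : k ≤ k') : ball T Q k ⊆ ball T Q k' :=
  monotone_nat_of_le_succ (f := ball T Q) (fun _ => ball_subset_succ) h

theorem card_ball_le (hs : Sparse T Q q) (k : ℕ) : (ball T Q k).card ≤ q * (q + 1) ^ k := by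
  induction k with
  | zero => simpa [ball] using hs.card_le
  | succ k ih =>
    refine (Finset.card_union_le _ _).trans ?_
    have := Finset.card_biUnion_le_card_mul (ball T Q k) (fun v => (outs T v).image Prod.snd) q
      fun v _ => Finset.card_image_le.trans (hs.outs_le v)
    calc _ ≤ (ball T Q k).card + (ball T Q k).card * q := Nat.add_le_add_left this _
      _ = (ball T Q k).card * (q + 1) := by ring
      _ ≤ q * (q + 1) ^ k * (q + 1) := Nat.mul_le_mul_right _ ih
      _ = _ := by ring

theorem mem_ball_succ (hx : x ∈ ball T Q k) (ht : tri x l y ∈ T) : y ∈ ball T Q (k + 1) :=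
  Finset.mem_union_right _ (Finset.mem_biUnion.2
    ⟨x, hx, Finset.mem_image.2 ⟨(l, y), mem_outs.2 ht, rfl⟩⟩)

theorem Reads.mem_ball (hr : Reads T x w y) (hx : x ∈ ball T Q k) : y ∈ ball T Q (k + w.length) := by
  induction w generalizing x k with
  | nil => exact (show x = y from hr) ▸ hx
  | cons l w ih =>
    obtain ⟨z, h1, h2⟩ := hr
    have := ih h2 (mem_ball_succ hx h1)
    rwa [List.length_cons, ← Nat.add_assoc, Nat.add_right_comm]

/-- With `card_ball_le` this bounds the core in terms of `q` and `L`, whatever the size of `T`. -/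
theorem verts_core_subset : verts (core T Q L) ⊆ ball T Q L := by
  intro v hv
  obtain ⟨e, he, hev⟩ := mem_verts.1 hv
  obtain ⟨heT, x, hx, z, hz, w₁, l, w₂, a, b, h1, h2, h3, h4, h5⟩ := Finset.mem_filter.1 he
  rw [h4] at heT
  have ha : a ∈ ball T Q w₁.length := by simpa using h3.mem_ball (k := 0) hx
  have hb := mem_ball_succ ha heT
  simp only [List.length_append, List.length_cons] at h2
  have hev : v = a ∨ v = b := by
    rw [h4] at hev
    unfold tri at hev
    split_ifs at hev
    · exact hev.imp Eq.symm Eq.symm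
    · exact hev.symm.imp Eq.symm Eq.symm
  rcases hev with rfl | rfl
  · exact ball_mono (by omega) ha
  · exact ball_mono (by omega) hb

/-- A path stays in a subgraph for `ℓ` steps, or leaves it before. -/
theorem Reads.stay_or_exit (hX : verts H ⊆ X) (hr : Reads T x w y) (hx : x ∈ X)
    (hℓ : ℓ ≤ w.length) :
    (∃ z, Reads H x (w.take ℓ) z ∧ Reads T z (w.drop ℓ) y) ∨
    ∃ u l v p b, w = u ++ l :: v ∧ u.length < ℓ ∧ p ∈ X ∧ tri p l b ∈ T ∧ tri p l b ∉ H ∧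
      Reads T b v y := by
  induction ℓ generalizing x w with
  | zero => exact .inl ⟨x, rfl, hr⟩
  | succ ℓ ih =>
    cases w with
    | nil => simp at hℓ
    | cons l w =>
      obtain ⟨z, h1, h2⟩ := hr
      by_cases h3 : tri x l z ∈ H
      · rcases ih h2 (hX (right_mem_verts h3)) (by simpa using hℓ) with
          ⟨z', h4, h5⟩ | ⟨u, l', v, p, b, rfl, h4, h5⟩
        · exact .inl ⟨z', ⟨z, h3, h4⟩, h5⟩
        · exact .inr ⟨l :: u, l', v, p, b, rfl, by simpa using h4, h5⟩
      · exact .inr ⟨[], l, w, x, z, rfl, by simp, hx, h1, h3, h2⟩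

/-- The renewal decomposition. If the first `ℓ` letters are read in the core, the path restarts from
a core vertex. Otherwise it leaves the core after `j < ℓ` letters, necessarily from `Q` and through
an edge with no return within `L`; the `j` letters are counted trivially. -/
theorem wcount_readFrom_le (hs : Sparse T Q q) (hℓ : 1 ≤ ℓ) {m : ℕ} (hm : ℓ ≤ m) :
    wcount (readFrom T (verts (core T Q L) ∪ Q)) m ≤
      wcount {w | Red w ∧ Readable (core T Q L) w} ℓ *
        wcount (readFrom T (verts (core T Q L) ∪ Q)) (m - ℓ) +
      ∑ j ∈ Finset.range ℓ, ∑ p ∈ Q, ∑ o ∈ (outs T p).filter (fun o => ¬ Ret T Q L o.1 o.2),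
        (2 * n) ^ j * wcount (cont T o.2 o.1) (m - j - 1) := by
  set X := verts (core T Q L) ∪ Q with hX
  refine (wcount_le_add (A := {w | ∃ u v, w = u ++ v ∧ u.length = ℓ ∧ (Red u ∧
    Readable (core T Q L) u) ∧ v ∈ readFrom T X}) (B := {w | ∃ j ∈ Finset.range ℓ, ∃ p ∈ Q,
    ∃ o ∈ (outs T p).filter (fun o => ¬ Ret T Q L o.1 o.2), ∃ u v, w = u ++ o.1 :: v ∧
    u.length = j ∧ v ∈ cont T o.2 o.1}) fun w hw hlen => ?_).trans (Nat.add_le_add ?_ ?_)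
  · obtain ⟨hw, x, hx, y, hr⟩ := hw
    rcases hr.stay_or_exit (H := core T Q L) Finset.subset_union_left hx (hm.trans_eq hlen.symm)
      with ⟨z, h1, h2⟩ | ⟨u, l, v, p, b, rfl, h1, h2, h3, h4, h5⟩
    · refine .inl ⟨w.take ℓ, w.drop ℓ, (List.take_append_drop _ _).symm, by simp; omega,
        ⟨hw.infix (List.take_prefix _ _).isInfix, x, z, h1⟩,
        hw.infix (List.drop_suffix _ _).isInfix, z, Finset.mem_union_left _ (h1.end_mem ?_), y, h2⟩
      intro h
      have := congrArg List.length h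
      simp only [List.length_take, List.length_nil] at this
      omega
    · have hp : p ∈ Q := by
        by_contra hp
        rcases Finset.mem_union.1 h2 with h | h
        · exact h4 (tri_mem_core_of_mem_verts hs h hp h3)
        · exact hp h
      refine .inr ⟨u.length, Finset.mem_range.2 h1, p, hp, (l, b),
        Finset.mem_filter.2 ⟨mem_outs.2 h3, fun h => h4 (tri_mem_core hp h3 h)⟩, u, v, rfl, rfl,
        hw.infix ⟨u, [], by simp⟩, y, h5⟩
  · obtain ⟨k, rfl⟩ := Nat.exists_eq_add_of_le hm
    rw [Nat.add_sub_cancel_left]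
    refine wcount_le_mul (B := fun _ => readFrom T X) (fun w hw _ => ?_) (fun _ _ _ => le_rfl)
    obtain ⟨u, v, rfl, h1, h2, h3⟩ := hw
    exact ⟨u, h2, v, h3, h1, rfl⟩
  · refine (wcount_le_sum _ _ fun w hw _ => hw).trans (Finset.sum_le_sum fun j hj => ?_)
    refine (wcount_le_sum _ _ fun w hw _ => hw).trans (Finset.sum_le_sum fun p _ => ?_)
    refine (wcount_le_sum _ _ fun w hw _ => hw).trans (Finset.sum_le_sum fun o _ => ?_)
    obtain ⟨k, rfl⟩ : ∃ k, m = j + (k + 1) :=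
      ⟨m - j - 1, by have := Finset.mem_range.1 hj; omega⟩
    rw [show j + (k + 1) - j - 1 = k by omega]
    refine (wcount_le_mul (A := Set.univ) (B := fun _ => {w | ∃ v ∈ cont T o.2 o.1, w = o.1 :: v})
      (fun w hw _ => ?_) (fun _ _ _ => wcount_cons_le fun w hw _ => hw)).trans
      (Nat.mul_le_mul_right _ (wcount_univ_le j))
    obtain ⟨u, v, rfl, h1, h2⟩ := hw
    exact ⟨u, trivial, _, ⟨v, h2, rfl⟩, h1, rfl⟩

end renewal


section renewal

variable {T : Finset (V × Fin n × V)} {Q : Finset V} {q L L' k ℓ : ℕ} {x y v : V}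
  {l : Letter n} {w : List (Letter n)} {K μ : ℝ}

/-- By the gap such an exit has no return within `L'` either. The steps forced after it save a
factor `μ ^ L'`, at least `2 ^ L'`, and `L'` is so large that this outweighs the number of exits. -/
theorem sum_exit_le (hs : Sparse T Q q) {m : ℕ} (hm : ℓ + L' ≤ m) (hn : 2 ≤ n)
    (hgap : ∀ p ∈ Q, ∀ o ∈ outs T p, Ret T Q L' o.1 o.2 → Ret T Q L o.1 o.2)
    (hμ : 2 ≤ μ) (hL' : 4 * (ℓ * (q * (q * (2 * n) ^ ℓ))) ≤ 2 ^ L') (hK : 1 ≤ K)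
    (hQ : ∀ j < m, (wcount (readFrom T Q) j : ℝ) ≤ K * μ ^ j) :
    ((∑ j ∈ Finset.range ℓ, ∑ p ∈ Q, ∑ o ∈ (outs T p).filter (fun o => ¬ Ret T Q L o.1 o.2),
        (2 * n) ^ j * wcount (cont T o.2 o.1) (m - j - 1) : ℕ) : ℝ) ≤ K * μ ^ m / 4 := by
  have hterm : ∀ j ∈ Finset.range ℓ, ∀ p ∈ Q,
      ∀ o ∈ (outs T p).filter (fun o => ¬ Ret T Q L o.1 o.2),
      ((2 * n) ^ j * wcount (cont T o.2 o.1) (m - j - 1) : ℕ) ≤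
        (2 * n : ℝ) ^ ℓ * (K * μ ^ m / 2 ^ L') := by
    intro j hj p hp o ho
    obtain ⟨ho1, ho2⟩ := Finset.mem_filter.1 ho
    have hj' := Finset.mem_range.1 hj
    have h1 := pow_mul_wcount_cont_le (k := m - j - 1) (r := L') hs hK (by linarith)
      (fun i hi => hQ i (by omega)) (by omega) (mem_outs.1 ho1) (fun h => ho2 (hgap p hp o ho1 h))
    have h2 : (2 : ℝ) ^ L' * wcount (cont T o.2 o.1) (m - j - 1) ≤ K * μ ^ m := by
      calc (2 : ℝ) ^ L' * wcount (cont T o.2 o.1) (m - j - 1)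
          ≤ μ ^ L' * wcount (cont T o.2 o.1) (m - j - 1) := by gcongr
        _ ≤ K * μ ^ (m - j - 1) := h1
        _ ≤ K * μ ^ m := by
          refine mul_le_mul_of_nonneg_left ?_ (by linarith)
          exact pow_le_pow_right₀ (by linarith) (by omega)
    push_cast
    refine mul_le_mul ?_ ?_ (by positivity) (by positivity)
    · refine pow_le_pow_right₀ ?_ hj'.le
      have : (2 : ℝ) ≤ n := by exact_mod_cast hn
      linarith
    · rw [le_div_iff₀ (by positivity)]
      linarith
  have hc : (0 : ℝ) ≤ (2 * n : ℝ) ^ ℓ * (K * μ ^ m / 2 ^ L') := by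
    have : 0 ≤ μ := by linarith
    positivity
  set c := (2 * n : ℝ) ^ ℓ * (K * μ ^ m / 2 ^ L') with hcdef
  push_cast at hterm ⊢
  have hsum : (∑ j ∈ Finset.range ℓ, ∑ p ∈ Q,
      ∑ o ∈ (outs T p).filter (fun o => ¬ Ret T Q L o.1 o.2),
        (2 * (n : ℝ)) ^ j * wcount (cont T o.2 o.1) (m - j - 1) : ℝ) ≤ ℓ * (q * (q * c)) := by
    calc _ ≤ ∑ j ∈ Finset.range ℓ, (q * (q * c) : ℝ) := by
          refine Finset.sum_le_sum fun j hj => ?_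
          calc _ ≤ ∑ p ∈ Q, (q * c : ℝ) := by
                refine Finset.sum_le_sum fun p hp => ?_
                refine (Finset.sum_le_card_nsmul _ _ c (hterm j hj p hp)).trans ?_
                rw [nsmul_eq_mul]
                refine mul_le_mul_of_nonneg_right ?_ hc
                exact_mod_cast (Finset.card_filter_le _ _).trans (hs.outs_le p)
            _ ≤ _ := by
                rw [Finset.sum_const, nsmul_eq_mul]
                refine mul_le_mul_of_nonneg_right ?_ (by positivity)
                exact_mod_cast hs.card_le
      _ = _ := by simp
  refine hsum.trans ?_
  have h4 : (4 * (ℓ * (q * (q * (2 * n) ^ ℓ))) : ℝ) ≤ 2 ^ L' := by exact_mod_cast hL'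
  have h5 : (0 : ℝ) ≤ K * μ ^ m := by
    have : 0 ≤ μ := by linarith
    positivity
  calc (ℓ * (q * (q * c)) : ℝ)
      = (4 * (ℓ * (q * (q * (2 * n) ^ ℓ)))) * (K * μ ^ m) / 2 ^ L' / 4 := by
        rw [hcdef]; ring
    _ ≤ 2 ^ L' * (K * μ ^ m) / 2 ^ L' / 4 := by gcongr
    _ = K * μ ^ m / 4 := by field_simp

/-- The renewal inequality at a scale such that no returns have length between `L` and `L'`. -/
theorem wcount_readFrom_le_of_gap (hs : Sparse T Q q) (hn : 2 ≤ n) (hℓ1 : 1 ≤ ℓ)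
    (hgap : ∀ p ∈ Q, ∀ o ∈ outs T p, Ret T Q L' o.1 o.2 → Ret T Q L o.1 o.2)
    (hcore : 2 * wcount {w | Red w ∧ Readable (core T Q L) w} ℓ ≤ (2 * n - 1) ^ ℓ)
    (hμ : 2 ≤ μ) (hμℓ : 2 * ((2 * n - 1 : ℕ) : ℝ) ^ ℓ ≤ 3 * μ ^ ℓ)
    (hL' : 4 * (ℓ * (q * (q * (2 * n) ^ ℓ))) ≤ 2 ^ L') (m : ℕ) :
    (wcount (readFrom T (verts (core T Q L) ∪ Q)) m : ℝ) ≤ (2 * n : ℝ) ^ (ℓ + L') * μ ^ m := by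
  have hn' : (2 : ℝ) ≤ n := by exact_mod_cast hn
  have hK : (1 : ℝ) ≤ (2 * n : ℝ) ^ (ℓ + L') := one_le_pow₀ (by linarith)
  induction m using Nat.strong_induction_on with
  | _ m ih =>
    -- Short words are counted trivially; this determines the constant `(2 * n) ^ (ℓ + L')`.
    rcases lt_or_ge m (ℓ + L') with hm | hm
    · have h1 : (wcount (readFrom T (verts (core T Q L) ∪ Q)) m : ℝ) ≤ (2 * n : ℝ) ^ m := by
        exact_mod_cast (wcount_mono fun _ _ _ => trivial).trans (wcount_univ_le m)
      calc _ ≤ (2 * n : ℝ) ^ m := h1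
        _ ≤ (2 * n : ℝ) ^ (ℓ + L') := pow_le_pow_right₀ (by linarith) hm.le
        _ ≤ _ := le_mul_of_one_le_right (by positivity) (one_le_pow₀ (by linarith))
    · have h1 : (wcount (readFrom T (verts (core T Q L) ∪ Q)) m : ℝ) ≤ _ :=
        Nat.cast_le.2 (wcount_readFrom_le (L := L) hs hℓ1 (show ℓ ≤ m by omega))
      have h2 := sum_exit_le (L := L) hs hm hn hgap hμ hL' hK fun j hj => by
        refine le_trans (Nat.cast_le.2 (wcount_mono fun w hw _ => ?_)) (ih j hj)
        obtain ⟨h3, x, hx, h4⟩ := hw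
        exact ⟨h3, x, Finset.mem_union_right _ hx, h4⟩
      rw [Nat.cast_add, Nat.cast_mul] at h1
      have h3 := ih (m - ℓ) (by omega)
      have h4 : 2 * (wcount {w | Red w ∧ Readable (core T Q L) w} ℓ : ℝ) ≤
          ((2 * n - 1 : ℕ) : ℝ) ^ ℓ := by exact_mod_cast hcore
      -- The core accounts for three quarters of the bound, and the exits for the remaining quarter.
      have h5 : (wcount {w | Red w ∧ Readable (core T Q L) w} ℓ : ℝ) ≤ 3 / 4 * μ ^ ℓ := by linarith
      have h6 := mul_le_mul h5 h3 (Nat.cast_nonneg _) (by positivity)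
      have h7 : μ ^ m = μ ^ ℓ * μ ^ (m - ℓ) := by rw [← pow_add]; congr 1; omega
      have h8 : 3 / 4 * μ ^ ℓ * ((2 * n : ℝ) ^ (ℓ + L') * μ ^ (m - ℓ)) =
          3 / 4 * ((2 * n : ℝ) ^ (ℓ + L') * μ ^ m) := by rw [h7]; ring
      linarith

/-- By Bernoulli's inequality `(1 - 1 / (3 * ℓ)) ^ ℓ ≥ 2 / 3`. -/
theorem exists_rate {ℓ : ℕ} (hℓ : 1 ≤ ℓ) {lam : ℝ} (hlam : 3 ≤ lam) :
    ∃ μ : ℝ, 2 ≤ μ ∧ μ < lam ∧ 2 * lam ^ ℓ ≤ 3 * μ ^ ℓ := by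
  have hℓ' : (1 : ℝ) ≤ ℓ := by exact_mod_cast hℓ
  have h0 : 1 / (3 * (ℓ : ℝ)) ≤ 1 / 3 := by
    apply one_div_le_one_div_of_le <;> linarith
  have h0' : 0 < 1 / (3 * (ℓ : ℝ)) := by positivity
  refine ⟨lam * (1 - 1 / (3 * ℓ)), by nlinarith, by nlinarith, ?_⟩
  have h1 := one_add_mul_le_pow (a := -(1 / (3 * (ℓ : ℝ)))) (by linarith) ℓ
  have h2 : 1 + (ℓ : ℝ) * -(1 / (3 * (ℓ : ℝ))) = 2 / 3 := by field_simp; norm_num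
  rw [h2, ← sub_eq_add_neg] at h1
  rw [mul_pow]
  have h3 : 0 ≤ lam ^ ℓ := by positivity
  nlinarith

/-- The constants at one scale. -/
theorem exists_scale (V : Type*) [Nonempty V] (hn : 2 ≤ n) (q L : ℕ) :
    ∃ (L' : ℕ) (K μ : ℝ), 1 ≤ K ∧ 2 ≤ μ ∧ μ < (2 * n - 1 : ℕ) ∧
      ∀ (T : Finset (V × Fin n × V)) (Q : Finset V), Sparse T Q q →
        (∃ u : List (Letter n), Red u ∧ ¬ Readable T u) →
        (∀ p ∈ Q, ∀ o ∈ outs T p, Ret T Q L' o.1 o.2 → Ret T Q L o.1 o.2) →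
        ∀ m, (wcount (readFrom T Q) m : ℝ) ≤ K * μ ^ m := by
  -- Order of the constants: `L` bounds the size of the core, this yields the block length `ℓ`, and
  -- `μ` and `L'` are chosen after `ℓ`.
  obtain ⟨ℓ, hℓ1, hℓ⟩ := exists_uniform_readable_bound (n := n) V hn (q * (q + 1) ^ L)
  obtain ⟨μ, hμ2, hμ, hμℓ⟩ := exists_rate hℓ1 (lam := (2 * n - 1 : ℕ))
    (by exact_mod_cast (by omega : 3 ≤ 2 * n - 1))
  obtain ⟨L', hL'⟩ : ∃ L', 4 * (ℓ * (q * (q * (2 * n) ^ ℓ))) ≤ 2 ^ L' :=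
    ⟨_, Nat.lt_two_pow_self.le⟩
  have hn' : (2 : ℝ) ≤ n := by exact_mod_cast hn
  refine ⟨L', (2 * n : ℝ) ^ (ℓ + L'), μ, one_le_pow₀ (by linarith), hμ2, hμ,
    fun T Q hs ⟨u, hu, hur⟩ hgap m => ?_⟩
  refine le_trans (Nat.cast_le.2 (wcount_mono fun w hw _ => ?_)) (wcount_readFrom_le_of_gap hs hn hℓ1
    hgap (hℓ _ ((Finset.card_le_card verts_core_subset).trans (card_ball_le hs L))
      ⟨u, hu, fun h => hur (h.mono core_subset)⟩) hμ2 hμℓ hL' m)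
  obtain ⟨h3, x, hx, h4⟩ := hw
  exact ⟨h3, x, Finset.mem_union_right _ hx, h4⟩

theorem Ret.mono {k k' : ℕ} (hk : k ≤ k') (h : Ret T Q k l y) : Ret T Q k' l y := by
  obtain ⟨w, z, h1, h2, h3⟩ := h
  exact ⟨w, z, h1, h2.trans hk, h3⟩

/-- The set of oriented edges at `Q` with a return within `L i` grows with `i` and has at most `q *
q` elements, so it cannot grow strictly at `q * q + 1` successive scales. -/
theorem exists_gap (hs : Sparse T Q q) (L : ℕ → ℕ) (hL : Monotone L) :
    ∃ i ≤ q * q, ∀ p ∈ Q, ∀ o ∈ outs T p, Ret T Q (L (i + 1)) o.1 o.2 →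
      Ret T Q (L i) o.1 o.2 := by
  by_contra! hcon
  let A : ℕ → Finset (V × (Letter n × V)) := fun i =>
    Q.biUnion fun p => ((outs T p).filter fun o => Ret T Q (L i) o.1 o.2).image fun o => (p, o)
  have hA : ∀ i p o, (p, o) ∈ A i ↔ p ∈ Q ∧ o ∈ outs T p ∧ Ret T Q (L i) o.1 o.2 := by
    intro i p o
    simp only [A, Finset.mem_biUnion, Finset.mem_image, Finset.mem_filter, Prod.mk.injEq]
    constructor
    · rintro ⟨p', hp', o', ⟨h1, h2⟩, rfl, rfl⟩
      exact ⟨hp', h1, h2⟩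
    · rintro ⟨h1, h2, h3⟩
      exact ⟨p, h1, o, ⟨h2, h3⟩, rfl, rfl⟩
  have hcard : ∀ i, (A i).card ≤ q * q := fun i =>
    (Finset.card_biUnion_le_card_mul _ _ q fun p _ => Finset.card_image_le.trans
      ((Finset.card_filter_le _ _).trans (hs.outs_le p))).trans (Nat.mul_le_mul_right _ hs.card_le)
  have hlt : ∀ i ≤ q * q, (A i).card < (A (i + 1)).card := by
    intro i hi
    obtain ⟨p, hp, o, ho, h1, h2⟩ := hcon i hi
    refine Finset.card_lt_card ⟨?_, fun hsub => h2 ?_⟩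
    · rintro ⟨p, o⟩ h
      obtain ⟨h3, h4, h5⟩ := (hA _ _ _).1 h
      exact (hA _ _ _).2 ⟨h3, h4, h5.mono (hL (Nat.le_succ i))⟩
    · exact ((hA _ _ _).1 (hsub ((hA _ _ _).2 ⟨hp, ho, h1⟩))).2.2
  have hle : ∀ i ≤ q * q + 1, i ≤ (A i).card := by
    intro i
    induction i with
    | zero => omega
    | succ i ih =>
      intro hi
      have := ih (by omega)
      have := hlt i (by omega)
      omega
  have := hle (q * q + 1) le_rfl
  have := hcard (q * q + 1)
  omega

/-- Iterating `exists_scale` gives a sequence of scales that does not depend on the graph. The scale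
with a gap does depend on it, but it is among the first `q * q + 1`, so the largest constants serve
for all graphs. -/
theorem exists_readFrom_bound (V : Type*) [Nonempty V] (hn : 2 ≤ n) (q : ℕ) :
    ∃ K μ : ℝ, 1 ≤ K ∧ 2 ≤ μ ∧ μ < (2 * n - 1 : ℕ) ∧
      ∀ (T : Finset (V × Fin n × V)) (Q : Finset V), Sparse T Q q →
        (∃ u : List (Letter n), Red u ∧ ¬ Readable T u) →
        ∀ m, (wcount (readFrom T Q) m : ℝ) ≤ K * μ ^ m := by
  choose next K μ hK hμ2 hμ hb using exists_scale (n := n) V hn q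
  let L : ℕ → ℕ := fun i => Nat.rec 0 (fun _ L => max L (next L)) i
  have hLs : ∀ i, L (i + 1) = max (L i) (next (L i)) := fun _ => rfl
  have hL : Monotone L := monotone_nat_of_le_succ fun i => by rw [hLs]; exact le_max_left _ _
  have hne : (Finset.range (q * q + 1)).Nonempty := ⟨0, by simp⟩
  refine ⟨(Finset.range (q * q + 1)).sup' hne fun i => K (L i),
    (Finset.range (q * q + 1)).sup' hne fun i => μ (L i), ?_, ?_, ?_, fun T Q hs hu m => ?_⟩
  · exact (hK (L 0)).trans (Finset.le_sup' (fun i => K (L i)) (b := 0) (by simp))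
  · exact (hμ2 (L 0)).trans (Finset.le_sup' (fun i => μ (L i)) (b := 0) (by simp))
  · exact (Finset.sup'_lt_iff _).2 fun i _ => hμ _
  · obtain ⟨i, hi, hgap⟩ := exists_gap hs L hL
    have hi' : i ∈ Finset.range (q * q + 1) := Finset.mem_range.2 (by omega)
    refine (hb (L i) T Q hs hu (fun p hp o ho h => hgap p hp o ho
      (h.mono (by rw [hLs]; exact le_max_right _ _))) m).trans ?_
    have h0 := hμ2 (L i)
    have h1 := hK (L i)
    refine mul_le_mul (Finset.le_sup' (fun i => K (L i)) hi') ?_ (by positivity) ?_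
    · exact pow_le_pow_left₀ (by linarith) (Finset.le_sup' (fun i => μ (L i)) hi') m
    · linarith [Finset.le_sup' (fun i => K (L i)) hi']

/-- Few reduced words can be read in a sparse graph in which not all of them can be read. -/
theorem exists_sparse_bound (V : Type*) [Nonempty V] (hn : 2 ≤ n) (q : ℕ) :
    ∃ K μ : ℝ, 1 ≤ K ∧ 2 ≤ μ ∧ μ < (2 * n - 1 : ℕ) ∧
      ∀ (T : Finset (V × Fin n × V)) (Q : Finset V), Sparse T Q q →
        (∃ u : List (Letter n), Red u ∧ ¬ Readable T u) →
        ∀ m, (wcount {w | Red w ∧ Readable T w} m : ℝ) ≤ ((verts T).card + 1) * K * μ ^ m := by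
  obtain ⟨K, μ, hK, hμ2, hμ, hb⟩ := exists_readFrom_bound (n := n) V hn q
  refine ⟨(q + 1) * K, μ, ?_, hμ2, hμ, fun T Q hs hu m => ?_⟩
  · nlinarith [(Nat.cast_nonneg q : (0 : ℝ) ≤ q)]
  cases m with
  | zero =>
    have h1 : (wcount {w | Red w ∧ Readable T w} 0 : ℝ) ≤ 1 := by exact_mod_cast wcount_zero_le
    have h2 : (0 : ℝ) ≤ (verts T).card := Nat.cast_nonneg _
    have h3 : (0 : ℝ) ≤ q := Nat.cast_nonneg _
    rw [pow_zero, mul_one]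
    refine h1.trans (one_le_mul_of_one_le_of_one_le (by linarith) ?_)
    exact one_le_mul_of_one_le_of_one_le (by linarith) hK
  | succ m =>
    -- The initial vertex need not lie in `Q`. After the first edge, `pow_mul_wcount_cont_le` with
    -- `r = 0` compares with words read from `Q`.
    have h1 : wcount {w | Red w ∧ Readable T w} (m + 1) ≤
        ∑ v ∈ verts T, ∑ o ∈ outs T v, wcount (cont T o.2 o.1) m := by
      refine (wcount_le_sum (verts T) (fun v => {w | ∃ o ∈ outs T v, ∃ u ∈ cont T o.2 o.1,
        w = o.1 :: u}) fun w hw hlen => ?_).trans (Finset.sum_le_sum fun v _ => ?_)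
      · obtain ⟨h1, x, y, hr⟩ := hw
        cases w with
        | nil => simp at hlen
        | cons l w =>
          have hx := hr.start_mem (List.cons_ne_nil _ _)
          obtain ⟨z, h2, h3⟩ := hr
          exact ⟨x, hx, (l, z), mem_outs.2 h2, w, ⟨h1, y, h3⟩, rfl⟩
      · refine (wcount_le_sum _ _ fun w hw _ => hw).trans (Finset.sum_le_sum fun o _ => ?_)
        exact wcount_cons_le fun w hw _ => hw
    have h2 : ∀ v ∈ verts T, ∀ o ∈ outs T v, (wcount (cont T o.2 o.1) m : ℝ) ≤ K * μ ^ m := by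
      intro v _ o ho
      have := pow_mul_wcount_cont_le (r := 0) hs hK (by linarith) (fun j _ => hb T Q hs hu j)
        (Nat.zero_le m) (mem_outs.1 ho) (by rintro ⟨w, z, -, h, -⟩; omega)
      simpa using this
    have hc : 0 ≤ K * μ ^ m := by positivity
    calc (wcount {w | Red w ∧ Readable T w} (m + 1) : ℝ)
        ≤ ∑ v ∈ verts T, ∑ o ∈ outs T v, (wcount (cont T o.2 o.1) m : ℝ) := by exact_mod_cast h1
      _ ≤ ∑ v ∈ verts T, ((q : ℝ) * (K * μ ^ m)) := by
        refine Finset.sum_le_sum fun v hv => ?_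
        refine (Finset.sum_le_card_nsmul _ _ _ (h2 v hv)).trans ?_
        rw [nsmul_eq_mul]
        exact mul_le_mul_of_nonneg_right (by exact_mod_cast hs.outs_le v) hc
      _ = (verts T).card * (q * (K * μ ^ m)) := by simp
      _ ≤ ((verts T).card + 1) * ((q + 1) * (K * μ ^ (m + 1))) := by
        have : K * μ ^ m ≤ K * μ ^ (m + 1) := by
          refine mul_le_mul_of_nonneg_left ?_ (by linarith)
          exact pow_le_pow_right₀ (by linarith) (Nat.le_succ m)
        gcongr <;> linarith
      _ = _ := by ring

end renewal


/-! ### Walks, closing steps and arcs -/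

/-- The edge crossed in step `j` of the walk `x` labelled `s`. -/
def edge (x : ℕ → V) (s : ℕ → Letter n) (j : ℕ) : V × Fin n × V := tri (x j) (s j) (x (j + 1))

/-- The edges crossed in the first `k` steps. -/
noncomputable def trace (x : ℕ → V) (s : ℕ → Letter n) (k : ℕ) : Finset (V × Fin n × V) :=
  (Finset.range k).image (edge x s)

/-- The steps before `N` that cross a new edge and end at an old vertex. The vertices of the walk
are supposed to be named by the times of their first visits. -/
noncomputable def closings (x : ℕ → ℕ) (s : ℕ → Letter n) (N : ℕ) : Finset ℕ :=
  (Finset.range N).filter fun j => edge x s j ∉ trace x s j ∧ x (j + 1) ≠ j + 1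

theorem exists_start (x : ℕ → ℕ) (c : ℕ) : ∃ a, ∀ j, a ≤ j → j < c → x (j + 1) = j + 1 :=
  ⟨c, fun _ h h' => absurd h' (by omega)⟩

/-- The beginning of the run of steps to new vertices before step `c`. -/
noncomputable def start (x : ℕ → ℕ) (c : ℕ) : ℕ := Nat.find (exists_start x c)

/-- A walk without backtracking whose vertices are named by the times of their first visits. -/
structure NamedWalk (x : ℕ → ℕ) (s : ℕ → Letter n) (N : ℕ) : Prop where
  le : ∀ j, x j ≤ j
  idem : ∀ j, x (x j) = x j
  red : ∀ j, j + 1 < N → s (j + 1) ≠ linv (s j)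

section trace

variable {x : ℕ → V} {s : ℕ → Letter n} {i j k c m : ℕ}

theorem mem_trace {e : V × Fin n × V} : e ∈ trace x s k ↔ ∃ j < k, edge x s j = e := by
  simp [trace]

theorem edge_mem_trace (h : j < k) : edge x s j ∈ trace x s k := mem_trace.2 ⟨j, h, rfl⟩

theorem trace_mono (h : j ≤ k) : trace x s j ⊆ trace x s k := fun _ he => by
  obtain ⟨i, hi, rfl⟩ := mem_trace.1 he
  exact edge_mem_trace (by omega)

theorem trace_succ [DecidableEq V] :
    trace x s (k + 1) = insert (edge x s k) (trace x s k) := by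
  ext e
  rw [mem_trace, Finset.mem_insert, mem_trace]
  constructor
  · rintro ⟨j, hj, rfl⟩
    rcases Nat.lt_succ_iff_lt_or_eq.1 hj with h | rfl
    · exact .inr ⟨j, h, rfl⟩
    · exact .inl rfl
  · rintro (rfl | ⟨j, hj, rfl⟩)
    · exact ⟨k, by omega, rfl⟩
    · exact ⟨j, by omega, rfl⟩

theorem verts_trace_subset [DecidableEq V] : verts (trace x s k) ⊆ (Finset.range (k + 1)).image x := by
  intro v hv
  obtain ⟨e, he, hev⟩ := mem_verts.1 hv
  obtain ⟨j, hj, rfl⟩ := mem_trace.1 he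
  have : v = x j ∨ v = x (j + 1) := by
    unfold edge tri at hev
    split_ifs at hev
    · exact hev.imp Eq.symm Eq.symm
    · exact hev.symm.imp Eq.symm Eq.symm
  rcases this with rfl | rfl
  · exact Finset.mem_image_of_mem _ (Finset.mem_range.2 (by omega))
  · exact Finset.mem_image_of_mem _ (Finset.mem_range.2 (by omega))

theorem trace_eq_of_old (h : ∀ i, c < i → i ≤ j → edge x s i ∈ trace x s i) (hj : c ≤ j) :
    trace x s (j + 1) = trace x s (c + 1) := by
  induction j with
  | zero =>
    obtain rfl : c = 0 := by omega
    rfl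
  | succ j ih =>
    rcases hj.eq_or_lt with rfl | hj'
    · rfl
    · rw [trace_succ, Finset.insert_eq_of_mem (h _ hj' le_rfl)]
      exact ih (fun i h1 h2 => h i h1 (by omega)) (by omega)

theorem reads_of_edges {T : Finset (V × Fin n × V)} (w : List (Letter n)) (i : ℕ)
    (hw : ∀ j, ∀ h : j < w.length, w[j] = s (i + j)) (h : ∀ j < w.length, edge x s (i + j) ∈ T) :
    Reads T (x i) w (x (i + w.length)) := by
  induction w generalizing i with
  | nil => rfl
  | cons l w ih =>
    have h0 := h 0 (by simp)
    have h1 := hw 0 (by simp)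
    simp only [List.getElem_cons_zero, Nat.add_zero] at h0 h1
    refine ⟨x (i + 1), by rw [h1]; exact h0, ?_⟩
    rw [show i + (l :: w).length = i + 1 + w.length by simp; omega]
    refine ih (i + 1) (fun j hj => ?_) fun j hj => ?_
    · have := hw (j + 1) (by simpa using hj)
      simpa [Nat.add_assoc, Nat.add_comm 1] using this
    · have := h (j + 1) (by simpa using hj)
      simpa [Nat.add_assoc, Nat.add_comm 1] using this

theorem card_new [DecidableEq V] (k : ℕ) :
    ((Finset.range k).filter fun j => edge x s j ∉ trace x s j).card = (trace x s k).card := by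
  induction k with
  | zero => simp [trace]
  | succ k ih =>
    rw [Finset.range_add_one, Finset.filter_insert, trace_succ]
    by_cases h : edge x s k ∈ trace x s k
    · rw [if_neg (not_not.2 h), Finset.insert_eq_of_mem h, ih]
    · rw [if_pos h, Finset.card_insert_of_notMem (by simp), Finset.card_insert_of_notMem h, ih]

theorem exists_new (h : i < k) : ∃ j < k, edge x s j ∉ trace x s j ∧ edge x s j = edge x s i := by
  induction i using Nat.strong_induction_on with
  | _ i ih =>
    by_cases h1 : edge x s i ∈ trace x s i
    · obtain ⟨j, hj, h2⟩ := mem_trace.1 h1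
      obtain ⟨j', h3, h4, h5⟩ := ih j hj (by omega)
      exact ⟨j', h3, h4, h5.trans h2⟩
    · exact ⟨i, h, h1, rfl⟩

end trace

section walk

variable {x : ℕ → ℕ} {s : ℕ → Letter n} {N i j k c m : ℕ}

theorem start_le : start x c ≤ c := Nat.find_min' _ fun _ h h' => absurd h' (by omega)

theorem fresh_of_start_le (h : start x c ≤ j) (h' : j < c) : x (j + 1) = j + 1 :=
  Nat.find_spec (exists_start x c) j h h'

theorem mem_closings : c ∈ closings x s N ↔
    c < N ∧ edge x s c ∉ trace x s c ∧ x (c + 1) ≠ c + 1 := by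
  simp [closings]

theorem NamedWalk.new_of_fresh (h : NamedWalk x s N) (hj : x (j + 1) = j + 1) :
    edge x s j ∉ trace x s j := by
  intro hmem
  have h1 := verts_trace_subset (right_mem_verts (l := s j) hmem)
  obtain ⟨i, hi, h2⟩ := Finset.mem_image.1 h1
  have h3 := h.le i
  have := Finset.mem_range.1 hi
  omega

/-- At a vertex just visited for the first time the only old edge is the one just crossed, and
backtracking is excluded. -/
theorem NamedWalk.new_succ (h : NamedWalk x s N) (hj : x (j + 1) = j + 1) (hN : j + 1 < N) :
    edge x s (j + 1) ∉ trace x s (j + 1) := by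
  rw [trace_succ, Finset.mem_insert]
  rintro (h1 | h1)
  · rcases tri_eq h1 with ⟨h2, -, -⟩ | ⟨-, -, h2⟩
    · have := h.le j
      omega
    · exact h.red j hN (eq_linv_comm.1 h2)
  · obtain ⟨i, hi, h2⟩ := Finset.mem_image.1 (verts_trace_subset (left_mem_verts h1))
    have h3 := h.le i
    have := Finset.mem_range.1 hi
    omega

theorem closings_succ : closings x s (k + 1) =
    if edge x s k ∉ trace x s k ∧ x (k + 1) ≠ k + 1 then insert k (closings x s k)
    else closings x s k := by
  rw [closings, Finset.range_add_one, Finset.filter_insert]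
  rfl

/-- Every step along a new edge either discovers a vertex or is a closing step; the initial vertex
accounts for the 1. -/
theorem NamedWalk.card_closings (h : NamedWalk x s N) (k : ℕ) :
    (closings x s k).card + ((Finset.range (k + 1)).image x).card = (trace x s k).card + 1 := by
  induction k with
  | zero => simp [closings, trace]
  | succ k ih =>
    rw [Finset.range_add_one (n := k + 1), Finset.image_insert, trace_succ, closings_succ]
    by_cases hf : x (k + 1) = k + 1
    · have hnew := h.new_of_fresh hf
      have hnot : x (k + 1) ∉ (Finset.range (k + 1)).image x := by
        intro h1
        obtain ⟨i, hi, h2⟩ := Finset.mem_image.1 h1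
        have := h.le i
        have := Finset.mem_range.1 hi
        omega
      rw [if_neg (fun h' => h'.2 hf), Finset.card_insert_of_notMem hnot,
        Finset.card_insert_of_notMem hnew]
      omega
    · have hmem : x (k + 1) ∈ (Finset.range (k + 1)).image x := by
        refine Finset.mem_image.2 ⟨x (k + 1), Finset.mem_range.2 ?_, h.idem _⟩
        have := h.le (k + 1)
        omega
      rw [Finset.insert_eq_of_mem hmem]
      by_cases hnew : edge x s k ∈ trace x s k
      · rw [if_neg (fun h' => h'.1 hnew), Finset.insert_eq_of_mem hnew]
        exact ih
      · rw [if_pos ⟨hnew, hf⟩, Finset.card_insert_of_notMem (by simp [closings]),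
          Finset.card_insert_of_notMem hnew]
        omega

theorem NamedWalk.card_closings_le (h : NamedWalk x s N) (k : ℕ) :
    ((closings x s k).card : ℤ) ≤ exc (trace x s k) + 1 := by
  have h1 := h.card_closings k
  have h2 := Finset.card_le_card (verts_trace_subset (x := x) (s := s) (k := k))
  unfold exc
  omega

/-- A new edge lies on a run of steps to new vertices that ends with a closing step. -/
theorem NamedWalk.exists_closing (h : NamedWalk x s N) (hi : edge x s i ∉ trace x s i)
    (hc : c ∈ closings x s N) (hic : i ≤ c) :
    ∃ c' ∈ closings x s N, c' ≤ c ∧ start x c' ≤ i ∧ i ≤ c' := by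
  have hex : ∃ c', i ≤ c' ∧ c' ∈ closings x s N := ⟨c, hic, hc⟩
  obtain ⟨h1, h2⟩ := Nat.find_spec hex
  have h3 := Nat.find_min' hex ⟨hic, hc⟩
  have hmin := fun j (hj : j < Nat.find hex) => Nat.find_min hex hj
  set c' := Nat.find hex
  have h4 := (mem_closings.1 h2).1
  -- Until the first closing step from `i` on, each step leads to a new vertex and is therefore
  -- followed by a new edge.
  have hnew : ∀ j, i ≤ j → j ≤ c' → edge x s j ∉ trace x s j := by
    intro j hij
    induction j, hij using Nat.le_induction with
    | base => exact fun _ => hi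
    | succ j hij ih =>
      intro hj
      refine h.new_succ ?_ (by omega)
      by_contra hf
      exact hmin j (by omega) ⟨hij, mem_closings.2 ⟨by omega, ih (by omega), hf⟩⟩
  refine ⟨c', h2, h3, Nat.find_min' _ fun j hj1 hj2 => ?_, h1⟩
  by_contra hf
  exact hmin j hj2 ⟨hj1, mem_closings.2 ⟨by omega, hnew j hj1 (by omega), hf⟩⟩

/-- If few edges are crossed then the walk stays for a long time among old edges. -/
theorem NamedWalk.exists_old_run (h : NamedWalk x s N)
    (hm : (trace x s N).card + (closings x s N).card * m < N) :
    ∃ c ∈ closings x s N, c + m < N ∧ ∀ j, c < j → j ≤ c + m → edge x s j ∈ trace x s j := by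
  by_contra! hcon
  have hsub : Finset.range N ⊆ ((Finset.range N).filter fun j => edge x s j ∉ trace x s j) ∪
      (closings x s N).biUnion fun c => Finset.Ico (c + 1) (c + 1 + m) := by
    intro j hj
    have hjN := Finset.mem_range.1 hj
    by_cases hnew : edge x s j ∈ trace x s j
    · refine Finset.mem_union_right _ ?_
      -- Let `c` be the last step before `j` along a new edge; step 0 is one. It is a closing step,
      -- since a step to a new vertex would be followed by another new edge. So old steps come in
      -- runs after closing steps, and short runs cannot fill up `N` steps.
      have hne : ((Finset.range j).filter fun i => edge x s i ∉ trace x s i).Nonempty := by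
        refine ⟨0, Finset.mem_filter.2 ⟨Finset.mem_range.2 ?_, by simp [trace]⟩⟩
        rcases Nat.eq_zero_or_pos j with rfl | hj
        · simp [trace] at hnew
        · exact hj
      obtain ⟨h1, h2⟩ := Finset.mem_filter.1 (Finset.max'_mem _ hne)
      have hmax := fun i hi => Finset.le_max' ((Finset.range j).filter
        fun i => edge x s i ∉ trace x s i) i hi
      set c := Finset.max' _ hne
      have h1 := Finset.mem_range.1 h1
      have hold : ∀ i, c < i → i ≤ j → edge x s i ∈ trace x s i := by
        intro i hi hij
        by_contra hi'
        rcases hij.eq_or_lt with rfl | hij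
        · exact hi' hnew
        · have := hmax i (Finset.mem_filter.2 ⟨Finset.mem_range.2 hij, hi'⟩)
          omega
      have hc : c ∈ closings x s N := mem_closings.2 ⟨by omega, h2, fun hf =>
        h.new_succ hf (by omega) (hold _ (by omega) (by omega))⟩
      refine Finset.mem_biUnion.2 ⟨c, hc, Finset.mem_Ico.2 ⟨h1, ?_⟩⟩
      by_contra hlt
      obtain ⟨i, h3, h4, h5⟩ := hcon c hc (by omega)
      exact h5 (hold i h3 (by omega))
    · exact Finset.mem_union_left _ (Finset.mem_filter.2 ⟨hj, hnew⟩)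
  have h1 := (Finset.card_le_card hsub).trans (Finset.card_union_le _ _)
  have h2 := Finset.card_biUnion_le_card_mul (closings x s N)
    (fun c => Finset.Ico (c + 1) (c + 1 + m)) m fun c _ => by simp
  rw [Finset.card_range, card_new] at h1
  omega

/-- The branch points of the walk up to step `c`. -/
noncomputable def branch (x : ℕ → ℕ) (s : ℕ → Letter n) (c : ℕ) : Finset ℕ :=
  (closings x s (c + 1)).biUnion fun c' => {x (start x c'), x (c' + 1)}

theorem closings_mono (h : j ≤ k) : closings x s j ⊆ closings x s k :=
  Finset.filter_subset_filter _ (Finset.range_mono h)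

/-- Each edge is attributed to its first crossing, a step on an arc. A vertex `v` inside an arc is
named by its time, so it is left in step `v` and entered in step `v - 1`; the other possibilities
are the ends of arcs. The truncated value at `v = 0` only enlarges the set. -/
theorem NamedWalk.outs_subset (h : NamedWalk x s N) (hc : c ∈ closings x s N) (v : ℕ) :
    outs (trace x s (c + 1)) v ⊆
      (insert v (((closings x s (c + 1)).image (start x)).filter fun i => x i = v)).image
        (fun i => (s i, x (i + 1))) ∪
      (insert (v - 1) ((closings x s (c + 1)).filter fun i => x (i + 1) = v)).image
        (fun i => (linv (s i), x i)) := by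
  rintro ⟨l, y⟩ ho
  obtain ⟨i, hi, h1⟩ := mem_trace.1 (mem_outs.1 ho)
  obtain ⟨j, hj, hnew, h2⟩ := exists_new (x := x) (s := s) hi
  obtain ⟨c', hc', h3, h4, h5⟩ := h.exists_closing hnew hc (by omega)
  have hc'' : c' ∈ closings x s (c + 1) := by
    obtain ⟨-, h6⟩ := mem_closings.1 hc'
    exact mem_closings.2 ⟨by omega, h6⟩
  rcases tri_eq (h2.trans h1) with ⟨h6, rfl, rfl⟩ | ⟨rfl, h6, rfl⟩
  · refine Finset.mem_union_left _ (Finset.mem_image.2 ⟨j, ?_, rfl⟩)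
    rw [Finset.mem_insert, Finset.mem_filter]
    by_cases hj : start x c' = j
    · exact .inr ⟨Finset.mem_image.2 ⟨c', hc'', hj⟩, h6⟩
    · refine .inl ?_
      have h7 := fresh_of_start_le (x := x) (c := c') (j := j - 1) (by omega) (by omega)
      rw [show j - 1 + 1 = j by omega] at h7
      omega
  · refine Finset.mem_union_right _ (Finset.mem_image.2 ⟨j, ?_, rfl⟩)
    rw [Finset.mem_insert, Finset.mem_filter]
    by_cases hj : j ∈ closings x s (c + 1)
    · exact .inr ⟨hj, h6⟩
    · refine .inl ?_
      have h7 : x (j + 1) = j + 1 := by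
        by_contra hf
        exact hj (mem_closings.2 ⟨by omega, hnew, hf⟩)
      omega

/-- At most `k` arcs have at most `2 * k` ends, and the degree is at most `2 * (k + 1) ≤ 4 * k`. -/
theorem NamedWalk.sparse (h : NamedWalk x s N) (hc : c ∈ closings x s N) (hq : 1 ≤ k)
    (hcard : (closings x s N).card ≤ k) : Sparse (trace x s (c + 1)) (branch x s c) (4 * k) := by
  have hcard' : (closings x s (c + 1)).card ≤ k := (Finset.card_le_card
    (closings_mono (by have := (mem_closings.1 hc).1; omega))).trans hcard
  refine ⟨?_, fun v => ?_, fun v hv => ?_⟩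
  · refine (Finset.card_biUnion_le_card_mul _ _ 2 fun _ _ => Finset.card_le_two).trans ?_
    omega
  · refine (Finset.card_le_card (h.outs_subset hc v)).trans ((Finset.card_union_le _ _).trans ?_)
    have h1 := (Finset.card_image_le (s := insert v (((closings x s (c + 1)).image
      (start x)).filter fun i => x i = v)) (f := fun i => (s i, x (i + 1)))).trans
      (Finset.card_insert_le _ _)
    have h2 := (Finset.card_image_le (s := insert (v - 1) ((closings x s (c + 1)).filter
      fun i => x (i + 1) = v)) (f := fun i => (linv (s i), x i))).trans (Finset.card_insert_le _ _)
    have h3 := Finset.card_filter_le ((closings x s (c + 1)).image (start x)) fun i => x i = v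
    have h4 := Finset.card_filter_le (closings x s (c + 1)) fun i => x (i + 1) = v
    have h5 := Finset.card_image_le (s := closings x s (c + 1)) (f := start x)
    omega
  · refine (Finset.card_le_card (h.outs_subset hc v)).trans ((Finset.card_union_le _ _).trans ?_)
    rw [Finset.filter_eq_empty_iff.2, Finset.filter_eq_empty_iff.2]
    · simp
    · intro i hi hiv
      exact hv (Finset.mem_biUnion.2 ⟨i, hi, by simp [hiv]⟩)
    · intro i hi hiv
      obtain ⟨c', hc', rfl⟩ := Finset.mem_image.1 hi
      exact hv (Finset.mem_biUnion.2 ⟨c', hc', by simp [hiv]⟩)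

end walk

/-- The edges on arcs labelled by subwords of `w`. The arc `(a, c, y, z)` has the label of the steps
`a, …, c` of `w`, it goes from `y` to `z`, and the vertices between are the times of these steps. -/
noncomputable def arcs {k : ℕ} (g : Fin k → ℕ × ℕ × ℕ × ℕ) (w : List (Letter n)) :
    Finset (ℕ × Fin n × ℕ) :=
  Finset.univ.biUnion fun i => (Finset.Icc (g i).1 (g i).2.1).biUnion fun j =>
    (w[j]?).toFinset.image fun l => tri (if j = (g i).1 then (g i).2.2.1 else j) l
      (if j = (g i).2.1 then (g i).2.2.2 else j + 1)

/-- The ends of the arcs. -/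
noncomputable def arcEnds {k : ℕ} (g : Fin k → ℕ × ℕ × ℕ × ℕ) : Finset ℕ :=
  Finset.univ.biUnion fun i => {(g i).2.2.1, (g i).2.2.2}

section walk

variable {x : ℕ → ℕ} {s : ℕ → Letter n} {N i j k c m : ℕ}

/-- The edges crossed until a closing step form few arcs. -/
theorem NamedWalk.exists_arcs (h : NamedWalk x s N) (hc : c ∈ closings x s N)
    (hcard : (closings x s N).card ≤ k) (w : List (Letter n))
    (hws : ∀ j ≤ c, w[j]? = some (s j)) :
    ∃ g : Fin k → ℕ × ℕ × ℕ × ℕ,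
      (∀ i, (g i).1 ≤ N ∧ (g i).2.1 ≤ N ∧ (g i).2.2.1 ≤ N ∧ (g i).2.2.2 ≤ N) ∧
      arcs g w = trace x s (c + 1) ∧ arcEnds g = branch x s c := by
  have hcN := (mem_closings.1 hc).1
  have hcard' : (closings x s (c + 1)).card ≤ k :=
    (Finset.card_le_card (closings_mono (by omega))).trans hcard
  have hcc : c ∈ closings x s (c + 1) := mem_closings.2 ⟨by omega, (mem_closings.1 hc).2⟩
  -- An enumeration of the closing steps by `Fin k`, with repetitions if there are fewer than `k`.
  obtain ⟨f, hf⟩ : ∃ f : Fin k → ℕ, ∀ c', c' ∈ closings x s (c + 1) ↔ ∃ i, f i = c' := by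
    obtain ⟨φ⟩ : Nonempty ((closings x s (c + 1) : Set ℕ) ↪ Fin k) := by
      refine Function.Embedding.nonempty_of_card_le ?_
      simpa using hcard'
    have : Nonempty (closings x s (c + 1) : Set ℕ) := ⟨⟨c, hcc⟩⟩
    refine ⟨fun i => (Function.invFun φ i).1, fun c' => ⟨fun hc' => ⟨φ ⟨c', hc'⟩, ?_⟩, ?_⟩⟩
    · dsimp only
      rw [Function.leftInverse_invFun φ.injective _]
    · rintro ⟨i, rfl⟩
      exact (Function.invFun φ i).2
  refine ⟨fun i => (start x (f i), f i, x (start x (f i)), x (f i + 1)), fun i => ?_, ?_, ?_⟩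
  · have h1 := (mem_closings.1 ((hf _).2 ⟨i, rfl⟩)).1
    have h2 := start_le (x := x) (c := f i)
    have h3 := h.le (start x (f i))
    have h4 := h.le (f i + 1)
    dsimp only
    omega
  -- Inside an arc the vertices are new, so their names are the times, and only the two ends have to
  -- be recorded.
  · have hval : ∀ c', ∀ j, start x c' ≤ j → j ≤ c' →
        (if j = start x c' then x (start x c') else j) = x j ∧
        (if j = c' then x (c' + 1) else j + 1) = x (j + 1) := by
      intro c' j h1 h2
      constructor
      · split_ifs with h3
        · rw [h3]
        · have h7 := fresh_of_start_le (x := x) (c := c') (j := j - 1) (by omega) (by omega)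
          rw [show j - 1 + 1 = j by omega] at h7
          exact h7.symm
      · split_ifs with h3
        · rw [h3]
        · exact (fresh_of_start_le h1 (by omega)).symm
    ext e
    simp only [arcs, Finset.mem_biUnion, Finset.mem_univ, true_and, Finset.mem_Icc,
      Finset.mem_image, Option.mem_toFinset, Option.mem_def]
    constructor
    · rintro ⟨i, j, ⟨h1, h2⟩, l, h3, rfl⟩
      have h4 := (mem_closings.1 ((hf _).2 ⟨i, rfl⟩)).1
      rw [hws j (by omega), Option.some_inj] at h3
      rw [(hval _ j h1 h2).1, (hval _ j h1 h2).2, ← h3]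
      exact edge_mem_trace (by omega)
    · intro he
      obtain ⟨i, hi, h1⟩ := mem_trace.1 he
      obtain ⟨j, hj, hnew, h2⟩ := exists_new (x := x) (s := s) hi
      obtain ⟨c', hc', h3, h4, h5⟩ := h.exists_closing hnew hc (by omega)
      obtain ⟨i', rfl⟩ := (hf c').1 (mem_closings.2 ⟨by omega, (mem_closings.1 hc').2⟩)
      refine ⟨i', j, ⟨h4, h5⟩, s j, hws j (by omega), ?_⟩
      rw [(hval _ j h4 h5).1, (hval _ j h4 h5).2]
      exact h2.trans h1
  · ext v
    simp only [arcEnds, branch, Finset.mem_biUnion, Finset.mem_univ, true_and, hf]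
    constructor
    · rintro ⟨i, hi⟩
      exact ⟨_, ⟨i, rfl⟩, hi⟩
    · rintro ⟨_, ⟨i, rfl⟩, hi⟩
      exact ⟨i, hi⟩

end walk


/-! ### The number of bad words -/

/-- The words of walks that cross few edges, of graphs with small excess in which some reduced word
is not readable. -/
def Bad (n : ℕ) (α : ℝ) : Set (List (Letter n)) :=
  {w | Red w ∧ ∃ (x : ℕ → ℕ) (s : ℕ → Letter n), NamedWalk x s w.length ∧
    (∀ j < w.length, w[j]? = some (s j)) ∧ ((trace x s w.length).card : ℝ) < α * w.length ∧
    exc (trace x s w.length) ≤ 2 * (n : ℤ) - 2 ∧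
    ∃ u, Red u ∧ ¬ Readable (trace x s w.length) u}

/-- The arcs form a sparse graph in which some reduced word is not readable. -/
structure GoodArcs {k : ℕ} (g : Fin k → ℕ × ℕ × ℕ × ℕ) (N : ℕ) (w : List (Letter n)) : Prop where
  sparse : Sparse (arcs g w) (arcEnds g) (4 * k)
  unreadable : ∃ u, Red u ∧ ¬ Readable (arcs g w) u
  card_le : (verts (arcs g w)).card ≤ N + 1

/-- The words that have a subword of length `m` which is readable in arcs that come from the
initial subword before it. -/
def Repeats {k : ℕ} (g : Fin k → ℕ × ℕ × ℕ × ℕ) (N c m : ℕ) : Set (List (Letter n)) :=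
  {w | ∃ w₁ w₂ w₃, w = w₁ ++ (w₂ ++ w₃) ∧ w₁.length = c ∧ w₂.length = m ∧ Red w₁ ∧ Red w₂ ∧
    Red w₃ ∧ GoodArcs g N w₁ ∧ Readable (arcs g w₁) w₂}

/-- The names for arcs in the first `N` steps. -/
noncomputable def arcNames (k N : ℕ) : Finset (Fin k → ℕ × ℕ × ℕ × ℕ) :=
  Fintype.piFinset fun _ => Finset.range (N + 1) ×ˢ Finset.range (N + 1) ×ˢ
    Finset.range (N + 1) ×ˢ Finset.range (N + 1)

theorem card_arcNames (k N : ℕ) : (arcNames k N).card = (N + 1) ^ (4 * k) := by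
  rw [arcNames, Fintype.card_piFinset]
  simp only [Finset.card_product, Finset.card_range, Finset.prod_const, Finset.card_univ,
    Fintype.card_fin]
  rw [pow_mul]
  congr 1
  ring

variable {α : ℝ} {N m : ℕ}

/-- The old run after a closing step `c` adds no edges, so its label is readable in the graph traced
by the first `c + 1` steps. That graph is recovered from the prefix and the names of at most `2 * n
- 1` arcs, and as a subgraph it still misses a word. -/
theorem exists_repeats_of_bad (hn : 2 ≤ n) {w : List (Letter n)} (hw : w ∈ Bad n α)
    (hlen : w.length = N) (hm : α * N + (2 * n - 1 : ℕ) * m ≤ N) :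
    ∃ c ∈ (Finset.range N).filter (fun c => c + 1 + m ≤ N),
      ∃ g ∈ arcNames (2 * n - 1) N, w ∈ Repeats g N (c + 1) m := by
  obtain ⟨hred, x, s, hwalk, hws, hcard, hexc, u, hu, hur⟩ := hw
  rw [hlen] at hwalk hws hcard hexc hur
  have hcl : (closings x s N).card ≤ 2 * n - 1 := by
    have := hwalk.card_closings_le N
    omega
  obtain ⟨c, hc, hcm, hold⟩ := hwalk.exists_old_run (m := m) (by
    have h1 : (((trace x s N).card + (closings x s N).card * m : ℕ) : ℝ) < N := by
      push_cast
      have h2 : ((closings x s N).card : ℝ) * m ≤ (2 * n - 1 : ℕ) * m :=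
        mul_le_mul_of_nonneg_right (Nat.cast_le.2 hcl) (Nat.cast_nonneg _)
      linarith
    exact_mod_cast h1)
  have hw₁ : ∀ j ≤ c, (w.take (c + 1))[j]? = some (s j) := by
    intro j hj
    rw [List.getElem?_take_of_lt (by omega), hws j (by omega)]
  obtain ⟨g, hg, hg1, hg2⟩ := hwalk.exists_arcs hc hcl (w.take (c + 1)) hw₁
  refine ⟨c, Finset.mem_filter.2 ⟨Finset.mem_range.2 (by omega), by omega⟩, g, ?_,
    w.take (c + 1), (w.drop (c + 1)).take m, (w.drop (c + 1)).drop m, ?_, ?_, ?_, ?_, ?_, ?_,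
    ⟨?_, ?_, ?_⟩, ?_⟩
  · refine Fintype.mem_piFinset.2 fun i => ?_
    have := hg i
    simp only [Finset.mem_product, Finset.mem_range]
    omega
  · rw [List.take_append_drop, List.take_append_drop]
  · rw [List.length_take]
    omega
  · rw [List.length_take, List.length_drop]
    omega
  · exact hred.infix (List.take_prefix _ _).isInfix
  · exact hred.infix ((List.take_prefix _ _).isInfix.trans (List.drop_suffix _ _).isInfix)
  · exact hred.infix ((List.drop_suffix _ _).isInfix.trans (List.drop_suffix _ _).isInfix)
  · rw [hg1, hg2]
    exact hwalk.sparse hc (by omega) hcl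
  · rw [hg1]
    exact ⟨u, hu, fun h => hur (h.mono (trace_mono (by omega)))⟩
  · rw [hg1]
    refine (Finset.card_le_card verts_trace_subset).trans (Finset.card_image_le.trans ?_)
    rw [Finset.card_range]
    omega
  · rw [hg1]
    have h1 : ((w.drop (c + 1)).take m).length = m := by
      rw [List.length_take, List.length_drop]
      omega
    refine ⟨_, _, reads_of_edges (x := x) (s := s) _ (c + 1) (fun j hj => ?_) fun j hj => ?_⟩
    · have h2 := hws (c + 1 + j) (by omega)
      rw [List.getElem?_eq_getElem (by omega), Option.some_inj] at h2
      rw [List.getElem_take, List.getElem_drop, h2]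
    · rw [h1] at hj
      have h2 := hold (c + 1 + j) (by omega) (by omega)
      have h3 := trace_eq_of_old (x := x) (s := s) (c := c) (j := c + j)
        (fun i hi1 hi2 => hold i hi1 (by omega)) (by omega)
      rwa [← h3, show c + j + 1 = c + 1 + j by omega]

/-- Prefix and suffix are counted as arbitrary reduced words. Once the prefix is fixed, so is the
graph in which the middle part must be readable. -/
theorem wcount_repeats_le {k c r C : ℕ} (hn : 1 ≤ n) (g : Fin k → ℕ × ℕ × ℕ × ℕ)
    (hC : ∀ w : List (Letter n), GoodArcs g N w →
      wcount {w' | Red w' ∧ Readable (arcs g w) w'} m ≤ C) :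
    wcount (Repeats (n := n) g N c m) (c + (m + r)) ≤
      (2 * (2 * n - 1) ^ c) * (C * (2 * (2 * n - 1) ^ r)) := by
  refine (wcount_le_mul (A := {w : List (Letter n) | Red w})
    (B := fun w₁ => {w | GoodArcs g N w₁ ∧ ∃ w₂ w₃, w = w₂ ++ w₃ ∧ w₂.length = m ∧ Red w₂ ∧
      Red w₃ ∧ Readable (arcs g w₁) w₂}) (C := C * (2 * (2 * n - 1) ^ r)) ?_ ?_).trans
    (Nat.mul_le_mul_right _ (wcount_red_le hn c))
  · rintro w ⟨w₁, w₂, w₃, rfl, h1, h2, h3, h4, h5, h6, h7⟩ -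
    exact ⟨w₁, h3, _, ⟨h6, w₂, w₃, rfl, h2, h4, h5, h7⟩, h1, rfl⟩
  · intro w₁ _ _
    by_cases hg : GoodArcs g N w₁
    · refine (wcount_le_mul (A := {w' | Red w' ∧ Readable (arcs g w₁) w'})
        (B := fun _ => {w | Red w}) ?_ fun _ _ _ => wcount_red_le hn r).trans
        (Nat.mul_le_mul_right _ (hC w₁ hg))
      rintro w ⟨-, w₂, w₃, rfl, h1, h2, h3, h4⟩ -
      exact ⟨w₂, ⟨h2, h4⟩, w₃, h3, h1, rfl⟩
    · have h1 : wcount {w | GoodArcs g N w₁ ∧ ∃ w₂ w₃, w = w₂ ++ w₃ ∧ w₂.length = m ∧ Red w₂ ∧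
          Red w₃ ∧ Readable (arcs g w₁) w₂} (m + r) ≤
          wcount (∅ : Set (List (Letter n))) (m + r) := wcount_mono fun w hw _ => absurd hw.1 hg
      refine h1.trans ?_
      simp [wcount]

/-- In the exponent, `4 * (2 * n - 1)` counts the names of the arcs; one further factor stands for
the position of the closing step and one for the number of vertices in `exists_sparse_bound`. -/
theorem exists_wcount_bad_le (hn : 2 ≤ n) (α : ℝ) : ∃ K μ : ℝ, 0 ≤ K ∧ 2 ≤ μ ∧
    μ < (2 * n - 1 : ℕ) ∧ ∀ N m : ℕ, α * N + (2 * n - 1 : ℕ) * m ≤ N →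
      (wcount (Bad n α) N : ℝ) ≤ K * ((N : ℝ) + 2) ^ (4 * (2 * n - 1) + 2) *
        (μ / (2 * n - 1 : ℕ)) ^ m * ((2 * n - 1 : ℕ) : ℝ) ^ N := by
  obtain ⟨K, μ, hK, hμ2, hμ, hb⟩ := exists_sparse_bound (n := n) ℕ hn (4 * (2 * n - 1))
  refine ⟨4 * K, μ, by linarith, hμ2, hμ, fun N m hm => ?_⟩
  obtain ⟨lam, hlam⟩ : ∃ lam, lam = 2 * n - 1 := ⟨_, rfl⟩
  set B : ℝ := ((N : ℝ) + 2) * K * μ ^ m with hB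
  have hμ0 : 0 < μ := by linarith
  have hB0 : 0 ≤ B := by positivity
  have hlam0 : (0 : ℝ) < lam := by
    have : 0 < lam := by omega
    exact_mod_cast this
  have hC : ∀ (g : Fin (2 * n - 1) → ℕ × ℕ × ℕ × ℕ) (w : List (Letter n)), GoodArcs g N w →
      wcount {w' | Red w' ∧ Readable (arcs g w) w'} m ≤ ⌊B⌋₊ := by
    intro g w hg
    refine Nat.le_floor ((hb _ _ hg.sparse hg.unreadable m).trans ?_)
    rw [hB]
    have : ((verts (arcs g w)).card : ℝ) + 1 ≤ N + 2 := by exact_mod_cast Nat.succ_le_succ hg.card_le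
    gcongr
  have h1 : wcount (Bad n α) N ≤
      ∑ c ∈ (Finset.range N).filter (fun c => c + 1 + m ≤ N),
        ∑ g ∈ arcNames (2 * n - 1) N, wcount (Repeats (n := n) g N (c + 1) m) N := by
    refine (wcount_le_sum _ (fun c => {w | ∃ g ∈ arcNames (2 * n - 1) N,
      w ∈ Repeats g N (c + 1) m}) fun w hw hlen =>
      exists_repeats_of_bad hn hw hlen hm).trans (Finset.sum_le_sum fun c _ => ?_)
    exact wcount_le_sum _ _ fun w hw _ => hw
  have h2 : ∀ c ∈ (Finset.range N).filter (fun c => c + 1 + m ≤ N),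
      ∀ g ∈ arcNames (2 * n - 1) N, (wcount (Repeats (n := n) g N (c + 1) m) N : ℝ) ≤
        4 * B * (lam : ℝ) ^ (N - m) := by
    intro c hc g _
    obtain ⟨-, hc⟩ := Finset.mem_filter.1 hc
    obtain ⟨r, rfl⟩ : ∃ r, N = c + 1 + (m + r) := ⟨N - (c + 1 + m), by omega⟩
    have h3 := (wcount_repeats_le (n := n) (c := c + 1) (r := r) (by omega) g (hC g)).trans_eq
      (show _ = 2 * lam ^ (c + 1) * (⌊B⌋₊ * (2 * lam ^ r)) by rw [hlam])
    calc (wcount (Repeats (n := n) g (c + 1 + (m + r)) (c + 1) m) (c + 1 + (m + r)) : ℝ)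
        ≤ ((2 * lam ^ (c + 1)) * (⌊B⌋₊ * (2 * lam ^ r)) : ℕ) := Nat.cast_le.2 h3
      _ = (2 * (lam : ℝ) ^ (c + 1)) * (⌊B⌋₊ * (2 * (lam : ℝ) ^ r)) := by push_cast; ring
      _ ≤ (2 * (lam : ℝ) ^ (c + 1)) * (B * (2 * (lam : ℝ) ^ r)) := by
        gcongr
        exact Nat.floor_le hB0
      _ = 4 * B * ((lam : ℝ) ^ (c + 1) * (lam : ℝ) ^ r) := by ring
      _ = 4 * B * (lam : ℝ) ^ (c + 1 + (m + r) - m) := by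
        rw [← pow_add]
        congr 2
        omega
  rcases lt_or_ge N m with hNm | hmN
  · have h0 : (Finset.range N).filter (fun c => c + 1 + m ≤ N) = ∅ :=
      Finset.filter_eq_empty_iff.2 fun c _ => by omega
    rw [h0, Finset.sum_empty, Nat.le_zero] at h1
    rw [h1, Nat.cast_zero]
    positivity
  have h3 : (lam : ℝ) ^ (N - m) = (lam : ℝ) ^ N / (lam : ℝ) ^ m := by
    rw [eq_div_iff (by positivity), ← pow_add]
    congr 1
    omega
  calc (wcount (Bad n α) N : ℝ)
      ≤ ∑ c ∈ (Finset.range N).filter (fun c => c + 1 + m ≤ N),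
        ∑ g ∈ arcNames (2 * n - 1) N, (wcount (Repeats (n := n) g N (c + 1) m) N : ℝ) := by
        exact_mod_cast h1
    _ ≤ ∑ c ∈ (Finset.range N).filter (fun c => c + 1 + m ≤ N),
        ∑ g ∈ arcNames (2 * n - 1) N, 4 * B * (lam : ℝ) ^ (N - m) :=
        Finset.sum_le_sum fun c hc => Finset.sum_le_sum fun g hg => h2 c hc g hg
    _ = ((Finset.range N).filter (fun c => c + 1 + m ≤ N)).card *
        (((N : ℝ) + 1) ^ (4 * (2 * n - 1)) * (4 * B * (lam : ℝ) ^ (N - m))) := by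
        simp [card_arcNames]
    _ ≤ ((N : ℝ) + 2) * (((N : ℝ) + 2) ^ (4 * (2 * n - 1)) * (4 * B * (lam : ℝ) ^ (N - m))) := by
        have h4 : ((Finset.range N).filter (fun c => c + 1 + m ≤ N)).card ≤ N :=
          (Finset.card_filter_le _ _).trans_eq (Finset.card_range N)
        have h5 : (((Finset.range N).filter (fun c => c + 1 + m ≤ N)).card : ℝ) ≤ N := by
          exact_mod_cast h4
        gcongr <;> linarith
    _ = _ := by
        rw [h3, hB, ← hlam, div_pow]
        ring

theorem tendsto_bad (hn : 2 ≤ n) (hα : α < 1) :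
    Tendsto (fun N : ℕ => (wcount (Bad n α) N : ℝ) / wcount {w : List (Letter n) | Red w} N)
      atTop (𝓝 0) := by
  obtain ⟨K, μ, hK, hμ2, hμ, hb⟩ := exists_wcount_bad_le hn α
  have hlam0 : (0 : ℝ) < (2 * n - 1 : ℕ) := by linarith
  have hr := fun N => le_wcount_red (n := n) (by omega) N
  obtain ⟨lam, hlam⟩ : ∃ lam : ℝ, lam = (2 * n - 1 : ℕ) := ⟨_, rfl⟩
  rw [← hlam] at hμ hlam0
  -- With `m = ⌊β * N⌋` the condition relating `N` and `m` holds, and `m` is still linear in `N`.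
  set β : ℝ := (1 - α) / lam with hβ
  have hβ0 : 0 < β := div_pos (by linarith) hlam0
  set θ : ℝ := μ / lam with hθ
  have hθ0 : 0 < θ := div_pos (by linarith) hlam0
  have hθ1 : θ < 1 := (div_lt_one hlam0).2 hμ
  set ρ : ℝ := θ ^ β with hρ
  have hρ0 : 0 < ρ := Real.rpow_pos_of_pos hθ0 _
  have hρ1 : ρ < 1 := Real.rpow_lt_one hθ0.le hθ1 hβ0
  set p := 4 * (2 * n - 1) + 2
  have hlim : Tendsto (fun N : ℕ => K * θ⁻¹ * (ρ ^ 2)⁻¹ * (((N + 2 : ℕ) : ℝ) ^ p * ρ ^ (N + 2)))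
      atTop (𝓝 0) := by
    have h1 := (tendsto_pow_const_mul_const_pow_of_lt_one p hρ0.le hρ1).comp (tendsto_add_atTop_nat 2)
    simpa using h1.const_mul (K * θ⁻¹ * (ρ ^ 2)⁻¹)
  refine squeeze_zero (fun N => by positivity) (fun N => ?_) hlim
  have hm0 : 0 ≤ β * N := by positivity
  have hm := hb N ⌊β * N⌋₊ (by
    have h1 := Nat.floor_le hm0
    rw [← hlam]
    have h2 : lam * (β * N) = (1 - α) * N := by rw [hβ]; field_simp
    have h3 : lam * ⌊β * N⌋₊ ≤ lam * (β * N) := mul_le_mul_of_nonneg_left h1 hlam0.le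
    linarith)
  have hpow : θ ^ ⌊β * N⌋₊ ≤ θ⁻¹ * ρ ^ N := by
    rw [le_inv_mul_iff₀ hθ0, ← pow_succ', hρ, ← Real.rpow_natCast, ← Real.rpow_natCast,
      ← Real.rpow_mul hθ0.le]
    refine Real.rpow_le_rpow_of_exponent_ge hθ0 hθ1.le ?_
    push_cast
    exact (Nat.lt_floor_add_one _).le
  have hden : lam ^ N ≤ wcount {w : List (Letter n) | Red w} N := by
    rw [hlam]
    exact_mod_cast hr N
  have hden0 : 0 < lam ^ N := by positivity
  rw [← hlam] at hm
  rw [div_le_iff₀ (hden0.trans_le hden)]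
  refine hm.trans ?_
  have h4 : 0 ≤ K * θ⁻¹ * (ρ ^ 2)⁻¹ * (((N + 2 : ℕ) : ℝ) ^ p * ρ ^ (N + 2)) := by positivity
  refine le_trans ?_ (mul_le_mul_of_nonneg_left hden h4)
  refine mul_le_mul_of_nonneg_right ?_ hden0.le
  calc K * ((N : ℝ) + 2) ^ p * θ ^ ⌊β * N⌋₊ ≤ K * ((N : ℝ) + 2) ^ p * (θ⁻¹ * ρ ^ N) := by gcongr
    _ = _ := by
      push_cast
      rw [pow_add ρ]
      field_simp


/-! ### From walks in a graph to named walks -/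

section walk

variable {X : ℕ → V} {s : ℕ → Letter n} {w : List (Letter n)} {α : ℝ}

theorem conn_trace {N : ℕ} : Conn (trace X s N) := by
  have key : ∀ i ≤ N, ∃ w, Reads (trace X s N) (X 0) w (X i) := by
    intro i hi
    have := reads_of_edges (x := X) (s := s) (T := trace X s N) ((List.range i).map s) 0
      (fun j hj => by simp) fun j hj => edge_mem_trace (by simp at hj; omega)
    simp only [List.length_map, List.length_range, Nat.zero_add] at this
    exact ⟨_, this⟩
  intro x hx y hy
  obtain ⟨i, hi, rfl⟩ := Finset.mem_image.1 (verts_trace_subset hx)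
  obtain ⟨j, hj, rfl⟩ := Finset.mem_image.1 (verts_trace_subset hy)
  obtain ⟨w, hw⟩ := key i (Nat.lt_succ_iff.1 (Finset.mem_range.1 hi))
  obtain ⟨w', hw'⟩ := key j (Nat.lt_succ_iff.1 (Finset.mem_range.1 hj))
  exact ⟨winv w ++ w', reads_append.2 ⟨X 0, hw.symm, hw'⟩⟩

/-- Naming the vertices by the times of the first visits. -/
theorem mem_bad_of_walk (hw : Red w) (hws : ∀ j < w.length, w[j]? = some (s j))
    (hcard : ((trace X s w.length).card : ℝ) < α * w.length)
    (hexc : exc (trace X s w.length) ≤ 2 * (n : ℤ) - 2)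
    (hun : ∃ u, Red u ∧ ¬ Readable (trace X s w.length) u) : w ∈ Bad n α := by
  have hex : ∀ j, ∃ i, X i = X j := fun j => ⟨j, rfl⟩
  let x : ℕ → ℕ := fun j => Nat.find (hex j)
  have hXx : ∀ j, X (x j) = X j := fun j => Nat.find_spec (hex j)
  have hxle : ∀ i j, X i = X j → x j ≤ i := fun i j h => Nat.find_min' (hex j) h
  have hxx : ∀ i j, X i = X j → x i = x j := fun i j h =>
    le_antisymm (hxle _ _ ((hXx j).trans h.symm)) (hxle _ _ ((hXx i).trans h))
  have hedge : ∀ j, edge X s j = ((X (edge x s j).1), (edge x s j).2.1, X (edge x s j).2.2) := by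
    intro j
    unfold edge tri
    split_ifs <;> simp [hXx]
  set N := w.length
  have hsub : trace X s N ⊆ (trace x s N).image fun e => (X e.1, e.2.1, X e.2.2) := by
    intro e he
    obtain ⟨j, hj, rfl⟩ := mem_trace.1 he
    exact Finset.mem_image.2 ⟨_, edge_mem_trace hj, (hedge j).symm⟩
  have hsub' : (trace x s N).image (fun e => (X e.1, e.2.1, X e.2.2)) ⊆ trace X s N := by
    intro e he
    obtain ⟨e', he', rfl⟩ := Finset.mem_image.1 he
    obtain ⟨j, hj, rfl⟩ := mem_trace.1 he'
    rw [← hedge j]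
    exact edge_mem_trace hj
  have hxv : ∀ v ∈ verts (trace x s N), x v = v := by
    intro v hv
    obtain ⟨j, -, rfl⟩ := Finset.mem_image.1 (verts_trace_subset hv)
    exact hxx _ _ (hXx j)
  have hinj : ∀ v ∈ verts (trace x s N), ∀ v' ∈ verts (trace x s N), X v = X v' → v = v' := by
    intro v hv v' hv' h
    rw [← hxv v hv, ← hxv v' hv', hxx _ _ h]
  -- Different names belong to different vertices. So the renamed trace has no more edges and no
  -- fewer vertices, and its excess does not increase.
  have hle : (trace x s N).card ≤ (trace X s N).card := by
    refine Finset.card_le_card_of_injOn (fun e => (X e.1, e.2.1, X e.2.2))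
      (fun e he => hsub' (Finset.mem_image_of_mem _ he)) fun e he e' he' h => ?_
    simp only [Prod.mk.injEq] at h
    exact Prod.ext (hinj _ (fst_mem_verts he) _ (fst_mem_verts he') h.1)
      (Prod.ext h.2.1 (hinj _ (snd_mem_verts he) _ (snd_mem_verts he') h.2.2))
  have hverts : (verts (trace X s N)).card ≤ (verts (trace x s N)).card := by
    refine (Finset.card_le_card (t := (verts (trace x s N)).image X) fun v hv => ?_).trans
      Finset.card_image_le
    obtain ⟨e, he, hev⟩ := mem_verts.1 hv
    obtain ⟨e', he', rfl⟩ := Finset.mem_image.1 (hsub he)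
    rcases hev with rfl | rfl
    · exact Finset.mem_image_of_mem _ (fst_mem_verts he')
    · exact Finset.mem_image_of_mem _ (snd_mem_verts he')
  refine ⟨hw, x, s, ⟨fun j => hxle j j rfl, fun j => hxx _ _ (hXx j), fun j hj => ?_⟩, hws, ?_, ?_, ?_⟩
  · have h1 := hws j (by omega)
    have h2 := hws (j + 1) hj
    rw [List.getElem?_eq_getElem (by omega), Option.some_inj] at h1 h2
    rw [← h1, ← h2]
    exact List.isChain_iff_getElem.1 hw j (by omega)
  · exact lt_of_le_of_lt (Nat.cast_le.2 hle) hcard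
  · change exc (trace x s N) ≤ _
    unfold exc at hexc ⊢
    omega
  · obtain ⟨u, hu, hur⟩ := hun
    refine ⟨u, hu, fun ⟨y, z, hr⟩ => hur ⟨X y, X z, hr.map X fun e he => ?_⟩⟩
    exact hsub' (Finset.mem_image_of_mem _ he)

end walk

/-! ### Betti numbers and coverings of the rose -/

/-- The space of 1-cycles has dimension at least the excess plus one. -/
theorem exc_add_one_le_finrank {T : Finset (V × Fin n × V)} (hT : T.Nonempty) :
    exc T + 1 ≤ Module.finrank ℚ (LinearMap.ker (Fintype.linearCombination ℚ
      fun t : T => (Finsupp.single t.1.2.2 1 - Finsupp.single t.1.1 1 : V →₀ ℚ))) := by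
  set D := Fintype.linearCombination ℚ
      fun t : T => (Finsupp.single t.1.2.2 1 - Finsupp.single t.1.1 1 : V →₀ ℚ) with hD
  obtain ⟨e₀, he₀⟩ := hT
  -- Boundaries lie in the span of the differences with one base vertex, so the boundary map has
  -- rank less than the number of vertices; rank-nullity does the rest.
  set F : Finset (V →₀ ℚ) := ((verts T).erase e₀.1).image fun v =>
    Finsupp.single v 1 - Finsupp.single e₀.1 1 with hF
  have hmem : ∀ v ∈ verts T, (Finsupp.single v 1 - Finsupp.single e₀.1 1 : V →₀ ℚ) ∈
      Submodule.span ℚ (F : Set (V →₀ ℚ)) := by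
    intro v hv
    by_cases h : v = e₀.1
    · rw [h, sub_self]
      exact Submodule.zero_mem _
    · exact Submodule.subset_span (Finset.mem_coe.2
        (Finset.mem_image.2 ⟨v, Finset.mem_erase.2 ⟨h, hv⟩, rfl⟩))
  have hrange : LinearMap.range D ≤ Submodule.span ℚ (F : Set (V →₀ ℚ)) := by
    rintro _ ⟨c, rfl⟩
    rw [hD, Fintype.linearCombination_apply]
    refine Submodule.sum_mem _ fun t _ => Submodule.smul_mem _ _ ?_
    have := Submodule.sub_mem _ (hmem _ (snd_mem_verts t.2)) (hmem _ (fst_mem_verts t.2))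
    simpa using this
  have h1 : Module.finrank ℚ (LinearMap.range D) ≤ (verts T).card - 1 := by
    refine (Submodule.finrank_mono hrange).trans ((finrank_span_finset_le_card F).trans ?_)
    refine Finset.card_image_le.trans ?_
    rw [Finset.card_erase_of_mem (fst_mem_verts he₀)]
  have h2 := LinearMap.finrank_range_add_finrank_ker D
  rw [Module.finrank_fintype_fun_eq_card, Fintype.card_coe] at h2
  have h3 : 0 < (verts T).card := Finset.card_pos.2 ⟨_, fst_mem_verts he₀⟩
  unfold exc
  omega

theorem red_iff {w : List (Letter n)} : Red w ↔ ∀ l₁ l₂ e, w ≠ l₁ ++ e :: linv e :: l₂ := by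
  constructor
  · rintro h l₁ l₂ e rfl
    exact (red_cons_cons.1 (h.infix (w' := [e, linv e]) ⟨l₁, l₂, by simp⟩)).1 rfl
  · intro h
    induction w with
    | nil => exact red_nil
    | cons a w ih =>
      have ih := ih fun l₁ l₂ e he => h (a :: l₁) l₂ e (by rw [he]; rfl)
      cases w with
      | nil => exact red_singleton a
      | cons b w => exact red_cons_cons.2 ⟨fun hb => h [] w a (by rw [hb]; rfl), ih⟩

section graph

variable {Γ : SGraph.{u, v}} {f : SGraph.Mor Γ (SGraph.rose n)}

/-- The label of an oriented edge. -/
def label (f : SGraph.Mor Γ (SGraph.rose n)) (e : Γ.E) : Letter n := f.onE e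

/-- The labelled edge underlying an oriented edge of a graph over the rose. -/
def toTri (f : SGraph.Mor Γ (SGraph.rose n)) (e : Γ.E) : Γ.V × Fin n × Γ.V :=
  tri (Γ.ini e) (label f e) (Γ.ter e)

theorem label_inv (e : Γ.E) : label f (Γ.inv e) = linv (label f e) := f.map_inv e

theorem ter_inv (e : Γ.E) : Γ.ter (Γ.inv e) = Γ.ini e := by
  unfold SGraph.ter
  rw [Γ.inv_inv]

theorem toTri_inv (e : Γ.E) : toTri f (Γ.inv e) = toTri f e := by
  rw [toTri, label_inv, ter_inv]
  exact tri_linv _ _ _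

theorem exists_positive (e : Γ.E) : ∃ e' : Γ.E,
    toTri f e = (Γ.ini e', (label f e').1, Γ.ter e') ∧ label f e' = ((toTri f e).2.1, true) := by
  by_cases h : (label f e).2 = true
  · refine ⟨e, ?_, ?_⟩
    · rw [toTri, tri, if_pos h]
    · rw [toTri, tri_label, ← h]
  · refine ⟨Γ.inv e, ?_, ?_⟩
    · rw [toTri, tri, if_neg h, ter_inv, label_inv]
      rfl
    · rw [toTri, tri_label, label_inv, linv]
      simp [h]

theorem isPathFrom_getElem {l : List Γ.E} {x : Γ.V} (h : Γ.IsPathFrom x l) (j : ℕ)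
    (hj : j < l.length) : Γ.ini l[j] = Γ.finishFrom x (l.take j) ∧
      Γ.ter l[j] = Γ.finishFrom x (l.take (j + 1)) := by
  induction l generalizing x j with
  | nil => simp at hj
  | cons e l ih =>
    cases j with
    | zero => exact ⟨h.1, rfl⟩
    | succ j => exact ih h.2 j (by simpa using hj)

/-- The labelled edges of a graph over the rose satisfy the bound for the first Betti number. -/
theorem exc_le_of_betti {T : Finset (Γ.V × Fin n × Γ.V)} (hT : ∀ t ∈ T, ∃ e, toTri f e = t)
    (hne : T.Nonempty) {b : ℕ} (hb : Γ.betti ≤ (b : Cardinal.{v})) : exc T + 1 ≤ b := by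
  have hT' : ∀ t : T, ∃ e : Γ.E, t.1 = (Γ.ini e, (label f e).1, Γ.ter e) ∧
      label f e = (t.1.2.1, true) := by
    rintro ⟨t, ht⟩
    obtain ⟨e, rfl⟩ := hT t ht
    exact exists_positive e
  choose e he he' using hT'
  refine (exc_add_one_le_finrank hne).trans ?_
  set D := Fintype.linearCombination ℚ
      fun t : T => (Finsupp.single t.1.2.2 1 - Finsupp.single t.1.1 1 : Γ.V →₀ ℚ) with hD
  -- A triple is represented by one edge over a positive letter, which becomes the antisymmetric
  -- chain `e - e⁻¹`. By positivity no chosen edge is the inverse of another, whence the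
  -- injectivity.
  set Φ := Fintype.linearCombination ℚ
      fun t : T => (Finsupp.single (e t) 1 - Finsupp.single (Γ.inv (e t)) 1 : Γ.E →₀ ℚ) with hΦ
  have hinj : Function.Injective Φ := by
    refine (injective_iff_map_eq_zero Φ).2 fun c hc => funext fun t => ?_
    have h1 := DFunLike.congr_fun hc (e t)
    rw [hΦ, Fintype.linearCombination_apply, Finsupp.finsetSum_apply, Finset.sum_eq_single t] at h1
    · simpa [Finsupp.single_apply, Γ.inv_ne] using h1
    · intro t' _ htt
      have h2 : e t' ≠ e t := fun h => htt (Subtype.ext (by rw [he t', he t, h]))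
      have h3 : Γ.inv (e t') ≠ e t := by
        intro h
        have h4 := congrArg (label f) h
        rw [label_inv, he' t', he' t] at h4
        simpa [linv] using congrArg Prod.snd h4
      simp [h2, h3]
    · intro h
      exact absurd (Finset.mem_univ t) h
  have hcyc : ∀ c ∈ LinearMap.ker D, Φ c ∈ Γ.cycles := by
    intro c hc
    have hc : D c = 0 := hc
    refine ⟨?_, ?_⟩
    · rw [SetLike.mem_coe, LinearMap.mem_ker, hΦ, Fintype.linearCombination_apply, map_sum]
      refine Finset.sum_eq_zero fun t _ => ?_
      simp [Finsupp.lmapDomain_apply, Finsupp.mapDomain_single, Γ.inv_inv, Finsupp.mapDomain_sub]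
    -- Both `e` and `e⁻¹` contribute `ter e - ini e` to the boundary, which explains the factor 2.
    · have h1 : (Finsupp.lmapDomain ℚ ℚ Γ.ter - Finsupp.lmapDomain ℚ ℚ Γ.ini) (Φ c) =
          (2 : ℚ) • D c := by
        rw [hΦ, hD, Fintype.linearCombination_apply, Fintype.linearCombination_apply, map_sum,
          Finset.smul_sum]
        refine Finset.sum_congr rfl fun t _ => ?_
        have h2 : t.1.2.2 = Γ.ter (e t) := by rw [he t]
        have h3 : t.1.1 = Γ.ini (e t) := by rw [he t]
        have h4 : Γ.ini (Γ.inv (e t)) = Γ.ter (e t) := rfl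
        rw [map_smul, smul_comm, h2, h3, LinearMap.sub_apply, map_sub, map_sub]
        simp only [Finsupp.lmapDomain_apply, Finsupp.mapDomain_single, ter_inv, h4]
        congr 1
        module
      rw [SetLike.mem_coe, LinearMap.mem_ker, h1, hc, smul_zero]
  let Ψ : LinearMap.ker D →ₗ[ℚ] Γ.cycles :=
    (Φ.comp (LinearMap.ker D).subtype).codRestrict Γ.cycles fun c => hcyc c.1 c.2
  have hΨ : Function.Injective Ψ := by
    intro c c' h
    exact Subtype.ext (hinj (congrArg Subtype.val h))
  have h1 := LinearMap.lift_rank_le_of_injective Ψ hΨ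
  rw [← Module.finrank_eq_rank] at h1
  have h2 := h1.trans (Cardinal.lift_le.2 hb)
  simp only [Cardinal.lift_natCast, Nat.cast_le] at h2
  exact_mod_cast h2

/-- A family of edges that looks like a covering of the rose gives a subgraph that covers it. -/
theorem exists_covering {B : Type*} [Nonempty B] (c : B → Γ.V) (hc : Function.Injective c)
    (σ : Fin n → Equiv.Perm B) (e : Fin n → B → Γ.E) (hini : ∀ i b, Γ.ini (e i b) = c b)
    (hter : ∀ i b, Γ.ter (e i b) = c (σ i b)) (hon : ∀ i b, label f (e i b) = (i, true)) :
    ∃ Γ' : Γ.Sub, (Γ'.restrict f).IsCovering ∧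
      ∀ y, ((Γ'.restrict f).onV ⁻¹' {y}).encard = ENat.card B := by
  have hon' : ∀ i b, label f (Γ.inv (e i b)) = (i, false) := fun i b => by
    rw [label_inv, hon]
    rfl
  let Γ' : Γ.Sub :=
    { verts := Set.range c
      edges := {a | ∃ i b, a = e i b ∨ a = Γ.inv (e i b)}
      inv_mem := by
        rintro _ ⟨i, b, rfl | rfl⟩
        · exact ⟨i, b, .inr rfl⟩
        · exact ⟨i, b, .inl (Γ.inv_inv _)⟩
      ini_mem := by
        rintro _ ⟨i, b, rfl | rfl⟩
        · exact ⟨b, (hini i b).symm⟩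
        · exact ⟨σ i b, (hter i b).symm⟩ }
  obtain ⟨b₀⟩ := ‹Nonempty B›
  refine ⟨Γ', ⟨fun y => ⟨⟨c b₀, b₀, rfl⟩, rfl⟩, ?_, ?_⟩, fun y => ?_⟩
  · rintro ⟨i, b⟩
    cases b
    · exact ⟨⟨Γ.inv (e i b₀), i, b₀, .inr rfl⟩, hon' i b₀⟩
    · exact ⟨⟨e i b₀, i, b₀, .inl rfl⟩, hon i b₀⟩
  · rintro ⟨_, b, rfl⟩
    refine ⟨fun a _ => rfl, ?_, ?_⟩
    · rintro ⟨a, ha⟩ g1 ⟨a', ha'⟩ g2 g3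
      have h1 : Γ.ini a = c b := congrArg Subtype.val g1
      have h2 : Γ.ini a' = c b := congrArg Subtype.val g2
      have h3 : label f a = label f a' := g3
      clear g1 g2 g3
      obtain ⟨i, d, rfl | rfl⟩ := ha <;> obtain ⟨i', d', rfl | rfl⟩ := ha'
      · rw [hon, hon, Prod.mk.injEq] at h3
        rw [hini] at h1 h2
        obtain rfl := hc h1
        obtain rfl := hc h2
        obtain rfl := h3.1
        rfl
      · rw [hon, hon', Prod.mk.injEq] at h3
        exact absurd h3.2 (by simp)
      · rw [hon, hon', Prod.mk.injEq] at h3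
        exact absurd h3.2 (by simp)
      · rw [hon', hon', Prod.mk.injEq] at h3
        obtain rfl := h3.1
        have h4 : Γ.ter (e i d) = Γ.ter (e i d') := h1.trans h2.symm
        rw [hter, hter] at h4
        obtain rfl := (σ i).injective (hc h4)
        rfl
    · rintro ⟨i, d⟩ -
      cases d
      · refine ⟨⟨Γ.inv (e i ((σ i).symm b)), i, _, .inr rfl⟩, Subtype.ext ?_, hon' i _⟩
        exact (hter i _).trans (by rw [Equiv.apply_symm_apply])
      · exact ⟨⟨e i b, i, b, .inl rfl⟩, Subtype.ext (hini i b), hon i b⟩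
  · have h1 : (Γ'.restrict f).onV ⁻¹' {y} = Set.univ := Set.eq_univ_of_forall fun _ => rfl
    rw [h1, Set.encard_univ]
    exact (ENat.card_congr (Equiv.ofInjective c hc)).symm

theorem exists_covering_one {T : Finset (Γ.V × Fin n × Γ.V)} (hT : ∀ t ∈ T, ∃ e, toTri f e = t)
    (h : HasRose Finset.univ T) : ∃ Γ' : Γ.Sub, (Γ'.restrict f).IsCoveringOfDegree 1 := by
  obtain ⟨x, hx⟩ := h
  have h1 : ∀ i : Fin n, ∃ e : Γ.E, Γ.ini e = x ∧ Γ.ter e = x ∧ label f e = (i, true) := by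
    intro i
    obtain ⟨e, he⟩ := hT _ (hx i (Finset.mem_univ i))
    obtain ⟨e', h1, h2⟩ := exists_positive (f := f) e
    rw [he] at h1 h2
    exact ⟨e', (congrArg (fun t => t.1) h1).symm, (congrArg (fun t => t.2.2) h1).symm, h2⟩
  choose e h1 h2 h3 using h1
  obtain ⟨Γ', h4, h5⟩ := exists_covering (B := Unit) (f := f) (fun _ => x)
    (fun _ _ _ => rfl) (fun _ => 1) (fun i _ => e i) (fun i _ => h1 i) (fun i _ => h2 i)
    (fun i _ => h3 i)
  exact ⟨Γ', h4, fun y => by rw [h5]; simp⟩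

theorem exists_covering_two {T : Finset (Γ.V × Fin n × Γ.V)} (hT : ∀ t ∈ T, ∃ e, toTri f e = t)
    (h : HasDouble Finset.univ T) : ∃ Γ' : Γ.Sub, (Γ'.restrict f).IsCoveringOfDegree 2 := by
  obtain ⟨c, hc, s, hs⟩ := h
  have h1 : ∀ (i : Fin n) (b : Bool), ∃ e : Γ.E, Γ.ini e = c b ∧ Γ.ter e = c (xor b (s i)) ∧
      label f e = (i, true) := by
    intro i b
    obtain ⟨e, he⟩ := hT _ (hs i (Finset.mem_univ i) b)
    obtain ⟨e', h1, h2⟩ := exists_positive (f := f) e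
    rw [he] at h1 h2
    exact ⟨e', (congrArg (fun t => t.1) h1).symm, (congrArg (fun t => t.2.2) h1).symm, h2⟩
  choose e h1 h2 h3 using h1
  obtain ⟨Γ', h4, h5⟩ := exists_covering (B := Bool) (f := f) c hc
    (fun i => ⟨fun b => xor b (s i), fun b => xor b (s i), fun b => by simp, fun b => by simp⟩)
    e h1 h2 h3
  exact ⟨Γ', h4, fun y => by rw [h5]; simp⟩

/-- A topological edge determines its triple, so identifying parallel edges with equal labels can
only reduce the count. -/
theorem card_trace_le {t : Γ.EdgePath} {T : Finset (Γ.V × Fin n × Γ.V)}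
    (hT : ∀ a ∈ T, ∃ e ∈ t.edges, toTri f e = a) : T.card ≤ t.crossed.ncard := by
  choose e he he' using hT
  have hfin : t.crossed.Finite := by
    refine (t.edges.finite_toSet.image Γ.topEdge).subset ?_
    rintro _ ⟨e, he, rfl⟩
    exact ⟨e, he, rfl⟩
  rw [Set.ncard_eq_toFinset_card _ hfin, ← Finset.card_attach]
  refine Finset.card_le_card_of_injOn (fun a => Γ.topEdge (e a.1 a.2)) (fun a _ => ?_) ?_
  · rw [Set.Finite.coe_toFinset]
    exact ⟨_, he a.1 a.2, rfl⟩
  · rintro ⟨a, ha⟩ - ⟨a', ha'⟩ - h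
    refine Subtype.ext ((he' a ha).symm.trans (Eq.trans ?_ (he' a' ha')))
    rcases Sym2.eq_iff.1 h with ⟨h1, -⟩ | ⟨h1, -⟩
    · exact congrArg (toTri f) h1
    · dsimp only at h1
      rw [h1, toTri_inv]

/-- A path that lifts a word outside of `Bad n α` is `α`-injective. -/
theorem isAlphaInjective_of_notMem_bad (hn : 2 ≤ n) {α : ℝ}
    (hb : Γ.betti ≤ ((2 * n - 1 : ℕ) : Cardinal.{v}))
    (hcov : ¬ ∃ Γ' : Γ.Sub, (Γ'.restrict f).IsCoveringOfDegree 1 ∨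
      (Γ'.restrict f).IsCoveringOfDegree 2)
    (t : Γ.EdgePath) (hred : Red (t.edges.map (label f)))
    (hbad : t.edges.map (label f) ∉ Bad n α) : t.IsAlphaInjective α := by
  have : NeZero n := ⟨by omega⟩
  by_contra hinj
  rw [SGraph.EdgePath.IsAlphaInjective, not_le] at hinj
  have hne : t.edges ≠ [] := by
    intro h
    have h1 : t.length = 0 := by simp [SGraph.EdgePath.length, h]
    have h2 : (0 : ℝ) ≤ t.crossed.ncard := Nat.cast_nonneg _
    rw [h1, Nat.cast_zero, mul_zero] at hinj
    linarith
  set w := t.edges.map (label f) with hw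
  have hlen : w.length = t.edges.length := by simp [hw]
  set X : ℕ → Γ.V := fun j => Γ.finishFrom t.start (t.edges.take j) with hX
  -- The default letter beyond the end of `w` is never read.
  set s : ℕ → Letter n := fun j => w.getD j (0, true) with hs
  have hws : ∀ j < w.length, w[j]? = some (s j) := fun j hj => by
    rw [List.getElem?_eq_getElem hj, hs]
    simp [hj]
  have hedge : ∀ j, ∀ hj : j < t.edges.length, edge X s j = toTri f t.edges[j] := by
    intro j hj
    obtain ⟨h1, h2⟩ := isPathFrom_getElem t.isPath j hj
    have h3 := hws j (by omega)
    rw [List.getElem?_eq_getElem (by omega), Option.some_inj] at h3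
    rw [edge, toTri, h1, h2, ← h3]
    simp [hw, hX]
  have hT : ∀ a ∈ trace X s w.length, ∃ e ∈ t.edges, toTri f e = a := by
    intro a ha
    obtain ⟨j, hj, rfl⟩ := mem_trace.1 ha
    exact ⟨t.edges[j], List.getElem_mem _, (hedge j (by omega)).symm⟩
  have hT' : ∀ a ∈ trace X s w.length, ∃ e, toTri f e = a := fun a ha =>
    let ⟨e, _, h⟩ := hT a ha
    ⟨e, h⟩
  have hexc : exc (trace X s w.length) + 1 ≤ (2 * n - 1 : ℕ) := by
    refine exc_le_of_betti hT' ⟨edge X s 0, edge_mem_trace ?_⟩ hb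
    rw [hlen]
    exact List.length_pos_iff.2 hne
  have hexc' : exc (trace X s w.length) ≤ 2 * (n : ℤ) - 2 := by omega
  refine hbad (mem_bad_of_walk hred hws (lt_of_le_of_lt (Nat.cast_le.2 (card_trace_le hT)) ?_)
    hexc' ?_)
  · rw [hlen]
    exact hinj
  -- If the trace read every reduced word, it would contain a rose or a double cover, and so `Γ`
  -- would have a forbidden subgraph.
  · by_contra! hread
    rcases hasRose_or_hasDouble (J := Finset.univ) conn_trace (by simpa using hn)
      (fun u _ hu _ => hread u hu) (by simpa using hexc') with h | h
    · obtain ⟨Γ', h⟩ := exists_covering_one hT' h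
      exact hcov ⟨Γ', .inl h⟩
    · obtain ⟨Γ', h⟩ := exists_covering_two hT' h
      exact hcov ⟨Γ', .inr h⟩

end graph

/-! ### Genericity of the complement of the bad words -/

section rose

theorem isPathFrom_rose (x : Unit) (l : List (Letter n)) : (SGraph.rose n).IsPathFrom x l := by
  induction l generalizing x with
  | nil => trivial
  | cons e l ih => exact ⟨rfl, ih _⟩

/-- The word of a path in the rose. -/
def toWord (s : (SGraph.rose n).EdgePath) : List (Letter n) := s.edges

theorem toWord_injective : Function.Injective (toWord (n := n)) := fun _ _ h =>
  SGraph.EdgePath.ext rfl h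

theorem toWord_surjective : Function.Surjective (toWord (n := n)) := fun w =>
  ⟨⟨(), w, isPathFrom_rose _ w⟩, rfl⟩

theorem isReduced_iff {s : (SGraph.rose n).EdgePath} : s.IsReduced ↔ Red (toWord s) :=
  red_iff.symm

theorem ncard_eq_wcount (A : Set (List (Letter n))) (N : ℕ) :
    {s : (SGraph.rose n).EdgePath | toWord s ∈ A ∧ s.length = N}.ncard = wcount A N := by
  rw [wcount_eq_ncard, ← Set.ncard_image_of_injective _ toWord_injective]
  congr 1
  ext w
  constructor
  · rintro ⟨s, ⟨h1, h2⟩, rfl⟩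
    exact ⟨h1, h2⟩
  · rintro ⟨h1, h2⟩
    obtain ⟨s, rfl⟩ := toWord_surjective w
    exact ⟨s, ⟨h1, h2⟩, rfl⟩

theorem wcount_diff {A B : Set (List (Letter n))} (h : B ⊆ A) (N : ℕ) :
    wcount (A \ B) N + wcount B N = wcount A N := by
  have hfin : {w : List (Letter n) | w.length = N}.Finite := List.finite_length_eq (Letter n) N
  rw [wcount_eq_ncard, wcount_eq_ncard, wcount_eq_ncard, ← Set.ncard_union_eq
    (Set.disjoint_sdiff_left.mono Set.inter_subset_left Set.inter_subset_left)
    (hfin.subset Set.inter_subset_right) (hfin.subset Set.inter_subset_right),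
    ← Set.union_inter_distrib_right, Set.sdiff_union_of_subset h]

theorem isGeneric_of_bad (hn : 2 ≤ n) {α : ℝ} (hα : α < 1) :
    SGraph.IsGeneric n {s | s.IsReduced ∧ toWord s ∉ Bad n α} := by
  refine ⟨fun s hs => hs.1, ?_⟩
  have h1 : ∀ N, ({s | s.IsReduced ∧ toWord s ∉ Bad n α} ∩
      SGraph.reducedPathsOfLength n N).ncard = wcount ({w | Red w} \ Bad n α) N := by
    intro N
    rw [← ncard_eq_wcount]
    congr 1
    ext s
    simp only [SGraph.reducedPathsOfLength, Set.mem_inter_iff, Set.mem_ofPred_eq, Set.mem_sdiff,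
      isReduced_iff]
    tauto
  have h2 : ∀ N, (SGraph.reducedPathsOfLength n N).ncard = wcount {w : List (Letter n) | Red w} N := by
    intro N
    rw [← ncard_eq_wcount]
    congr 1
    ext s
    simp only [SGraph.reducedPathsOfLength, Set.mem_ofPred_eq, isReduced_iff]
  have h3 := (tendsto_bad hn hα).const_sub 1
  rw [sub_zero] at h3
  refine h3.congr fun N => ?_
  have h4 : 0 < wcount {w : List (Letter n) | Red w} N :=
    lt_of_lt_of_le (pow_pos (by omega) N) (le_wcount_red (by omega) N)
  have h5 : (0 : ℝ) < wcount {w : List (Letter n) | Red w} N := by exact_mod_cast h4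
  have h6 := wcount_diff (A := {w | Red w}) (B := Bad n α) (fun w hw => hw.1) N
  rw [h1, h2, eq_div_iff h5.ne', sub_mul, div_mul_cancel₀ _ h5.ne', one_mul, ← h6]
  push_cast
  ring

end rose

end Labelled
theorem mainTheorem4 (n : ℕ) (hn : 2 ≤ n) (α : ℝ) (hα₀ : 0 ≤ α) (hα₁ : α < 1) :
    ∃ S : Set (SGraph.rose n).EdgePath, SGraph.IsGeneric n S ∧
      ∀ (Γ : SGraph.{u, v}) (v₀ : Γ.V) (f : SGraph.Mor Γ (SGraph.rose n)),
        Γ.IsCorePair v₀ →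
        Γ.betti ≤ ((2 * n - 1 : ℕ) : Cardinal.{v}) →
        (¬ ∃ Γ' : Γ.Sub, (Γ'.restrict f).IsCoveringOfDegree 1 ∨
          (Γ'.restrict f).IsCoveringOfDegree 2) →
        ∀ s ∈ S, ∀ t : Γ.EdgePath, f.mapPath t = s → t.IsAlphaInjective α := by
  refine ⟨{s | s.IsReduced ∧ Labelled.toWord s ∉ Labelled.Bad n α},
    Labelled.isGeneric_of_bad hn hα₁, ?_⟩
  rintro Γ v₀ f - hb hcov s ⟨hs, hbad⟩ t rfl
  exact Labelled.isAlphaInjective_of_notMem_bad hn hb hcov t (Labelled.isReduced_iff.1 hs) hbad
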